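/- Let $1\le m<n$ be integers, $\Omega\subset\mathbb C^n$ open, and let $d^c=\frac{i}{4\pi}(\bar\partial-\partial)$, so that $dd^c=\frac{i}{2\pi}\partial\bar\partial$, and $\beta=dd^c|z|^2$. A real $(1,1)$-form $\alpha$ is called $m$-positive if $\alpha^j\wedge\beta^{n-j}\ge0$ for $1\le j\le m$. Let $\varphi:\Omega\to\mathbb R\cup\{-\infty\}$ be $m$-subharmonic, that is: $\varphi$ is subharmonic (and not identically $-\infty$ on any connected component of $\Omega$), and $dd^c\varphi$ is an $m$-positive current, $$\langle dd^c\varphi\wedge\beta^{n-m},\ \chi\,\alpha_1\wedge\dots\wedge\alpha_{m-1}\rangle\ge 0$$ for all smooth compactly supported functions $\chi\ge0$ on $\Omega$ and all smooth $m$-positive $(1,1)$-forms $\alpha_1,\dots,\alpha_{m-1}$ on $\Omega$. For $a\in\Omega$ and $r>0$ put $$\phi_m(r)=-\frac{1}{(\frac nm-1)\,r^{2(\frac nm-1)}},\qquad \nu_\varphi(a,r)=\frac1{r^{\frac{2n}{m}(m-1)}}\int_{\mathbb B(a,r)}dd^c\varphi\wedge\beta^{n-1},$$ $$\lambda(\varphi,a,r)=\frac{(n-1)!}{2\pi^nr^{2n-1}}\int_{\mathbb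 S(a,r)}\varphi\,d\sigma,\qquad \Lambda(\varphi,a,r)=\frac{n!}{\pi^nr^{2n}}\int_{\mathbb B(a,r)}\varphi\,dV .$$ Then $dd^c\varphi\wedge\beta^{n-1}$ is (represented by) a unique positive measure on $\Omega$ that is finite on compact subsets, and $\varphi$ is integrable on $\mathbb S(a,r)$ and on $\mathbb B(a,r)$ whenever the closed ball of radius $r$ around $a$ lies in $\Omega$. For every $a\in\Omega$ the Lelong number $\nu_\varphi(a)=\lim_{r\to0^+}\nu_\varphi(a,r)$ exists in $[0,+\infty)$, the two limits below exist, and $$\nu_\varphi(a)=\lim_{r\to0^+}\frac{\lambda(\varphi,a,r)}{\phi_m(r)}=\frac1n\Big(n-\frac nm+1\Big)\lim_{r\to0^+}\frac{\Lambda(\varphi,a,r)}{\phi_m(r)} .$$ In particular $\nu_\varphi(a)=0$ if $\varphi$ is bounded near $a$. Moreover, on the set of those $r>0$ for which the closed ball of radius $r$ around $a$ lies in $\Omega$, the mean $\lambda(\varphi,a,r)$ is a convex increasing (that is, nondecreasing) function of $\phi_m(r)$. -/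

import Mathlib

open MeasureTheory Filter Topology Metric
open scoped ContDiff

noncomputable section

namespace MSubharmonic

/-- The space `ℂⁿ` with its Euclidean norm and Lebesgue measure. -/
abbrev Cn (n : ℕ) : Type := EuclideanSpace ℂ (Fin n)

/-! ### Wirtinger derivatives -/

/-- `∂f/∂z_j = (∂f/∂x_j - i ∂f/∂y_j) / 2`. -/
def dz {n : ℕ} (j : Fin n) (f : Cn n → ℂ) (z : Cn n) : ℂ :=
  (1 / 2 : ℂ) * (fderiv ℝ f z (EuclideanSpace.single j 1)
    - Complex.I * fderiv ℝ f z (EuclideanSpace.single j Complex.I))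

/-- `∂f/∂z̄_j = (∂f/∂x_j + i ∂f/∂y_j) / 2`. -/
def dzbar {n : ℕ} (j : Fin n) (f : Cn n → ℂ) (z : Cn n) : ℂ :=
  (1 / 2 : ℂ) * (fderiv ℝ f z (EuclideanSpace.single j 1)
    + Complex.I * fderiv ℝ f z (EuclideanSpace.single j Complex.I))

/-! ### Forms

A `(1,1)`-covector `(i/2π) ∑ A_{jk} dz_j ∧ dz̄_k` is represented by the matrix `A`; it is real exactly
when `A` is Hermitian. In this normalisation (`dd^c = (i/2π) ∂∂̄`) the form `dd^c u` is represented
by the complex Hessian `(∂²u/∂z_j∂z̄_k)`, and `β = dd^c |z|²` by the identity matrix. -/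

/-- The coefficient, with respect to Lebesgue measure, of the top degree form
`α_0 ∧ ⋯ ∧ α_{n-1}`, where `α_i = (i/2π) ∑ (A i)_{jk} dz_j ∧ dz̄_k`. One expands the product and uses
`(i/2) dz_1 ∧ dz̄_1 ∧ ⋯ ∧ (i/2) dz_n ∧ dz̄_n = dV`. -/
def wedgeTop {n : ℕ} (A : Fin n → Matrix (Fin n) (Fin n) ℂ) : ℂ :=
  ((Real.pi : ℂ) ^ n)⁻¹ * ∑ σ : Equiv.Perm (Fin n), ∑ τ : Equiv.Perm (Fin n),
    ((Equiv.Perm.sign σ : ℤ) : ℂ) * ((Equiv.Perm.sign τ : ℤ) : ℂ) * ∏ i, A i (σ i) (τ i)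

/-- A real `(1,1)`-covector `α` is `m`-positive if `α^j ∧ β^{n-j} ≥ 0` for `1 ≤ j ≤ m`. -/
def IsMPositive {n : ℕ} (m : ℕ) (A : Matrix (Fin n) (Fin n) ℂ) : Prop :=
  A.IsHermitian ∧
    ∀ j : ℕ, 1 ≤ j → j ≤ m → 0 ≤ (wedgeTop (fun i : Fin n => if (i : ℕ) < j then A else 1)).re

/-- The `n` factors of `θ ∧ α_1 ∧ ⋯ ∧ α_{m-1} ∧ β^{n-m}`. -/
def factors {n : ℕ} (m : ℕ) (θ : Matrix (Fin n) (Fin n) ℂ) (A : ℕ → Matrix (Fin n) (Fin n) ℂ) :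
    Fin n → Matrix (Fin n) (Fin n) ℂ :=
  fun i => if (i : ℕ) = 0 then θ else if (i : ℕ) < m then A i else 1

/-- The density with respect to Lebesgue measure of
`dd^c (χ α_1 ∧ ⋯ ∧ α_{m-1}) ∧ β^{n-m} = dd^c (χ α_1 ∧ ⋯ ∧ α_{m-1} ∧ β^{n-m})`.
Here `Θ = χ α_1 ∧ ⋯ ∧ α_{m-1} ∧ β^{n-m}` is a form of bidegree `(n-1,n-1)`; if `Θ^{jk}` denotes the
coefficient of `(i/2π) dz_j ∧ dz̄_k ∧ Θ`, then `dd^c Θ` has the density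
`∑ ∂²Θ^{jk}/∂z_j∂z̄_k`. For real forms this is real. -/
def ddcDensity {n : ℕ} (m : ℕ) (χ : Cn n → ℝ) (α : ℕ → Cn n → Matrix (Fin n) (Fin n) ℂ)
    (z : Cn n) : ℝ :=
  (∑ j : Fin n, ∑ k : Fin n, dz j (dzbar k (fun w =>
    (χ w : ℂ) * wedgeTop (factors m (Matrix.single j k 1) (fun i => α i w)))) z).re

/-! ### Test functions and the current `dd^c φ` -/

/-- Real valued smooth functions with compact support contained in `Ω`. -/
def IsTest {n : ℕ} (Ω : Set (Cn n)) (χ : Cn n → ℝ) : Prop :=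
  ContDiff ℝ ∞ χ ∧ HasCompactSupport χ ∧ tsupport χ ⊆ Ω

/-- The value `⟨dd^c φ ∧ β^{n-m}, χ α_1 ∧ ⋯ ∧ α_{m-1}⟩ = ∫ φ dd^c (χ α_1 ∧ ⋯ ∧ α_{m-1}) ∧ β^{n-m}`
of the current `dd^c φ`. -/
def ddcPairing {n : ℕ} (m : ℕ) (Ω : Set (Cn n)) (φ : Cn n → EReal) (χ : Cn n → ℝ)
    (α : ℕ → Cn n → Matrix (Fin n) (Fin n) ℂ) : ℝ :=
  ∫ z in Ω, (φ z).toReal * ddcDensity m χ α z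

/-- `dd^c φ` is an `m`-positive current on `Ω`: `⟨dd^c φ ∧ β^{n-m}, α⟩ ≥ 0` for all strongly
`m`-positive test forms `α` of bidegree `(m-1,m-1)`. These are the sums of forms
`χ α_1 ∧ ⋯ ∧ α_{m-1}` with a test function `χ ≥ 0` and smooth `m`-positive `(1,1)`-forms `α_k`, so
that by linearity one such product suffices. For `m = 1` the product is `χ` alone. -/
def IsMPositiveDdc {n : ℕ} (m : ℕ) (Ω : Set (Cn n)) (φ : Cn n → EReal) : Prop :=
  ∀ (χ : Cn n → ℝ) (α : ℕ → Cn n → Matrix (Fin n) (Fin n) ℂ),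
    IsTest Ω χ → (∀ z, 0 ≤ χ z) →
    (∀ k, 1 ≤ k → k < m →
      (∀ i j, ContDiffOn ℝ ∞ (fun z => α k z i j) Ω) ∧ ∀ z ∈ Ω, IsMPositive m (α k z)) →
    0 ≤ ddcPairing m Ω φ χ α

/-! ### Subharmonic functions -/

/-- Surface measure of the unit sphere of `ℂⁿ`. -/
def unitSphereMeasure (n : ℕ) : Measure (sphere (0 : Cn n) 1) :=
  (volume : Measure (Cn n)).toSphere

/-- The mean value of `φ` over the sphere `S(a,r)` as an extended real number, the integral being
the difference of the integrals of the positive and of the negative part. (The function `φ` will be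
bounded above on `S(a,r)`.) -/
def sphereMeanE {n : ℕ} (φ : Cn n → EReal) (a : Cn n) (r : ℝ) : EReal :=
  let μ := (unitSphereMeasure n Set.univ)⁻¹ • unitSphereMeasure n
  ((∫⁻ ξ : sphere (0 : Cn n) 1, (φ (a + r • (ξ : Cn n))).toENNReal ∂μ : ENNReal) : EReal)
    - ((∫⁻ ξ : sphere (0 : Cn n) 1, (-φ (a + r • (ξ : Cn n))).toENNReal ∂μ : ENNReal) : EReal)

/-- Subharmonic functions `φ : Ω → ℝ ∪ {-∞}`: upper semicontinuous, satisfying the sub-mean value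
inequality, and not identically `-∞` on any connected component of `Ω`. -/
structure IsSubharmonic {n : ℕ} (Ω : Set (Cn n)) (φ : Cn n → EReal) : Prop where
  ne_top : ∀ z ∈ Ω, φ z ≠ ⊤
  usc : UpperSemicontinuousOn φ Ω
  not_bot : ∀ a ∈ Ω, ∃ z ∈ connectedComponentIn Ω a, φ z ≠ ⊥
  submean : ∀ a r, 0 < r → closedBall a r ⊆ Ω → φ a ≤ sphereMeanE φ a r

/-- `m`-subharmonic functions: `φ` is subharmonic and `dd^c φ` is an `m`-positive current. -/
structure IsMSubharmonic {n : ℕ} (m : ℕ) (Ω : Set (Cn n)) (φ : Cn n → EReal) : Prop where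
  subharmonic : IsSubharmonic Ω φ
  mpositive : IsMPositiveDdc m Ω φ

/-! ### Lelong numbers -/

/-- `μ` is the measure `dd^c φ ∧ β^{n-1}` on `Ω` (extended by zero outside of `Ω`): it is finite on
compact subsets of `Ω` and `∫ χ dμ = ∫ φ dd^c χ ∧ β^{n-1}` for all test functions `χ`. -/
structure IsTraceMeasure {n : ℕ} (Ω : Set (Cn n)) (φ : Cn n → EReal) (μ : Measure (Cn n)) :
    Prop where
  compl_eq_zero : μ Ωᶜ = 0
  finite : ∀ K, IsCompact K → K ⊆ Ω → μ K < ⊤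
  integral_eq : ∀ χ, IsTest Ω χ → ∫ z, χ z ∂μ = ddcPairing 1 Ω φ χ (fun _ _ => 1)

open Classical in
/-- The measure `dd^c φ ∧ β^{n-1}` on `Ω` (zero if there is none). -/
def traceMeasure {n : ℕ} (Ω : Set (Cn n)) (φ : Cn n → EReal) : Measure (Cn n) :=
  if h : ∃ μ, IsTraceMeasure Ω φ μ then h.choose else 0

/-- `ν_φ(a,r) = r^{-(2n/m)(m-1)} ∫_{B(a,r)} dd^c φ ∧ β^{n-1}`. -/
def lelongFunction {n : ℕ} (m : ℕ) (Ω : Set (Cn n)) (φ : Cn n → EReal) (a : Cn n) (r : ℝ) : ℝ :=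
  1 / r ^ ((2 * n / m : ℝ) * (m - 1)) * (traceMeasure Ω φ).real (ball a r)

/-- `ν` is the Lelong number `ν_φ(a) = lim_{r → 0+} ν_φ(a,r)`. -/
def HasLelongNumber {n : ℕ} (m : ℕ) (Ω : Set (Cn n)) (φ : Cn n → EReal) (a : Cn n) (ν : ℝ) :
    Prop :=
  Tendsto (lelongFunction m Ω φ a) (𝓝[>] 0) (𝓝 ν)

/-! ### Mean values -/

/-- `φ_m(r) = -1 / ((n/m - 1) r^{2(n/m - 1)})`. -/
def phi (n m : ℕ) (r : ℝ) : ℝ :=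
  -(1 / (((n / m : ℝ) - 1) * r ^ (2 * ((n / m : ℝ) - 1))))

/-- `λ(φ,a,r) = (n-1)! / (2 π^n r^{2n-1}) ∫_{S(a,r)} φ dσ`, where the sphere `S(a,r)` is parametrised
by the unit sphere, the surface measure of which is multiplied by `r^{2n-1}`. -/
def sphereMean {n : ℕ} (φ : Cn n → EReal) (a : Cn n) (r : ℝ) : ℝ :=
  ((n - 1).factorial : ℝ) / (2 * Real.pi ^ n * r ^ (2 * n - 1))
    * (r ^ (2 * n - 1) * ∫ ξ : sphere (0 : Cn n) 1, (φ (a + r • (ξ : Cn n))).toReal ∂(unitSphereMeasure n))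

/-- `Λ(φ,a,r) = n! / (π^n r^{2n}) ∫_{B(a,r)} φ dV`. -/
def ballMean {n : ℕ} (φ : Cn n → EReal) (a : Cn n) (r : ℝ) : ℝ :=
  (n.factorial : ℝ) / (Real.pi ^ n * r ^ (2 * n)) * ∫ z in ball a r, (φ z).toReal

/-- `φ` is finite almost everywhere and integrable on the sphere `S(a,r)`. -/
def SphereIntegrable {n : ℕ} (φ : Cn n → EReal) (a : Cn n) (r : ℝ) : Prop :=
  (∀ᵐ ξ : sphere (0 : Cn n) 1 ∂(unitSphereMeasure n), φ (a + r • (ξ : Cn n)) ≠ ⊥) ∧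
    Integrable (fun ξ : sphere (0 : Cn n) 1 => (φ (a + r • (ξ : Cn n))).toReal)
      (unitSphereMeasure n)

/-- `φ` is finite almost everywhere and integrable on the ball `B(a,r)`. -/
def BallIntegrable {n : ℕ} (φ : Cn n → EReal) (a : Cn n) (r : ℝ) : Prop :=
  (∀ᵐ z ∂(volume.restrict (ball a r)), φ z ≠ ⊥) ∧
    IntegrableOn (fun z => (φ z).toReal) (ball a r)

/-- The radii `r > 0` for which the closed ball of radius `r` around `a` lies in `Ω`; for `a ∈ Ω`
these are the `r` with `0 < r < d(a,∂Ω)`. -/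
def radii {n : ℕ} (Ω : Set (Cn n)) (a : Cn n) : Set ℝ :=
  {r | 0 < r ∧ closedBall a r ⊆ Ω}

end MSubharmonic

end

noncomputable section

namespace MSubharmonic

/-! Put `w = z - a` and `t = |w|²`, let `λ(t)` be the mean of `φ` over the sphere of squared radius
`t`, and let `N(t)` be the mass that `μ = dd^c φ ∧ β^{n-1}` gives to the closed ball of squared
radius `t`. Pairing `dd^c φ` with radial data reduces the theorem to two statements about these
functions of one variable.

First, `∫ h(t) dμ = ∫ φ dd^c h(t) ∧ β^{n-1}` says that `λ' = N / t^n` in the sense of distributions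
(`IsTraceMeasure.integral_meanSq_mul_deriv`). Second, the complex Hessian of `φ_m(|w|)` is `t^{-n/m}
(1 - (n/m) t⁻¹ w̄ wᵀ)`. This form is just barely `m`-positive: its `m`-th power wedged with
`β^{n-m}` vanishes. It is a rank one perturbation of a multiple of `β`, so mixed discriminants are
affine in the perturbation (`wedgeTop_subOn`) and everything can be computed. Testing `m`-positivity
with `χ = ψ(t)` and with every `α_k` equal to this form, up to a positive factor, gives an
inequality for `λ` (`IsMPositiveDdc.integral_meanSq_nonneg`). Eliminating `λ` by the first identity
leaves `(N t^{-p})' ≥ 0` with `p = n (m - 1) / m` (`monotoneOn_div_rpow`), so the mass quotient is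
nondecreasing and has a limit at `0`.

Since `t^{-n} = t^{-p} t^{-n/m}` and `dφ_m/dt = t^{-n/m}`, the first identity also reads `dλ/dφ_m =
N t^{-p}`: as a function of `φ_m`, the mean `λ` has a nonnegative nondecreasing slope. This is the
convexity and monotonicity statement, and because `φ_m → -∞` at `0`, the quotient `λ / φ_m` tends to
the limit of the slope, which is the Lelong number (`IsMSubharmonic.sphereMean_slope_bounds`,
`IsMSubharmonic.exists_lelong`). Averaging over radii multiplies `φ_m` by `n / (n - n/m + 1)`,
whence the formula for balls. If `φ` is bounded near `a`, then `λ / φ_m → 0`.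

The rest is regularity. Subharmonic functions are locally integrable by a connectedness argument
(`IsSubharmonic.integrableNear`); the measure `μ` comes from two theorems of Riesz
(`exists_isTraceMeasure`); and the formula for `λ`, obtained for almost every radius, is carried
over to every radius by semicontinuity and the sub-mean value inequality
(`IsSubharmonic.sphereMean_eq_of_ae`). -/

/-! ### Test functions on the real line -/

/-- Smooth functions on the real line with compact support contained in `U`. -/
structure IsTestReal (U : Set ℝ) (g : ℝ → ℝ) : Prop where
  smooth : ContDiff ℝ ∞ g
  compact : HasCompactSupport g
  subset : tsupport g ⊆ U

lemma IsTestReal.mono {U V : Set ℝ} {g : ℝ → ℝ} (hg : IsTestReal U g) (h : U ⊆ V) :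
    IsTestReal V g := ⟨hg.1, hg.2, hg.3.trans h⟩

lemma IsTestReal.eq_zero {U : Set ℝ} {g : ℝ → ℝ} (hg : IsTestReal U g) {t : ℝ} (ht : t ∉ U) :
    g t = 0 := image_eq_zero_of_notMem_tsupport fun h => ht (hg.subset h)

/-- Smoothness of `c` on `U` is enough, since the product vanishes near every point outside the
support of `g`. This admits factors such as `t ^ (-p)` and `t⁻¹` that are singular at `0`. -/
lemma IsTestReal.mul_left {U : Set ℝ} (hU : IsOpen U) {c g : ℝ → ℝ} (hc : ContDiffOn ℝ ∞ c U)
    (hg : IsTestReal U g) : IsTestReal U (fun t => c t * g t) := by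
  refine ⟨?_, hg.compact.mul_left, (closure_mono ?_).trans hg.subset⟩
  · rw [contDiff_iff_contDiffAt]
    intro t
    by_cases ht : t ∈ tsupport g
    · exact (hc.contDiffAt (hU.mem_nhds (hg.subset ht))).mul hg.smooth.contDiffAt
    · have : (fun t => c t * g t) =ᶠ[𝓝 t] fun _ => 0 := by
        filter_upwards [notMem_tsupport_iff_eventuallyEq.1 ht] with s hs
        simp [hs]
      exact contDiffAt_const.congr_of_eventuallyEq this
  · intro t ht
    simp only [Function.mem_support] at ht ⊢
    exact right_ne_zero_of_mul ht

lemma IsTestReal.add {U : Set ℝ} {f g : ℝ → ℝ} (hf : IsTestReal U f) (hg : IsTestReal U g) :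
    IsTestReal U (fun t => f t + g t) :=
  ⟨hf.smooth.add hg.smooth, hf.compact.add hg.compact,
    (tsupport_add f g).trans (Set.union_subset hf.subset hg.subset)⟩

lemma IsTestReal.const_mul {U : Set ℝ} (c : ℝ) {g : ℝ → ℝ} (hg : IsTestReal U g) :
    IsTestReal U (fun t => c * g t) :=
  ⟨contDiff_const.mul hg.smooth, hg.compact.mul_left,
    (closure_mono fun _ ht => right_ne_zero_of_mul ht).trans hg.subset⟩

lemma IsTestReal.deriv {U : Set ℝ} {g : ℝ → ℝ} (hg : IsTestReal U g) :
    IsTestReal U (_root_.deriv g) :=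
  ⟨hg.smooth.iterate_deriv 1, hg.compact.deriv,
    (tsupport_deriv_subset (𝕜 := ℝ) (f := g)).trans hg.subset⟩

lemma IsTestReal.hasDerivAt {U : Set ℝ} {g : ℝ → ℝ} (hg : IsTestReal U g) (t : ℝ) :
    HasDerivAt g (_root_.deriv g t) t :=
  (hg.smooth.differentiable (by simp) t).hasDerivAt

/-- The infimum and supremum of the support can be moved outwards a little inside the open set `U`.
As the end points themselves lie in `U`, local integrability on an order connected `U` gives
integrability on the whole closed interval. -/
lemma IsTestReal.exists_support_subset {U : Set ℝ} (hU : IsOpen U) (hne : U.Nonempty)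
    {g : ℝ → ℝ} (hg : IsTestReal U g) :
    ∃ A ∈ U, ∃ B ∈ U, A < B ∧ tsupport g ⊆ Set.Ioo A B := by
  rcases (tsupport g).eq_empty_or_nonempty with h | h
  · obtain ⟨x, hx⟩ := hne
    obtain ⟨ε, hε, hb⟩ := Metric.isOpen_iff.1 hU x hx
    refine ⟨x, hx, x + ε / 2, hb ?_, by linarith, ?_⟩
    · simp [abs_of_pos hε, hε]
    · exact h ▸ Set.empty_subset _
  · have hc : IsCompact (tsupport g) := hg.compact
    obtain ⟨ε, hε, hb⟩ := Metric.isOpen_iff.1 hU _ (hg.subset (hc.sInf_mem h))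
    obtain ⟨δ, hδ, hd⟩ := Metric.isOpen_iff.1 hU _ (hg.subset (hc.sSup_mem h))
    have key : ∀ t ∈ tsupport g, sInf (tsupport g) ≤ t ∧ t ≤ sSup (tsupport g) := fun t ht =>
      ⟨csInf_le hc.bddBelow ht, le_csSup hc.bddAbove ht⟩
    refine ⟨sInf (tsupport g) - ε / 2, hb ?_, sSup (tsupport g) + δ / 2, hd ?_, ?_, ?_⟩
    · simp [abs_of_pos hε, hε]
    · simp [abs_of_pos hδ, hδ]
    · obtain ⟨t, ht⟩ := h
      linarith [key t ht]
    · intro t ht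
      have := key t ht
      constructor <;> linarith

/-- Nonnegative test functions of integral one on a given interval. -/
lemma exists_isTestReal_integral_eq_one {a b : ℝ} (hab : a < b) :
    ∃ ρ : ℝ → ℝ, IsTestReal (Set.Ioo a b) ρ ∧ (∀ t, 0 ≤ ρ t) ∧ ∫ t, ρ t = 1 := by
  let f : ContDiffBump ((a + b) / 2) := ⟨(b - a) / 8, (b - a) / 4, by linarith, by linarith⟩
  refine ⟨f.normed volume, ⟨f.contDiff_normed, f.hasCompactSupport_normed, ?_⟩,
    fun t => f.nonneg_normed t, f.integral_normed⟩
  rw [f.tsupport_normed_eq, Real.closedBall_eq_Icc]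
  intro t ht
  change (a + b) / 2 - (b - a) / 4 ≤ t ∧ t ≤ (a + b) / 2 + (b - a) / 4 at ht
  constructor <;> linarith [ht.1, ht.2]

lemma integral_eq_intervalIntegral {A B : ℝ} {g : ℝ → ℝ} (hg : Function.support g ⊆ Set.Ioo A B) :
    ∫ t, g t = ∫ t in A..B, g t :=
  (intervalIntegral.integral_eq_integral_of_support_subset
    (hg.trans Set.Ioo_subset_Ioc_self)).symm

lemma contDiff_primitive {k : ℝ → ℝ} (hk : ContDiff ℝ ∞ k) (A : ℝ) :
    ContDiff ℝ ∞ (fun t => ∫ x in A..t, k x) ∧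
      ∀ t, HasDerivAt (fun t => ∫ x in A..t, k x) (k t) t := by
  have h : ∀ t, HasDerivAt (fun t => ∫ x in A..t, k x) (k t) t := fun t =>
    intervalIntegral.integral_hasDerivAt_right (hk.continuous.intervalIntegrable _ _)
      (hk.continuous.stronglyMeasurableAtFilter _ _) hk.continuous.continuousAt
  refine ⟨?_, h⟩
  rw [contDiff_infty_iff_deriv]
  refine ⟨fun t => (h t).differentiableAt, ?_⟩
  rwa [show _root_.deriv (fun t => ∫ x in A..t, k x) = k from funext fun t => (h t).deriv]

lemma primitive_eq_zero {k : ℝ → ℝ} {A B : ℝ} (hk : Function.support k ⊆ Set.Ioo A B) {t : ℝ}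
    (ht : t ≤ A) : ∫ x in A..t, k x = 0 := by
  rw [intervalIntegral.integral_symm, intervalIntegral.integral_of_le ht,
    setIntegral_eq_zero_of_forall_eq_zero, neg_zero]
  intro x hx
  by_contra h
  exact absurd (hk h).1 (not_lt.2 hx.2)

lemma primitive_eq_integral {k : ℝ → ℝ} {A B : ℝ} (hk : Function.support k ⊆ Set.Ioo A B) {t : ℝ}
    (ht : B ≤ t) : ∫ x in A..t, k x = ∫ x, k x :=
  (integral_eq_intervalIntegral (hk.trans (Set.Ioo_subset_Ioo_right ht))).symm

/-- A test function of integral zero is the derivative of a test function. -/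
lemma IsTestReal.exists_primitive {U : Set ℝ} (hU : IsOpen U) (hne : U.Nonempty)
    (hc : U.OrdConnected) {k : ℝ → ℝ} (hk : IsTestReal U k) (h0 : ∫ t, k t = 0) :
    ∃ g, IsTestReal U g ∧ (∀ t, HasDerivAt g (k t) t) ∧
      ∃ A, ∀ t, g t = ∫ x in A..t, k x := by
  obtain ⟨A, hA, B, hB, hAB, hts⟩ := hk.exists_support_subset hU hne
  have hs := (subset_tsupport k).trans hts
  have hsupp : tsupport (fun t => ∫ x in A..t, k x) ⊆ Set.Icc A B := by
    refine closure_minimal (fun t ht => ?_) isClosed_Icc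
    by_contra hn
    rw [Set.mem_Icc, not_and_or, not_le, not_le] at hn
    rcases hn with hn | hn
    · exact ht (primitive_eq_zero hs hn.le)
    · exact ht ((primitive_eq_integral hs hn.le).trans h0)
  exact ⟨fun t => ∫ x in A..t, k x, ⟨(contDiff_primitive hk.smooth A).1,
    isCompact_Icc.of_isClosed_subset (isClosed_tsupport _) hsupp,
    hsupp.trans (hc.out hA hB)⟩, (contDiff_primitive hk.smooth A).2, A, fun _ => rfl⟩

lemma IsTestReal.integrable_mul {U : Set ℝ} {l g : ℝ → ℝ}
    (hl : LocallyIntegrableOn l U) (hg : IsTestReal U g) : Integrable (fun t => l t * g t) := by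
  have h1 : IntegrableOn l (tsupport g) := hl.integrableOn_compact_subset hg.subset hg.compact
  have h2 : IntegrableOn (fun t => l t * g t) (tsupport g) :=
    h1.mul_continuousOn hg.smooth.continuous.continuousOn hg.compact
  refine (integrableOn_iff_integrable_of_support_subset ?_).1 h2
  exact fun t ht => subset_tsupport g (right_ne_zero_of_mul ht)

/-- A compact interval with end points in `U` that contains `t₀` and a neighbourhood of `t` reduces
this to primitives of integrable functions. -/
lemma continuousOn_primitive {U : Set ℝ} (hU : IsOpen U) (hc : U.OrdConnected) {w : ℝ → ℝ}
    (hw : LocallyIntegrableOn w U) {t₀ : ℝ} (ht₀ : t₀ ∈ U) :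
    ContinuousOn (fun t => ∫ x in t₀..t, w x) U := by
  intro t ht
  obtain ⟨ε, hε, hb⟩ := Metric.isOpen_iff.1 hU t ht
  set A := min t₀ (t - ε / 2)
  set B := max t₀ (t + ε / 2)
  have hA : A ∈ U := by
    rcases min_choice t₀ (t - ε / 2) with h | h
    · simpa only [A, h]
    · rw [show A = t - ε / 2 from h]; exact hb (by simp [abs_of_pos hε, hε])
  have hB : B ∈ U := by
    rcases max_choice t₀ (t + ε / 2) with h | h
    · simpa only [B, h]
    · rw [show B = t + ε / 2 from h]; exact hb (by simp [abs_of_pos hε, hε])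
  have hAt : A ≤ t - ε / 2 := min_le_right _ _
  have hBt : t + ε / 2 ≤ B := le_max_right _ _
  have h1 : IntegrableOn w (Set.uIcc A B) := by
    refine hw.integrableOn_compact_subset ?_ isCompact_uIcc
    rw [Set.uIcc_of_le (by linarith)]
    exact hc.out hA hB
  have h2 : t₀ ∈ Set.uIcc A B := by
    rw [Set.uIcc_of_le (by linarith)]
    exact ⟨min_le_left _ _, le_max_left _ _⟩
  have h3 := intervalIntegral.continuousOn_primitive_interval' (f := w) (μ := volume)
    (h1.intervalIntegrable) h2
  refine (h3.continuousAt ?_).continuousWithinAt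
  rw [Set.uIcc_of_le (by linarith)]
  exact Icc_mem_nhds (by linarith) (by linarith)

/-! ### Distributional derivatives on an interval -/

/-- A function with distributional derivative `w` on an interval is almost everywhere equal to a
primitive of `w`. -/
theorem ae_eq_primitive_of_integral_deriv {U : Set ℝ} (hU : IsOpen U) (hc : U.OrdConnected)
    {l w : ℝ → ℝ} (hl : LocallyIntegrableOn l U) (hw : LocallyIntegrableOn w U)
    (hwr : ∀ t ∈ U, ContinuousWithinAt w (Set.Ioi t) t)
    (h : ∀ g, IsTestReal U g → ∫ t, l t * deriv g t = - ∫ t, w t * g t)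
    {t₀ : ℝ} (ht₀ : t₀ ∈ U) :
    ∃ K : ℝ, ∀ᵐ t, t ∈ U → l t = K + ∫ x in t₀..t, w x := by
  have hne : U.Nonempty := ⟨t₀, ht₀⟩
  set G : ℝ → ℝ := fun t => ∫ x in t₀..t, w x with hG
  have hGc : ContinuousOn G U := continuousOn_primitive hU hc hw ht₀
  have hGl : LocallyIntegrableOn G U := hGc.locallyIntegrableOn hU.measurableSet
  have hII : ∀ a ∈ U, ∀ b ∈ U, IntervalIntegrable w volume a b := fun a ha b hb =>
    (hw.integrableOn_compact_subset (hc.uIcc_subset ha hb) isCompact_uIcc).intervalIntegrable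
  -- As `w` is only right continuous, `G` is known to have `w` as its right derivative only;
  -- integration by parts holds in this generality.
  have hparts : ∀ g, IsTestReal U g → ∫ t, G t * deriv g t = - ∫ t, w t * g t := by
    intro g hg
    obtain ⟨A, hA, B, hB, hAB, hts⟩ := hg.exists_support_subset hU hne
    have hs := (subset_tsupport g).trans hts
    have hI : Set.uIcc A B ⊆ U := hc.uIcc_subset hA hB
    have hs1 : Function.support (fun t => G t * deriv g t) ⊆ Set.Ioc A B := by
      exact fun t ht => Set.Ioo_subset_Ioc_self (hts (support_deriv_subset (right_ne_zero_of_mul ht)))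
    rw [← intervalIntegral.integral_eq_integral_of_support_subset hs1,
      intervalIntegral.integral_mul_deriv_eq_deriv_mul_of_hasDeriv_right (u' := w)
        (hGc.mono hI) hg.smooth.continuous.continuousOn _
        (fun x _ => (hg.hasDerivAt x).hasDerivWithinAt) (hII A hA B hB)
        (hg.deriv.smooth.continuous.intervalIntegrable _ _)]
    · have hgA : g A = 0 := by
        by_contra h; exact absurd (hs h).1 (lt_irrefl _)
      have hgB : g B = 0 := by
        by_contra h; exact absurd (hs h).2 (lt_irrefl _)
      rw [hgA, hgB, integral_eq_intervalIntegral
        (fun t ht => hs (right_ne_zero_of_mul ht))]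
      ring
    · intro x hx
      rw [min_eq_left hAB.le, max_eq_right hAB.le] at hx
      have hxU : x ∈ U := hc.out hA hB ⟨hx.1.le, hx.2.le⟩
      have hwm : StronglyMeasurableAtFilter w (𝓝[Set.Ioi x] x) volume :=
        ⟨Set.Ioo x B, Ioo_mem_nhdsGT hx.2,
          ((hII x hxU B hB).1.aestronglyMeasurable.mono_set Set.Ioo_subset_Ioc_self)⟩
      exact (intervalIntegral.integral_hasDerivWithinAt_right (s := Set.Ici x) (t := Set.Ioi x)
        (hII t₀ ht₀ x hxU) hwm (hwr x hxU)).mono Set.Ioi_subset_Ici_self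
  obtain ⟨ε, hε, hb⟩ := Metric.isOpen_iff.1 hU t₀ ht₀
  obtain ⟨ρ, hρ, -, hρ1⟩ := exists_isTestReal_integral_eq_one (a := t₀ - ε) (b := t₀ + ε)
    (by linarith)
  replace hρ : IsTestReal U ρ := hρ.mono (by rw [← Real.ball_eq_Ioo]; exact hb)
  have hf : LocallyIntegrableOn (fun t => l t - G t) U := hl.sub hGl
  -- The du Bois-Reymond argument: `f = l - G` annihilates all derivatives of test functions. For
  -- any test function `k` with integral `I`, the function `k - I ρ` has integral zero and hence is
  -- such a derivative, so `∫ f k = I K`, which says that `f = K` almost everywhere.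
  set K := ∫ t, (l t - G t) * ρ t
  have hfK : LocallyIntegrableOn (fun t => l t - G t - K) U :=
    hf.sub (continuousOn_const.locallyIntegrableOn hU.measurableSet)
  refine ⟨K, ?_⟩
  suffices H : ∀ g : ℝ → ℝ, ContDiff ℝ ∞ g → HasCompactSupport g → tsupport g ⊆ U →
      ∫ t, g t • (l t - G t - K) = 0 by
    filter_upwards [hU.ae_eq_zero_of_integral_contDiff_smul_eq_zero hfK H] with t ht htU
    linarith [ht htU]
  intro k hk1 hk2 hk3
  have hk : IsTestReal U k := ⟨hk1, hk2, hk3⟩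
  set I := ∫ t, k t
  have hkk : IsTestReal U (fun t => k t + (-I) * ρ t) := hk.add (hρ.const_mul _)
  have hki : Integrable k := hk.smooth.continuous.integrable_of_hasCompactSupport hk.compact
  have hρi : Integrable ρ := hρ.smooth.continuous.integrable_of_hasCompactSupport hρ.compact
  obtain ⟨g, hg, hgd, -⟩ := hkk.exists_primitive hU hne hc (by
    rw [integral_add hki (hρi.const_mul _), integral_const_mul, hρ1]
    ring)
  have h1 := h g hg
  have h2 := hparts g hg
  have hd : deriv g = fun t => k t + (-I) * ρ t := funext fun t => (hgd t).deriv
  have h3 : ∫ t, (l t - G t) * (k t + (-I) * ρ t) = 0 := by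
    simp only [← fun t => (hgd t).deriv]
    calc ∫ t, (l t - G t) * deriv g t = ∫ t, (l t * deriv g t - G t * deriv g t) := by
          simp only [sub_mul]
      _ = 0 := by
          rw [integral_sub (hg.deriv.integrable_mul hl) (hg.deriv.integrable_mul hGl), h1, h2,
            sub_self]
  have e1 : ∀ t, (l t - G t) * (k t + (-I) * ρ t) = (l t - G t) * k t + (-I) * ((l t - G t) * ρ t) :=
    fun t => by ring
  simp only [e1] at h3
  rw [integral_add (hk.integrable_mul hf) ((hρ.integrable_mul hf).const_mul _),
    integral_const_mul] at h3
  have e2 : ∀ t, k t • (l t - G t - K) = (l t - G t) * k t + (-K) * k t :=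
    fun t => by simp only [smul_eq_mul]; ring
  simp only [e2]
  rw [integral_add (hk.integrable_mul hf) (hki.const_mul _), integral_const_mul]
  linarith

/-- A right continuous function with nonnegative distributional derivative is nondecreasing. -/
theorem monotoneOn_of_integral_deriv_nonpos {U : Set ℝ} (hU : IsOpen U) (hc : U.OrdConnected)
    {v : ℝ → ℝ} (hv : LocallyIntegrableOn v U)
    (hvr : ∀ t ∈ U, ContinuousWithinAt v (Set.Ioi t) t)
    (h : ∀ g, IsTestReal U g → (∀ t, 0 ≤ g t) → ∫ t, v t * deriv g t ≤ 0) :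
    MonotoneOn v U := by
  intro a ha b hb hab
  rcases hab.eq_or_lt with rfl | hab
  · exact le_rfl
  by_contra hlt
  rw [not_le] at hlt
  obtain ⟨c, hc1, hc2'⟩ := exists_between hlt
  obtain ⟨d, hd1, hc2⟩ := exists_between hc2'
  have ea : ∀ᶠ t in 𝓝[>] a, d < v t := (hvr a ha).eventually (lt_mem_nhds hc2)
  have eb : ∀ᶠ t in 𝓝[>] b, v t < c := (hvr b hb).eventually (gt_mem_nhds hc1)
  have ea' : ∀ᶠ t in 𝓝[>] a, t ∈ U := mem_nhdsWithin_of_mem_nhds (hU.mem_nhds ha)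
  have eb' : ∀ᶠ t in 𝓝[>] b, t ∈ U := mem_nhdsWithin_of_mem_nhds (hU.mem_nhds hb)
  obtain ⟨x, hx, hxs⟩ := mem_nhdsGT_iff_exists_Ioo_subset.1 (ea.and ea')
  obtain ⟨y, hy, hys⟩ := mem_nhdsGT_iff_exists_Ioo_subset.1 (eb.and eb')
  -- The test function `g` with `g' = ρ - η` is a smoothed indicator of `[a, b]`: `ρ` lives just to
  -- the right of `a`, where `v > d`, and `η` just to the right of `b`, where `v < c`. Then `∫ v g'
  -- ≥ d - c > 0`, a contradiction. Cutting at `min x b` puts `ρ` before `η`.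
  obtain ⟨ρ, hρ, hρ0, hρ1⟩ := exists_isTestReal_integral_eq_one
    (show a < min x b from lt_min hx hab)
  obtain ⟨η, hη, hη0, hη1⟩ := exists_isTestReal_integral_eq_one (show b < y from hy)
  have hρU : IsTestReal U ρ := hρ.mono fun t ht => (hxs ⟨ht.1, ht.2.trans_le (min_le_left _ _)⟩).2
  have hηU : IsTestReal U η := hη.mono fun t ht => (hys ht).2
  have hρi : Integrable ρ := hρ.smooth.continuous.integrable_of_hasCompactSupport hρ.compact
  have hηi : Integrable η := hη.smooth.continuous.integrable_of_hasCompactSupport hη.compact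
  obtain ⟨g, hg, hgd, A, hgA⟩ := (hρU.add (hηU.const_mul (-1))).exists_primitive hU ⟨a, ha⟩ hc (by
    rw [integral_add hρi (hηi.const_mul _), integral_const_mul, hρ1, hη1]; ring)
  have hd : deriv g = fun t => ρ t + (-1) * η t := funext fun t => (hgd t).deriv
  -- `g` increases up to `b`, decreases from `b` on, and vanishes far out on both sides.
  have hg0 : ∀ t, 0 ≤ g t := by
    intro t
    rcases le_total t b with htb | htb
    · obtain ⟨A', -, B', -, -, hs⟩ := hg.exists_support_subset hU ⟨a, ha⟩
      have hm : MonotoneOn g (Set.Iic b) := by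
        refine monotoneOn_of_deriv_nonneg (convex_Iic b) hg.smooth.continuous.continuousOn
          (fun s _ => (hgd s).differentiableAt.differentiableWithinAt) ?_
        intro s hs
        rw [interior_Iic] at hs
        rw [hd]
        simp only
        rw [hη.eq_zero (fun h => absurd h.1 (not_lt.2 hs.le))]
        simpa using hρ0 s
      have h0 : g (min A' t) = 0 := by
        by_contra hne
        exact absurd (hs (subset_tsupport g hne)).1 (not_lt.2 (min_le_left _ _))
      rw [← h0]
      exact hm ((min_le_right _ _).trans htb) htb (min_le_right _ _)
    · obtain ⟨A', -, B', -, -, hs⟩ := hg.exists_support_subset hU ⟨a, ha⟩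
      have hm : AntitoneOn g (Set.Ici b) := by
        refine antitoneOn_of_deriv_nonpos (convex_Ici b) hg.smooth.continuous.continuousOn
          (fun s _ => (hgd s).differentiableAt.differentiableWithinAt) ?_
        intro s hs
        rw [interior_Ici] at hs
        rw [hd]
        simp only
        rw [hρ.eq_zero (fun h => absurd h.2 (not_lt.2 ((min_le_right _ _).trans hs.le)))]
        simpa using hη0 s
      have h0 : g (max B' t) = 0 := by
        by_contra hne
        exact absurd (hs (subset_tsupport g hne)).2 (not_lt.2 (le_max_left _ _))
      rw [← h0]
      exact hm htb (htb.trans (le_max_right _ _)) (le_max_right _ _)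
  have h1 := h g hg hg0
  rw [hd] at h1
  have e1 : ∀ t, v t * (ρ t + (-1) * η t) = v t * ρ t - v t * η t := fun t => by ring
  simp only [e1] at h1
  rw [integral_sub (hρU.integrable_mul hv) (hηU.integrable_mul hv)] at h1
  have h2 : d ≤ ∫ t, v t * ρ t := by
    calc d = ∫ t, d * ρ t := by rw [integral_const_mul, hρ1, mul_one]
      _ ≤ _ := integral_mono (hρi.const_mul _) (hρU.integrable_mul hv) fun t => by
        by_cases ht : t ∈ Set.Ioo a (min x b)
        · exact mul_le_mul_of_nonneg_right
            (hxs ⟨ht.1, ht.2.trans_le (min_le_left _ _)⟩).1.le (hρ0 t)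
        · simp [hρ.eq_zero ht]
  have h3 : ∫ t, v t * η t ≤ c := by
    calc _ ≤ ∫ t, c * η t := integral_mono (hηU.integrable_mul hv) (hηi.const_mul _) fun t => by
            by_cases ht : t ∈ Set.Ioo b y
            · exact mul_le_mul_of_nonneg_right (hys ht).1.le (hη0 t)
            · simp [hη.eq_zero ht]
      _ = c := by rw [integral_const_mul, hη1, mul_one]
  linarith

lemma locallyIntegrableOn_of_monotoneOn {U : Set ℝ} (hU : IsOpen U) {N : ℝ → ℝ}
    (hN : MonotoneOn N U) : LocallyIntegrableOn N U := by
  intro x hx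
  obtain ⟨ε, hε, hb⟩ := Metric.isOpen_iff.1 hU x hx
  have hs : Set.Icc (x - ε / 2) (x + ε / 2) ⊆ U := by
    rw [← Real.closedBall_eq_Icc]
    exact (closedBall_subset_ball (by linarith)).trans hb
  exact ⟨Set.Icc (x - ε / 2) (x + ε / 2), mem_nhdsWithin_of_mem_nhds
    (Icc_mem_nhds (by linarith) (by linarith)), (hN.mono hs).integrableOn_isCompact isCompact_Icc⟩

lemma contDiffOn_rpow_Ioi (s : ℝ) : ContDiffOn ℝ ∞ (fun t : ℝ => t ^ s) (Set.Ioi 0) :=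
  fun _ ht => (Real.contDiffAt_rpow_const_of_ne (ne_of_gt ht)).contDiffWithinAt

/-! ### The radial differential inequality and its consequences -/

/-- If the function `l` satisfies `l' = N / t ^ n` and
`-∫ N (m ψ' + n (m - 1) ψ / t) ≥ 0` for all `ψ ≥ 0`, then `N / t ^ (n (m - 1) / m)` is
nondecreasing. -/
theorem monotoneOn_div_rpow {n m : ℕ} (hm : 1 ≤ m) (hmn : m < n) {U : Set ℝ} (hU : IsOpen U)
    (hc : U.OrdConnected) (hpos : U ⊆ Set.Ioi 0) {l N : ℝ → ℝ}
    (hN : MonotoneOn N U) (hNr : ∀ t ∈ U, ContinuousWithinAt N (Set.Ioi t) t)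
    (h₁ : ∀ g, IsTestReal U g → ∫ t, l t * deriv g t = - ∫ t, N t / t ^ n * g t)
    (h₂ : ∀ ψ, IsTestReal U ψ → (∀ t, 0 ≤ ψ t) →
      0 ≤ ∫ t, l t * deriv (fun t => t ^ (n - 1) * (m * t * deriv ψ t + n * (m - 1) * ψ t)) t) :
    MonotoneOn (fun t => N t * t ^ (-(n * (m - 1) / m : ℝ))) U := by
  have hm0 : (m : ℝ) ≠ 0 := by positivity
  set p : ℝ := n * (m - 1) / m with hp
  have hpm : m * p = n * (m - 1) := by rw [hp]; field_simp
  have hcont : ContinuousOn (fun t : ℝ => t ^ (-p)) U :=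
    ((contDiffOn_rpow_Ioi (-p)).continuousOn).mono hpos
  refine monotoneOn_of_integral_deriv_nonpos hU hc ?_ ?_ ?_
  · exact (locallyIntegrableOn_of_monotoneOn hU hN).mul_continuousOn hcont hU.isLocallyClosed
  · intro t ht
    exact (hNr t ht).mul ((hcont.continuousAt (hU.mem_nhds ht)).continuousWithinAt)
  intro g hg hg0
  -- `t ^ (-p)` solves `m t ψ' + n (m - 1) ψ = 0`. With `ψ = t ^ (-p) g` the expression `m t ψ' + n
  -- (m - 1) ψ` therefore becomes `m t ^ (1 - p) g'`, with no term in `g` left over.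
  have hψ : IsTestReal U (fun t => t ^ (-p) * g t) :=
    hg.mul_left hU ((contDiffOn_rpow_Ioi _).mono hpos)
  have hψ0 : ∀ t, 0 ≤ t ^ (-p) * g t := by
    intro t
    by_cases ht : t ∈ U
    · exact mul_nonneg (Real.rpow_nonneg (le_of_lt (hpos ht)) _) (hg0 t)
    · simp [hg.eq_zero ht]
  have hh : IsTestReal U (fun t => (m * t ^ n * t ^ (-p)) * deriv g t) :=
    hg.deriv.mul_left hU
      (((contDiffOn_const.mul (contDiffOn_id.pow n)).mul (contDiffOn_rpow_Ioi _)).mono hpos)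
  have e : (fun t => t ^ (n - 1) * (m * t * deriv (fun t => t ^ (-p) * g t) t
      + n * (m - 1) * (t ^ (-p) * g t))) = fun t => (m * t ^ n * t ^ (-p)) * deriv g t := by
    funext t
    by_cases ht : t ∈ U
    · have ht0 : 0 < t := hpos ht
      have hd : HasDerivAt (fun t => t ^ (-p) * g t)
          ((-p) * t ^ (-p - 1) * g t + t ^ (-p) * deriv g t) t :=
        (Real.hasDerivAt_rpow_const (Or.inl ht0.ne')).mul (hg.hasDerivAt t)
      rw [hd.deriv, Real.rpow_sub_one ht0.ne', ← hpm, ← Nat.sub_add_cancel (show 1 ≤ n by omega),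
        pow_succ]
      simp only [Nat.add_sub_cancel]
      field_simp
      ring
    · simp [hg.eq_zero ht, hg.deriv.eq_zero ht, hψ.deriv.eq_zero ht]
  have h3 := h₂ _ hψ hψ0
  rw [e, h₁ _ hh] at h3
  have e2 : ∀ t, N t / t ^ n * ((m * t ^ n * t ^ (-p)) * deriv g t)
      = m * (N t * t ^ (-p) * deriv g t) := by
    intro t
    by_cases ht : t ∈ U
    · have ht0 : 0 < t := hpos ht
      field_simp
    · simp [hg.deriv.eq_zero ht]
  simp only [e2, integral_const_mul] at h3
  have : (0 : ℝ) < m := by positivity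
  by_contra hlt
  rw [not_le] at hlt
  have := mul_pos this hlt
  linarith

/-- The function `φ_m` in terms of the square of the radius. -/
def phiSq (n m : ℕ) (t : ℝ) : ℝ := -(1 / (((n / m : ℝ) - 1) * t ^ ((n / m : ℝ) - 1)))

lemma one_lt_div {n m : ℕ} (hm : 1 ≤ m) (hmn : m < n) : (1 : ℝ) < n / m := by
  have : (0 : ℝ) < m := by positivity
  rw [one_lt_div₀ this]
  exact_mod_cast hmn

lemma hasDerivAt_phiSq {n m : ℕ} (hm : 1 ≤ m) (hmn : m < n) {t : ℝ} (ht : 0 < t) :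
    HasDerivAt (phiSq n m) (t ^ (-(n / m : ℝ))) t := by
  have hq := one_lt_div hm hmn
  have hq' : (n / m : ℝ) - 1 ≠ 0 := by linarith
  have h1 : HasDerivAt (fun t : ℝ => -(1 / ((n / m : ℝ) - 1)) * t ^ (-((n / m : ℝ) - 1)))
      (-(1 / ((n / m : ℝ) - 1)) * (-((n / m : ℝ) - 1) * t ^ (-((n / m : ℝ) - 1) - 1))) t :=
    (Real.hasDerivAt_rpow_const (Or.inl ht.ne')).const_mul _
  have e : -(1 / ((n / m : ℝ) - 1)) * (-((n / m : ℝ) - 1) * t ^ (-((n / m : ℝ) - 1) - 1))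
      = t ^ (-(n / m : ℝ)) := by
    have key : ∀ c x : ℝ, c ≠ 0 → -(1 / c) * (-c * x) = x := fun c x hc => by field_simp
    rw [show -((n / m : ℝ) - 1) - 1 = -(n / m : ℝ) by ring, key _ _ hq']
  rw [e] at h1
  refine h1.congr_of_eventuallyEq ?_
  filter_upwards [lt_mem_nhds ht] with s hs
  rw [phiSq, Real.rpow_neg hs.le]
  field_simp

/-- Because `n = n (m - 1) / m + n / m`, the integrand is the monotone quotient times `t ^ (-n/m)`,
the derivative of `phiSq`. Estimating the quotient by its values at the two end points gives both
bounds. -/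
theorem primitive_slope_bounds {n m : ℕ} (hm : 1 ≤ m) (hmn : m < n) {N : ℝ → ℝ} {a b : ℝ}
    (ha : 0 < a) (hab : a ≤ b)
    (hint : IntervalIntegrable (fun t => N t / t ^ n) volume a b)
    (hν : MonotoneOn (fun t => N t * t ^ (-(n * (m - 1) / m : ℝ))) (Set.Icc a b)) :
    N a * a ^ (-(n * (m - 1) / m : ℝ)) * (phiSq n m b - phiSq n m a) ≤ ∫ t in a..b, N t / t ^ n ∧
    ∫ t in a..b, N t / t ^ n ≤
      N b * b ^ (-(n * (m - 1) / m : ℝ)) * (phiSq n m b - phiSq n m a) := by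
  have hm0 : (m : ℝ) ≠ 0 := by positivity
  have hci : IntervalIntegrable (fun t : ℝ => t ^ (-(n / m : ℝ))) volume a b := by
    refine ContinuousOn.intervalIntegrable ?_
    rw [Set.uIcc_of_le hab]
    exact (contDiffOn_rpow_Ioi _).continuousOn.mono fun t ht => ha.trans_le ht.1
  have hX : ∫ t in a..b, t ^ (-(n / m : ℝ)) = phiSq n m b - phiSq n m a := by
    refine intervalIntegral.integral_eq_sub_of_hasDerivAt (fun t ht => ?_) hci
    rw [Set.uIcc_of_le hab] at ht
    exact hasDerivAt_phiSq hm hmn (ha.trans_le ht.1)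
  have e : ∀ t ∈ Set.Icc a b, N t / t ^ n
      = N t * t ^ (-(n * (m - 1) / m : ℝ)) * t ^ (-(n / m : ℝ)) := by
    intro t ht
    have ht0 : 0 < t := ha.trans_le ht.1
    rw [mul_assoc, ← Real.rpow_add ht0,
      show -(n * (m - 1) / m : ℝ) + -(n / m : ℝ) = -(n : ℝ) by field_simp; ring,
      Real.rpow_neg ht0.le, Real.rpow_natCast, div_eq_mul_inv]
  constructor
  · rw [← hX, ← intervalIntegral.integral_const_mul]
    refine intervalIntegral.integral_mono_on hab (hci.const_mul _) hint fun t ht => ?_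
    rw [e t ht]
    exact mul_le_mul_of_nonneg_right (hν ⟨le_rfl, hab⟩ ht ht.1)
      (Real.rpow_nonneg (ha.trans_le ht.1).le _)
  · rw [← hX, ← intervalIntegral.integral_const_mul]
    refine intervalIntegral.integral_mono_on hab hint (hci.const_mul _) fun t ht => ?_
    rw [e t ht]
    exact mul_le_mul_of_nonneg_right (hν ht ⟨hab, le_rfl⟩ ht.2)
      (Real.rpow_nonneg (ha.trans_le ht.1).le _)

/-! ### Mixed discriminants -/

section Wedge

open Function Equiv Matrix

variable {n : ℕ}

lemma prod_update_apply (A : Fin n → Matrix (Fin n) (Fin n) ℂ) (i : Fin n)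
    (X : Matrix (Fin n) (Fin n) ℂ) (σ τ : Perm (Fin n)) :
    ∏ k, update A i X k (σ k) (τ k)
      = X (σ i) (τ i) * ∏ k ∈ Finset.univ.erase i, A k (σ k) (τ k) := by
  rw [← Finset.mul_prod_erase _ _ (Finset.mem_univ i), update_self]
  congr 1
  refine Finset.prod_congr rfl fun k hk => ?_
  rw [update_of_ne (Finset.ne_of_mem_erase hk)]

lemma wedgeTop_update_sub (A : Fin n → Matrix (Fin n) (Fin n) ℂ) (i : Fin n)
    (X Y : Matrix (Fin n) (Fin n) ℂ) :
    wedgeTop (update A i (X - Y)) = wedgeTop (update A i X) - wedgeTop (update A i Y) := by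
  simp only [wedgeTop, prod_update_apply, ← mul_sub, ← Finset.sum_sub_distrib, Matrix.sub_apply,
    sub_mul]

/-- This is `θ ∧ θ = 0` for a decomposable `θ`: composing `τ` with the transposition of `i` and `j`
changes its sign but not the product, so each inner sum equals its own negative. -/
lemma wedgeTop_eq_zero_of_rank_one (A : Fin n → Matrix (Fin n) (Fin n) ℂ) {i j : Fin n}
    (hij : i ≠ j) (v w : Fin n → ℂ) (hi : A i = vecMulVec v w) (hj : A j = vecMulVec v w) :
    wedgeTop A = 0 := by
  have key : ∀ σ : Perm (Fin n), ∑ τ : Perm (Fin n),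
      ((Perm.sign σ : ℤ) : ℂ) * ((Perm.sign τ : ℤ) : ℂ) * ∏ k, A k (σ k) (τ k) = 0 := by
    intro σ
    obtain ⟨S, hS⟩ : ∃ S, S = ∑ τ : Perm (Fin n),
      ((Perm.sign σ : ℤ) : ℂ) * ((Perm.sign τ : ℤ) : ℂ) * ∏ k, A k (σ k) (τ k) := ⟨_, rfl⟩
    rw [← hS]
    have h : S = -S := by
      conv_lhs => rw [hS, ← Equiv.sum_comp (Equiv.mulRight (swap i j))]
      rw [hS, ← Finset.sum_neg_distrib]
      refine Finset.sum_congr rfl fun τ _ => ?_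
      have hp : ∏ k, A k (σ k) ((Equiv.mulRight (swap i j)) τ k) = ∏ k, A k (σ k) (τ k) := by
        have hj' : j ∈ Finset.univ.erase i := Finset.mem_erase.2 ⟨hij.symm, Finset.mem_univ _⟩
        rw [← Finset.mul_prod_erase _ _ (Finset.mem_univ i), ← Finset.mul_prod_erase _ _ hj',
          ← Finset.mul_prod_erase _ (fun k => A k (σ k) (τ k)) (Finset.mem_univ i),
          ← Finset.mul_prod_erase _ (fun k => A k (σ k) (τ k)) hj']
        have hr : ∀ k ∈ (Finset.univ.erase i).erase j,
            A k (σ k) ((Equiv.mulRight (swap i j)) τ k) = A k (σ k) (τ k) := by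
          intro k hk
          have h1 := Finset.ne_of_mem_erase hk
          have h2 := Finset.ne_of_mem_erase (Finset.mem_of_mem_erase hk)
          simp [swap_apply_of_ne_of_ne h2 h1]
        rw [Finset.prod_congr rfl hr]
        simp only [coe_mulRight, Perm.mul_apply, swap_apply_left, swap_apply_right, hi, hj,
          vecMulVec_apply]
        ring
      rw [hp]
      simp [Perm.sign_mul, Perm.sign_swap hij]
    exact self_eq_neg.1 h
  simp only [wedgeTop, key, Finset.sum_const_zero, mul_zero]

lemma exists_perm_apply_eq {i j a b : Fin n} (hij : i ≠ j) (hab : a ≠ b) :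
    ∃ ρ : Perm (Fin n), ρ a = i ∧ ρ b = j := by
  have h1 : swap i a b ≠ i := fun h => hab.symm (by
    have := congrArg (swap i a) h
    simpa using this)
  refine ⟨swap (swap i a b) j * swap i a, ?_, ?_⟩
  · simp [swap_apply_of_ne_of_ne h1.symm hij]
  · simp

/-- Double counting. Reindexing shows that the sum is the same for all ordered pairs of distinct
indices. Summing over all pairs (the diagonal contributes nothing by `hf`) gives `n (n - 1)` times
it on one side, and on the other side `n!` times the full double sum, since each `σ` only permutes
the indices. -/
lemma sum_perm_apply_pair (f : Fin n → Fin n → ℂ) (hf : ∀ a, f a a = 0) {i j : Fin n}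
    (hij : i ≠ j) :
    ∑ σ : Perm (Fin n), f (σ i) (σ j) = ((n - 2).factorial : ℂ) * ∑ a, ∑ b, f a b := by
  set S := ∑ σ : Perm (Fin n), f (σ i) (σ j) with hS
  have h1 : ∀ a b, a ≠ b → ∑ σ : Perm (Fin n), f (σ a) (σ b) = S := by
    intro a b hab
    obtain ⟨ρ, ha, hb⟩ := exists_perm_apply_eq hij hab
    rw [hS, ← Equiv.sum_comp (Equiv.mulRight ρ)]
    simp [Perm.mul_apply, ← ha, ← hb]
  have hn : 2 ≤ n := by
    have := i.2; have := j.2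
    have : (i : ℕ) ≠ j := fun h => hij (Fin.ext h)
    omega
  have h2 : ∑ a, ∑ b, ∑ σ : Perm (Fin n), f (σ a) (σ b) = n * (n - 1) * S := by
    have : ∀ a, ∑ b, ∑ σ : Perm (Fin n), f (σ a) (σ b) = (n - 1) * S := by
      intro a
      rw [← Finset.add_sum_erase _ _ (Finset.mem_univ a),
        Finset.sum_congr rfl fun b hb => h1 a b (Finset.ne_of_mem_erase hb).symm]
      simp [hf, Finset.card_erase_of_mem, Nat.cast_sub (show 1 ≤ n by omega)]
    simp only [this, Finset.sum_const, Finset.card_univ, Fintype.card_fin, nsmul_eq_mul]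
    ring
  have h3 : ∑ a, ∑ b, ∑ σ : Perm (Fin n), f (σ a) (σ b) = n.factorial * ∑ a, ∑ b, f a b := by
    calc _ = ∑ σ : Perm (Fin n), ∑ a, ∑ b, f (σ a) (σ b) := by
          rw [Finset.sum_comm' (t' := Finset.univ) (s' := fun _ => Finset.univ) (by simp)]
          rw [Finset.sum_congr rfl fun b _ => Finset.sum_comm]
          rw [Finset.sum_comm]
          exact Finset.sum_congr rfl fun σ _ => Finset.sum_comm
      _ = ∑ σ : Perm (Fin n), ∑ a, ∑ b, f a b := by
          refine Finset.sum_congr rfl fun σ _ => ?_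
          rw [Equiv.sum_comp σ (fun a => ∑ b, f a (σ b))]
          exact Finset.sum_congr rfl fun a _ => Equiv.sum_comp σ _
      _ = _ := by simp [Fintype.card_perm]
  have h4 : (n.factorial : ℂ) = n * (n - 1) * (n - 2).factorial := by
    obtain ⟨k, rfl⟩ := Nat.exists_eq_add_of_le hn
    rw [show 2 + k = k + 1 + 1 by ring, Nat.factorial_succ, Nat.factorial_succ]
    simp only [show k + 1 + 1 - 2 = k by omega]
    push_cast
    ring
  have h5 : (n : ℂ) * (n - 1) ≠ 0 := by
    have a1 : (n : ℂ) ≠ 0 := by simp; omega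
    have a2 : (n : ℂ) - 1 ≠ 0 := by
      rw [sub_ne_zero]; exact_mod_cast (show n ≠ 1 by omega)
    exact mul_ne_zero a1 a2
  apply mul_left_cancel₀ h5
  rw [← h2, h3, h4]
  ring

/-- All slots but `i` and `j` carry the identity, which forces `τ` to agree with `σ` there. Thus `τ`
is `σ` or `σ * swap i j`, and the inner sum is a difference of two products, which is then summed
over `σ` by `sum_perm_apply_pair`. -/
lemma wedgeTop_update_update_one {i j : Fin n} (hij : i ≠ j) (E Q : Matrix (Fin n) (Fin n) ℂ) :
    wedgeTop (update (update (fun _ => 1) i E) j Q)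
      = ((Real.pi : ℂ) ^ n)⁻¹ * ((n - 2).factorial * (E.trace * Q.trace - (E * Q).trace)) := by
  have hj' : i ∈ Finset.univ.erase j := Finset.mem_erase.2 ⟨hij, Finset.mem_univ _⟩
  have hprod : ∀ σ τ : Perm (Fin n), ∏ k, (update (update (fun _ => 1) i E) j Q : Fin n → Matrix (Fin n) (Fin n) ℂ) k (σ k) (τ k)
      = Q (σ j) (τ j) * (E (σ i) (τ i) * ∏ k ∈ (Finset.univ.erase j).erase i,
        (1 : Matrix (Fin n) (Fin n) ℂ) (σ k) (τ k)) := by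
    intro σ τ
    rw [prod_update_apply, ← Finset.mul_prod_erase _ _ hj', update_self]
    congr 2
    refine Finset.prod_congr rfl fun k hk => ?_
    rw [update_of_ne (Finset.ne_of_mem_erase hk)]
  have hinner : ∀ σ : Perm (Fin n), ∑ τ : Perm (Fin n),
      ((Perm.sign σ : ℤ) : ℂ) * ((Perm.sign τ : ℤ) : ℂ) *
        ∏ k, (update (update (fun _ => 1) i E) j Q : Fin n → Matrix (Fin n) (Fin n) ℂ) k (σ k) (τ k)
      = E (σ i) (σ i) * Q (σ j) (σ j) - E (σ i) (σ j) * Q (σ j) (σ i) := by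
    intro σ
    rw [← Equiv.sum_comp (Equiv.mulLeft σ)]
    have hsub : ({1, swap i j} : Finset (Perm (Fin n))) ⊆ Finset.univ := Finset.subset_univ _
    rw [← Finset.sum_subset hsub]
    · have hne : (1 : Perm (Fin n)) ≠ swap i j := fun h => hij (by
        have := congrArg (fun ρ : Perm (Fin n) => ρ i) h
        simpa using this)
      rw [Finset.sum_pair hne, hprod, hprod]
      have hr : ∏ k ∈ (Finset.univ.erase j).erase i, (1 : Matrix (Fin n) (Fin n) ℂ) (σ k)
          ((Equiv.mulLeft σ) (swap i j) k) = 1 := by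
        refine Finset.prod_eq_one fun k hk => ?_
        have h1 := Finset.ne_of_mem_erase hk
        have h2 := Finset.ne_of_mem_erase (Finset.mem_of_mem_erase hk)
        change (1 : Matrix (Fin n) (Fin n) ℂ) (σ k) (σ (swap i j k)) = 1
        rw [swap_apply_of_ne_of_ne h1 h2, Matrix.one_apply_eq]
      have hr' : ∏ k ∈ (Finset.univ.erase j).erase i, (1 : Matrix (Fin n) (Fin n) ℂ) (σ k)
          ((Equiv.mulLeft σ) 1 k) = 1 := Finset.prod_eq_one fun k _ =>
        Matrix.one_apply_eq (σ k)
      rw [hr, hr']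
      have hs : ((Perm.sign σ : ℤ) : ℂ) * ((Perm.sign σ : ℤ) : ℂ) = 1 := by
        rw [← Int.cast_mul, ← Units.val_mul, Int.units_mul_self]; simp
      simp only [coe_mulLeft, mul_one, Perm.sign_mul, Perm.sign_swap hij, Units.val_mul,
        Units.val_neg, Units.val_one, Int.cast_mul, Int.cast_neg, Int.cast_one, Perm.mul_apply,
        swap_apply_left, swap_apply_right]
      linear_combination (Q (σ j) (σ j) * E (σ i) (σ i) - Q (σ j) (σ i) * E (σ i) (σ j)) * hs
    · intro ρ _ hρ
      have : ∃ k, k ≠ j ∧ k ≠ i ∧ ρ k ≠ k := by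
        by_contra hcon
        push Not at hcon
        apply hρ
        by_cases h1 : ρ i = i
        · have h2 : ρ j = j := by
            by_contra h2
            have h3 : ρ j ≠ i := fun h => hij (ρ.injective (h1.trans h.symm))
            exact h2 (ρ.injective (hcon _ h2 h3))
          have : ρ = 1 := by
            ext k
            by_cases hk : k = j
            · simp [hk, h2]
            by_cases hk' : k = i
            · simp [hk', h1]
            simp [hcon k hk hk']
          simp [this]
        · have h2 : ρ i = j := by
            by_contra h2
            exact h1 (ρ.injective (hcon _ h2 h1))
          have h3 : ρ j = i := by
            by_contra h3
            have h4 : ρ j ≠ j := fun h => hij (ρ.injective (h2.trans h.symm))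
            exact h4 (ρ.injective (hcon _ h4 h3))
          have : ρ = swap i j := by
            ext k
            by_cases hk : k = j
            · simp [hk, h3]
            by_cases hk' : k = i
            · simp [hk', h2]
            simp [hcon k hk hk', swap_apply_of_ne_of_ne hk' hk]
          simp [this]
      obtain ⟨k, hkj, hki, hk⟩ := this
      rw [hprod, Finset.prod_eq_zero (i := k) (by simp [hkj, hki])]
      · simp
      · simpa [Matrix.one_apply] using fun h => hk h.symm
  rw [wedgeTop]
  simp only [hinner]
  rw [sum_perm_apply_pair (fun a b => E a a * Q b b - E a b * Q b a) (fun a => by ring) hij]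
  congr 2
  simp only [Finset.sum_sub_distrib, ← Finset.mul_sum, ← Finset.sum_mul, trace, Matrix.diag_apply,
    Matrix.mul_apply]

lemma factorial_sub_one_eq {n : ℕ} (hn : 2 ≤ n) :
    ((n - 1).factorial : ℂ) = (n - 1) * (n - 2).factorial := by
  obtain ⟨k, rfl⟩ := Nat.exists_eq_add_of_le hn
  rw [show 2 + k - 1 = k + 1 by omega, Nat.factorial_succ, show 2 + k - 2 = k by omega]
  push_cast
  ring

lemma wedgeTop_update_one (hn : 2 ≤ n) (i : Fin n) (E : Matrix (Fin n) (Fin n) ℂ) :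
    wedgeTop (update (fun _ => 1) i E)
      = ((Real.pi : ℂ) ^ n)⁻¹ * ((n - 1).factorial * E.trace) := by
  obtain ⟨j, hj⟩ : ∃ j : Fin n, i ≠ j := by
    have : Nontrivial (Fin n) := Fin.nontrivial_iff_two_le.2 hn
    obtain ⟨j, hj⟩ := exists_ne i
    exact ⟨j, hj.symm⟩
  have h := wedgeTop_update_update_one hj E 1
  rw [update_eq_self_iff.2 (by rw [update_of_ne hj.symm])] at h
  rw [h, factorial_sub_one_eq hn]
  simp
  ring_nf

/-- Subtract `Q` in all the slots belonging to `S`. -/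
def subOn (M : Fin n → Matrix (Fin n) (Fin n) ℂ) (Q : Matrix (Fin n) (Fin n) ℂ)
    (S : Finset (Fin n)) : Fin n → Matrix (Fin n) (Fin n) ℂ :=
  fun i => if i ∈ S then M i - Q else M i

lemma subOn_empty (M : Fin n → Matrix (Fin n) (Fin n) ℂ) (Q : Matrix (Fin n) (Fin n) ℂ) :
    subOn M Q ∅ = M := by
  funext k
  simp [subOn]

lemma subOn_insert (M : Fin n → Matrix (Fin n) (Fin n) ℂ) (Q : Matrix (Fin n) (Fin n) ℂ)
    (S : Finset (Fin n)) (i : Fin n) :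
    subOn M Q (insert i S) = update (subOn M Q S) i (M i - Q) := by
  funext k
  by_cases hk : k = i
  · subst hk; simp [subOn]
  · simp [subOn, hk]

/-- Once the rank one matrix occupies slot `j`, any further occurrence of it contributes zero. -/
lemma wedgeTop_update_subOn (M : Fin n → Matrix (Fin n) (Fin n) ℂ) (v w : Fin n → ℂ)
    (S : Finset (Fin n)) {j : Fin n} (hj : j ∉ S) :
    wedgeTop (update (subOn M (vecMulVec v w) S) j (vecMulVec v w))
      = wedgeTop (update M j (vecMulVec v w)) := by
  induction S using Finset.induction_on with
  | empty => simp [subOn_empty]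
  | insert i S hi ih =>
    have hji : j ≠ i := fun h => hj (by simp [h])
    rw [subOn_insert, update_comm hji.symm, wedgeTop_update_sub,
      wedgeTop_eq_zero_of_rank_one (update (update (subOn M (vecMulVec v w) S) j (vecMulVec v w)) i
        (vecMulVec v w)) hji v w (by rw [update_of_ne hji, update_self])
        (by rw [update_self]), sub_zero,
      update_eq_self_iff.2 (by rw [update_of_ne hji.symm]; simp [subOn, hi])]
    exact ih fun h => hj (Finset.mem_insert_of_mem h)

/-- The multilinear expansion stops after the first order, since two copies of the same rank one
matrix give zero. -/
lemma wedgeTop_subOn (M : Fin n → Matrix (Fin n) (Fin n) ℂ) (v w : Fin n → ℂ)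
    (S : Finset (Fin n)) :
    wedgeTop (subOn M (vecMulVec v w) S)
      = wedgeTop M - ∑ i ∈ S, wedgeTop (update M i (vecMulVec v w)) := by
  induction S using Finset.induction_on with
  | empty => simp [subOn_empty]
  | insert i S hi ih =>
    rw [subOn_insert, wedgeTop_update_sub, wedgeTop_update_subOn M v w S hi,
      update_eq_self_iff.2 (by simp [subOn, hi]), ih, Finset.sum_insert hi]
    ring

/-- First order expansion in the rank one part; each of the `m - 1` correction terms has only two
slots different from the identity and is given by `wedgeTop_update_update_one`. Taking elementary
matrices for `E` yields the coefficients that enter `ddcDensity`. -/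
lemma wedgeTop_factors {m : ℕ} (hm : 1 ≤ m) (hmn : m < n) (E : Matrix (Fin n) (Fin n) ℂ)
    (v w : Fin n → ℂ) :
    wedgeTop (factors m E (fun _ => 1 - vecMulVec v w)) = ((Real.pi : ℂ) ^ n)⁻¹ *
      ((n - 2).factorial * ((n - 1 - (m - 1) * (v ⬝ᵥ w)) * E.trace
        + (m - 1) * (E * vecMulVec v w).trace)) := by
  have hn : 2 ≤ n := by omega
  let i₀ : Fin n := ⟨0, by omega⟩
  -- The slots `1, …, m - 1`; slot `0` holds `E`.
  let S : Finset (Fin n) := (Finset.univ.filter fun i : Fin n => (i : ℕ) < m).erase i₀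
  have hS : S.card = m - 1 := by
    rw [Finset.card_erase_of_mem (by simp [i₀]; omega)]
    congr 1
    rw [Fin.card_filter_val_lt]
    omega
  have hf : factors m E (fun _ => 1 - vecMulVec v w)
      = subOn (update (fun _ => 1) i₀ E) (vecMulVec v w) S := by
    funext i
    by_cases hi : i = i₀
    · subst hi; simp [factors, subOn, S, i₀]
    · have hi' : (i : ℕ) ≠ 0 := fun h => hi (Fin.ext h)
      simp [factors, subOn, S, hi, hi']
  rw [hf, wedgeTop_subOn, wedgeTop_update_one hn]
  rw [Finset.sum_congr rfl fun i hi =>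
    wedgeTop_update_update_one (Finset.ne_of_mem_erase hi).symm E (vecMulVec v w)]
  rw [Finset.sum_const, hS, factorial_sub_one_eq hn, nsmul_eq_mul, Nat.cast_sub hm,
    trace_vecMulVec]
  push_cast
  ring

/-- By the first order expansion, `α^j ∧ β^{n-j}` is a positive multiple of `n - j s`. For `j ≤ m`
this is nonnegative as soon as `s ≤ n / m`, and at `s = n / m` it vanishes for `j = m`. -/
lemma isMPositive_one_sub {m : ℕ} (hm : 1 ≤ m) (hmn : m < n) (v w : Fin n → ℂ) {s : ℝ}
    (hs : v ⬝ᵥ w = s) (hsn : s ≤ n / m) (hH : (vecMulVec v w).IsHermitian) :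
    IsMPositive m (1 - vecMulVec v w) := by
  have hn : 2 ≤ n := by omega
  refine ⟨Matrix.isHermitian_one.sub hH, fun j hj hjm => ?_⟩
  have hf : (fun i : Fin n => if (i : ℕ) < j then 1 - vecMulVec v w else 1)
      = subOn (fun _ => 1) (vecMulVec v w) (Finset.univ.filter fun i : Fin n => (i : ℕ) < j) := by
    funext i; simp [subOn]
  have h1 : wedgeTop (fun _ : Fin n => (1 : Matrix (Fin n) (Fin n) ℂ))
      = ((Real.pi : ℂ) ^ n)⁻¹ * ((n - 1).factorial * n) := by
    have := wedgeTop_update_one hn ⟨0, by omega⟩ (1 : Matrix (Fin n) (Fin n) ℂ)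
    rw [update_eq_self_iff.2 rfl] at this
    simpa using this
  rw [hf, wedgeTop_subOn, h1, Finset.sum_congr rfl fun i _ => wedgeTop_update_one hn i _,
    Finset.sum_const, Fin.card_filter_val_lt, trace_vecMulVec, hs, nsmul_eq_mul,
    min_eq_right (by omega)]
  have e : ((Real.pi : ℂ) ^ n)⁻¹ * ((n - 1).factorial * n)
      - j * (((Real.pi : ℂ) ^ n)⁻¹ * ((n - 1).factorial * (s : ℂ)))
      = (((Real.pi ^ n)⁻¹ * ((n - 1).factorial * (n - j * s)) : ℝ) : ℂ) := by
    push_cast; ring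
  rw [e, Complex.ofReal_re]
  have hm0 : (0 : ℝ) < m := by positivity
  have hjs : j * s ≤ (n : ℝ) := by
    have h2 : j * s ≤ j * (n / m : ℝ) := by gcongr
    have h3 : j * (n / m : ℝ) ≤ m * (n / m : ℝ) := by gcongr
    rw [mul_div_cancel₀ _ hm0.ne'] at h3
    linarith
  have := sub_nonneg.2 hjs
  positivity

end Wedge

/-! ### Calculus of the Wirtinger derivatives -/

section Wirtinger

open ComplexConjugate Matrix

variable {n : ℕ}

lemma dz_add {f g : Cn n → ℂ} {z : Cn n} (hf : DifferentiableAt ℝ f z)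
    (hg : DifferentiableAt ℝ g z) (j : Fin n) :
    dz j (fun w => f w + g w) z = dz j f z + dz j g z := by
  simp only [dz, fderiv_fun_add hf hg, _root_.add_apply]
  ring

lemma dzbar_add {f g : Cn n → ℂ} {z : Cn n} (hf : DifferentiableAt ℝ f z)
    (hg : DifferentiableAt ℝ g z) (j : Fin n) :
    dzbar j (fun w => f w + g w) z = dzbar j f z + dzbar j g z := by
  simp only [dzbar, fderiv_fun_add hf hg, _root_.add_apply]
  ring

lemma dz_sum {ι : Type*} (s : Finset ι) {f : ι → Cn n → ℂ} {z : Cn n}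
    (hf : ∀ i ∈ s, DifferentiableAt ℝ (f i) z) (j : Fin n) :
    dz j (fun w => ∑ i ∈ s, f i w) z = ∑ i ∈ s, dz j (f i) z := by
  simp only [dz, fderiv_fun_sum hf, _root_.sum_apply, Finset.mul_sum,
    ← Finset.sum_sub_distrib]

lemma dz_mul {f g : Cn n → ℂ} {z : Cn n} (hf : DifferentiableAt ℝ f z)
    (hg : DifferentiableAt ℝ g z) (j : Fin n) :
    dz j (fun w => f w * g w) z = dz j f z * g z + f z * dz j g z := by
  simp only [dz, fderiv_fun_mul hf hg, _root_.add_apply,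
    _root_.smul_apply, smul_eq_mul]
  ring

lemma dzbar_mul {f g : Cn n → ℂ} {z : Cn n} (hf : DifferentiableAt ℝ f z)
    (hg : DifferentiableAt ℝ g z) (j : Fin n) :
    dzbar j (fun w => f w * g w) z = dzbar j f z * g z + f z * dzbar j g z := by
  simp only [dzbar, fderiv_fun_mul hf hg, _root_.add_apply,
    _root_.smul_apply, smul_eq_mul]
  ring

lemma dz_const_mul {f : Cn n → ℂ} {z : Cn n} (hf : DifferentiableAt ℝ f z) (c : ℂ) (j : Fin n) :
    dz j (fun w => c * f w) z = c * dz j f z := by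
  rw [dz_mul (differentiableAt_const c) hf]
  simp [dz]

lemma dzbar_const_mul {f : Cn n → ℂ} {z : Cn n} (hf : DifferentiableAt ℝ f z) (c : ℂ)
    (j : Fin n) : dzbar j (fun w => c * f w) z = c * dzbar j f z := by
  rw [dzbar_mul (differentiableAt_const c) hf]
  simp [dzbar]

lemma contDiff_dz {f : Cn n → ℂ} (hf : ContDiff ℝ ∞ f) (j : Fin n) : ContDiff ℝ ∞ (dz j f) := by
  have h : ContDiff ℝ ∞ (fderiv ℝ f) := hf.fderiv_right (by simp)
  exact contDiff_const.mul ((h.clm_apply contDiff_const).sub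
    (contDiff_const.mul (h.clm_apply contDiff_const)))

lemma contDiff_dzbar {f : Cn n → ℂ} (hf : ContDiff ℝ ∞ f) (j : Fin n) :
    ContDiff ℝ ∞ (dzbar j f) := by
  have h : ContDiff ℝ ∞ (fderiv ℝ f) := hf.fderiv_right (by simp)
  exact contDiff_const.mul ((h.clm_apply contDiff_const).add
    (contDiff_const.mul (h.clm_apply contDiff_const)))

lemma dz_eq_zero {f : Cn n → ℂ} {z : Cn n} (hz : z ∉ tsupport f) (j : Fin n) : dz j f z = 0 := by
  simp [dz, fderiv_of_notMem_tsupport ℝ hz]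

lemma tsupport_dzbar_subset (f : Cn n → ℂ) (j : Fin n) : tsupport (dzbar j f) ⊆ tsupport f := by
  refine closure_minimal (fun z hz => ?_) (isClosed_tsupport _)
  by_contra h
  exact hz (by simp [dzbar, fderiv_of_notMem_tsupport ℝ h])

/-- The coordinate `w_k = z_k - a_k`. -/
def coord (a : Cn n) (k : Fin n) (z : Cn n) : ℂ := z k - a k

lemma contDiff_coord (a : Cn n) (k : Fin n) : ContDiff ℝ ∞ (coord a k) := by
  unfold coord; fun_prop

lemma contDiff_conj_coord (a : Cn n) (k : Fin n) : ContDiff ℝ ∞ (fun z => conj (coord a k z)) :=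
  Complex.conjCLE.contDiff.comp (contDiff_coord a k)

lemma hasFDerivAt_coord (a : Cn n) (k : Fin n) (z : Cn n) :
    HasFDerivAt (coord a k)
      ((EuclideanSpace.proj k : Cn n →L[ℂ] ℂ).restrictScalars ℝ) z := by
  exact (((EuclideanSpace.proj k : Cn n →L[ℂ] ℂ).restrictScalars ℝ).hasFDerivAt).sub_const _

lemma dz_coord (a : Cn n) (j k : Fin n) (z : Cn n) :
    dz j (coord a k) z = if j = k then 1 else 0 := by
  rw [dz, (hasFDerivAt_coord a k z).fderiv]
  by_cases h : j = k
  · subst h; simp; ring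
  · simp [h, Ne.symm h]

lemma dzbar_coord (a : Cn n) (j k : Fin n) (z : Cn n) : dzbar j (coord a k) z = 0 := by
  rw [dzbar, (hasFDerivAt_coord a k z).fderiv]
  by_cases h : j = k
  · subst h; simp
  · simp [Ne.symm h]

lemma hasFDerivAt_conj_coord (a : Cn n) (k : Fin n) (z : Cn n) :
    HasFDerivAt (fun z => conj (coord a k z)) ((Complex.conjCLE : ℂ →L[ℝ] ℂ).comp
      ((EuclideanSpace.proj k : Cn n →L[ℂ] ℂ).restrictScalars ℝ)) z :=
  (Complex.conjCLE : ℂ →L[ℝ] ℂ).hasFDerivAt.comp z (hasFDerivAt_coord a k z)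

lemma dz_conj_coord (a : Cn n) (j k : Fin n) (z : Cn n) :
    dz j (fun z => conj (coord a k z)) z = 0 := by
  rw [dz, (hasFDerivAt_conj_coord a k z).fderiv]
  by_cases h : j = k
  · subst h; simp
  · simp [Ne.symm h]

lemma dzbar_conj_coord (a : Cn n) (j k : Fin n) (z : Cn n) :
    dzbar j (fun z => conj (coord a k z)) z = if j = k then 1 else 0 := by
  rw [dzbar, (hasFDerivAt_conj_coord a k z).fderiv]
  by_cases h : j = k
  · subst h; simp; ring
  · simp [h, Ne.symm h]

/-- The square of the distance to `a`. -/
def distSq (a z : Cn n) : ℝ := ‖z - a‖ ^ 2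

lemma ofReal_distSq (a z : Cn n) :
    (distSq a z : ℂ) = ∑ k, conj (coord a k z) * coord a k z := by
  rw [distSq, EuclideanSpace.norm_sq_eq]
  push_cast
  refine Finset.sum_congr rfl fun k _ => ?_
  rw [← Complex.normSq_eq_conj_mul_self, Complex.normSq_eq_norm_sq]
  simp [coord]

lemma contDiff_distSq (a : Cn n) : ContDiff ℝ ∞ (distSq a) := by
  have h : distSq a = fun z => (∑ k, conj (coord a k z) * coord a k z).re := by
    funext z
    rw [← ofReal_distSq, Complex.ofReal_re]
  rw [h]
  exact Complex.reCLM.contDiff.comp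
    (ContDiff.sum fun k _ => (contDiff_conj_coord a k).mul (contDiff_coord a k))

lemma diff_of_contDiff {f : Cn n → ℂ} (hf : ContDiff ℝ ∞ f) (z : Cn n) :
    DifferentiableAt ℝ f z := hf.differentiable (by simp) z

lemma contDiff_radial {h : ℝ → ℝ} (hh : ContDiff ℝ ∞ h) (a : Cn n) :
    ContDiff ℝ ∞ (fun z => (h (distSq a z) : ℂ)) :=
  Complex.ofRealCLM.contDiff.comp (hh.comp (contDiff_distSq a))

lemma fderiv_radial {h : ℝ → ℝ} (hh : ContDiff ℝ ∞ h) (a z v : Cn n) :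
    fderiv ℝ (fun z => (h (distSq a z) : ℂ)) z v
      = deriv h (distSq a z) * fderiv ℝ (fun z => (distSq a z : ℂ)) z v := by
  have h1 : HasFDerivAt (distSq a) (fderiv ℝ (distSq a) z) z :=
    ((contDiff_distSq a).differentiable (by simp) z).hasFDerivAt
  have h2 : HasDerivAt h (deriv h (distSq a z)) (distSq a z) :=
    (hh.differentiable (by simp) _).hasDerivAt
  have h3 := Complex.ofRealCLM.hasFDerivAt.comp z (h2.comp_hasFDerivAt z h1)
  have h4 := Complex.ofRealCLM.hasFDerivAt.comp z h1
  have e3 : fderiv ℝ (fun z => (h (distSq a z) : ℂ)) z = _ := h3.fderiv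
  have e4 : fderiv ℝ (fun z => (distSq a z : ℂ)) z = _ := h4.fderiv
  rw [e3, e4]
  simp

lemma dz_distSq (a : Cn n) (j : Fin n) (z : Cn n) :
    dz j (fun z => (distSq a z : ℂ)) z = conj (coord a j z) := by
  simp only [ofReal_distSq]
  rw [dz_sum _ fun k _ => diff_of_contDiff ((contDiff_conj_coord a k).mul (contDiff_coord a k)) z]
  simp only [dz_mul (diff_of_contDiff (contDiff_conj_coord a _) z)
    (diff_of_contDiff (contDiff_coord a _) z), dz_coord, dz_conj_coord]
  simp

/-- The complex conjugate of `dz_distSq`, the differential of `distSq` being real. -/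
lemma dzbar_distSq (a : Cn n) (j : Fin n) (z : Cn n) :
    dzbar j (fun z => (distSq a z : ℂ)) z = coord a j z := by
  have h := dz_distSq a j z
  have hre : ∀ v, conj (fderiv ℝ (fun z => (distSq a z : ℂ)) z v)
      = fderiv ℝ (fun z => (distSq a z : ℂ)) z v := by
    intro v
    have h1 : HasFDerivAt (distSq a) (fderiv ℝ (distSq a) z) z :=
      ((contDiff_distSq a).differentiable (by simp) z).hasFDerivAt
    have h4 := Complex.ofRealCLM.hasFDerivAt.comp z h1
    have e4 : fderiv ℝ (fun z => (distSq a z : ℂ)) z = _ := h4.fderiv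
    rw [e4]
    simp
  rw [dz] at h
  have h' := congrArg conj h
  rw [dzbar]
  simp only [map_mul, map_sub, hre, Complex.conj_conj, Complex.conj_I] at h'
  rw [← h', map_div₀, map_one, map_ofNat]
  ring

lemma dz_radial {h : ℝ → ℝ} (hh : ContDiff ℝ ∞ h) (a : Cn n) (j : Fin n) (z : Cn n) :
    dz j (fun z => (h (distSq a z) : ℂ)) z
      = deriv h (distSq a z) * conj (coord a j z) := by
  rw [← dz_distSq, dz, dz, fderiv_radial hh, fderiv_radial hh]
  ring

lemma dzbar_radial {h : ℝ → ℝ} (hh : ContDiff ℝ ∞ h) (a : Cn n) (j : Fin n) (z : Cn n) :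
    dzbar j (fun z => (h (distSq a z) : ℂ)) z = deriv h (distSq a z) * coord a j z := by
  rw [← dzbar_distSq, dzbar, dzbar, fderiv_radial hh, fderiv_radial hh]
  ring

/-- The complex divergence of the radial field `h(t) w`. All second order radial computations reduce
to it, since the `∂/∂z̄` derivatives that occur sum up to fields of this type. -/
lemma sum_dz_radial_mul_coord {h : ℝ → ℝ} (hh : ContDiff ℝ ∞ h) (a z : Cn n) :
    ∑ j, dz j (fun z => (h (distSq a z) : ℂ) * coord a j z) z
      = ((distSq a z * deriv h (distSq a z) + n * h (distSq a z) : ℝ) : ℂ) := by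
  simp only [dz_mul (diff_of_contDiff (contDiff_radial hh a) z)
    (diff_of_contDiff (contDiff_coord a _) z), dz_radial hh, dz_coord, Finset.sum_add_distrib]
  push_cast
  rw [ofReal_distSq, Finset.sum_mul]
  congr 1
  · exact Finset.sum_congr rfl fun k _ => by ring
  · simp

lemma contDiff_deriv {h : ℝ → ℝ} (hh : ContDiff ℝ ∞ h) : ContDiff ℝ ∞ (deriv h) :=
  hh.iterate_deriv 1

lemma sum_dz_dzbar_radial {h : ℝ → ℝ} (hh : ContDiff ℝ ∞ h) (a z : Cn n) :
    ∑ j, dz j (dzbar j (fun z => (h (distSq a z) : ℂ))) z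
      = ((distSq a z * deriv (deriv h) (distSq a z) + n * deriv h (distSq a z) : ℝ) : ℂ) := by
  rw [← sum_dz_radial_mul_coord (contDiff_deriv hh)]
  refine Finset.sum_congr rfl fun j _ => ?_
  congr 1
  funext w
  exact dzbar_radial hh a j w

lemma dzbar_radial_mul_conj_mul {h : ℝ → ℝ} (hh : ContDiff ℝ ∞ h) (a : Cn n) (j k : Fin n) :
    dzbar k (fun z => (h (distSq a z) : ℂ) * (conj (coord a k z) * coord a j z))
      = fun z => deriv h (distSq a z) * (conj (coord a k z) * coord a k z) * coord a j z
        + h (distSq a z) * coord a j z := by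
  funext z
  rw [dzbar_mul (diff_of_contDiff (contDiff_radial hh a) z) (diff_of_contDiff
      ((contDiff_conj_coord a k).mul (contDiff_coord a j)) z),
    dzbar_mul (diff_of_contDiff (contDiff_conj_coord a k) z)
      (diff_of_contDiff (contDiff_coord a j) z), dzbar_radial hh, dzbar_coord, dzbar_conj_coord]
  simp
  ring

/-- Summing the `∂/∂z̄_k` derivatives over `k` gives the radial field `(t h' + n h) w_j`, to which
`sum_dz_radial_mul_coord` applies once more. -/
lemma sum_dz_dzbar_radial_mul {h : ℝ → ℝ} (hh : ContDiff ℝ ∞ h) (a z : Cn n) :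
    ∑ j, ∑ k, dz j (dzbar k
        (fun z => (h (distSq a z) : ℂ) * (conj (coord a k z) * coord a j z))) z
      = ((distSq a z * deriv (fun t => t * deriv h t + n * h t) (distSq a z)
        + n * (distSq a z * deriv h (distSq a z) + n * h (distSq a z)) : ℝ) : ℂ) := by
  have hH : ContDiff ℝ ∞ (fun t => t * deriv h t + n * h t) :=
    (contDiff_id.mul (contDiff_deriv hh)).add (contDiff_const.mul hh)
  rw [← sum_dz_radial_mul_coord hH]
  refine Finset.sum_congr rfl fun j _ => ?_
  simp only [dzbar_radial_mul_conj_mul hh]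
  rw [← dz_sum]
  · congr 1
    funext w
    rw [Finset.sum_add_distrib, ← Finset.sum_mul, ← Finset.mul_sum, ← ofReal_distSq]
    simp
    ring
  · intro k _
    exact diff_of_contDiff ((((contDiff_radial (contDiff_deriv hh) a).mul
      ((contDiff_conj_coord a k).mul (contDiff_coord a k))).mul (contDiff_coord a j)).add
      ((contDiff_radial hh a).mul (contDiff_coord a j))) z

/-! ### The densities of `dd^c` of the test forms -/

/-- The density of `dd^c χ ∧ β^{n-1}`. -/
def laplaceDensity (χ : Cn n → ℝ) (z : Cn n) : ℝ :=
  ((n - 1).factorial : ℝ) / Real.pi ^ n *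
    (∑ j : Fin n, dz j (dzbar j (fun w => (χ w : ℂ))) z).re

lemma contDiff_ofReal {χ : Cn n → ℝ} (hχ : ContDiff ℝ ∞ χ) :
    ContDiff ℝ ∞ (fun z => (χ z : ℂ)) := Complex.ofRealCLM.contDiff.comp hχ

lemma dz_dzbar_const_mul {f : Cn n → ℂ} (hf : ContDiff ℝ ∞ f) (c : ℂ) (j k : Fin n) (z : Cn n) :
    dz j (dzbar k (fun w => c * f w)) z = c * dz j (dzbar k f) z := by
  rw [← dz_const_mul (diff_of_contDiff (contDiff_dzbar hf k) z)]
  congr 1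
  funext w
  exact dzbar_const_mul (diff_of_contDiff hf w) c k

lemma dz_dzbar_add {f g : Cn n → ℂ} (hf : ContDiff ℝ ∞ f) (hg : ContDiff ℝ ∞ g) (j k : Fin n)
    (z : Cn n) :
    dz j (dzbar k (fun w => f w + g w)) z = dz j (dzbar k f) z + dz j (dzbar k g) z := by
  rw [← dz_add (diff_of_contDiff (contDiff_dzbar hf k) z)
    (diff_of_contDiff (contDiff_dzbar hg k) z)]
  congr 1
  funext w
  exact dzbar_add (diff_of_contDiff hf w) (diff_of_contDiff hg w) k

/-- With all `α_k = β` the form is `β^{n-1}` whatever `m` is. Hence the pairing for `m` with these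
`α_k` agrees with the pairing for `1` that defines the trace measure. -/
lemma ddcDensity_one {m : ℕ} (hm : 1 ≤ m) (hmn : m < n) {χ : Cn n → ℝ} (hχ : ContDiff ℝ ∞ χ)
    (z : Cn n) : ddcDensity m χ (fun _ _ => 1) z = laplaceDensity χ z := by
  have h1 : ∀ j k : Fin n, wedgeTop (factors m (Matrix.single j k 1) fun _ => 1)
      = if j = k then ((Real.pi : ℂ) ^ n)⁻¹ * (n - 1).factorial else 0 := by
    intro j k
    have := wedgeTop_factors hm hmn (Matrix.single j k 1) 0 0
    rw [Matrix.zero_vecMulVec, sub_zero] at this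
    rw [this, factorial_sub_one_eq (by omega)]
    by_cases hjk : j = k
    · subst hjk; simp; ring
    · simp [hjk]
  have h2 : ∀ j k : Fin n, dz j (dzbar k (fun w => (χ w : ℂ) *
      wedgeTop (factors m (Matrix.single j k 1) fun _ => 1))) z
      = if j = k then ((Real.pi : ℂ) ^ n)⁻¹ * (n - 1).factorial *
          dz j (dzbar k (fun w => (χ w : ℂ))) z else 0 := by
    intro j k
    rw [h1]
    by_cases hjk : j = k
    · simp only [hjk, if_true, mul_comm (_ : ℂ) (((Real.pi : ℂ) ^ n)⁻¹ * _)]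
      rw [dz_dzbar_const_mul (contDiff_ofReal hχ)]
    · have h0 : dzbar k (fun _ : Cn n => (0 : ℂ)) = fun _ => 0 := by funext; simp [dzbar]
      simp [hjk, h0, dz]
  rw [ddcDensity, laplaceDensity]
  simp only [h2, Finset.sum_ite_eq, Finset.mem_univ, if_true]
  rw [← Finset.mul_sum, ← Complex.re_ofReal_mul]
  push_cast
  congr 2
  ring

lemma laplaceDensity_radial {h : ℝ → ℝ} (hh : ContDiff ℝ ∞ h) (a z : Cn n) :
    laplaceDensity (fun z => h (distSq a z)) z = ((n - 1).factorial : ℝ) / Real.pi ^ n *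
      (distSq a z * deriv (deriv h) (distSq a z) + n * deriv h (distSq a z)) := by
  rw [laplaceDensity, sum_dz_dzbar_radial hh, Complex.ofReal_re]

/-- The form `β - (n/m) e(t) dd^c`-type perturbation used to test `m`-positivity, where
`t = |z - a|²`: the matrix `1 - (n/m) e(t) w̄ wᵀ`. -/
def radialForm (m : ℕ) (e : ℝ → ℝ) (a z : Cn n) : Matrix (Fin n) (Fin n) ℂ :=
  1 - vecMulVec (fun i => ((n / m * e (distSq a z) : ℝ) : ℂ) * conj (coord a i z))
    (fun i => coord a i z)

lemma radialForm_dotProduct (m : ℕ) (e : ℝ → ℝ) (a z : Cn n) :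
    (fun i => ((n / m * e (distSq a z) : ℝ) : ℂ) * conj (coord a i z)) ⬝ᵥ
      (fun i => coord a i z) = ((n / m * (e (distSq a z) * distSq a z) : ℝ) : ℂ) := by
  simp only [dotProduct, mul_assoc, ← Finset.mul_sum, ← ofReal_distSq]
  push_cast
  ring

lemma isMPositive_radialForm {m : ℕ} (hm : 1 ≤ m) (hmn : m < n) {e : ℝ → ℝ}
    (he : ∀ t, 0 ≤ t → e t * t ≤ 1) (a z : Cn n) : IsMPositive m (radialForm m e a z) := by
  refine isMPositive_one_sub hm hmn _ _ (radialForm_dotProduct m e a z) ?_ ?_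
  · have h1 := he (distSq a z) (sq_nonneg _)
    have h2 : (0 : ℝ) ≤ n / m := by positivity
    nlinarith
  · ext i j
    simp [vecMulVec_apply]
    ring

lemma contDiff_radialForm {m : ℕ} {e : ℝ → ℝ} (he : ContDiff ℝ ∞ e) (a : Cn n) (i j : Fin n) :
    ContDiff ℝ ∞ (fun z => radialForm m e a z i j) := by
  simp only [radialForm, Matrix.sub_apply, vecMulVec_apply]
  exact contDiff_const.sub (((contDiff_radial (contDiff_const.mul he) a).mul
    (contDiff_conj_coord a i)).mul (contDiff_coord a j))

/-- The hypothesis `heψ` says that `e = 1 / t` where `ψ` does not vanish. There the scalar in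
`wedgeTop_factors` becomes `n - 1 - (m - 1) n / m = (n - m) / m`, so the coefficient matrix is a
combination of `ψ` times the identity and of `ψ e w̄_k w_j`, and both parts have explicit radial
densities. -/
lemma ddcDensity_radialForm {m : ℕ} (hm : 1 ≤ m) (hmn : m < n) {e ψ : ℝ → ℝ}
    (he : ContDiff ℝ ∞ e) (hψ : ContDiff ℝ ∞ ψ) (heψ : ∀ t, ψ t * (e t * t) = ψ t) (a z : Cn n) :
    ddcDensity m (fun z => ψ (distSq a z)) (fun _ z => radialForm m e a z) z
      = ((n - 2).factorial : ℝ) / (Real.pi ^ n * m) *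
        ((n - m) * (distSq a z * deriv (deriv ψ) (distSq a z) + n * deriv ψ (distSq a z))
          + n * (m - 1) *
            (distSq a z * deriv (fun t => t * deriv (fun t => ψ t * e t) t + n * (ψ t * e t))
                (distSq a z)
              + n * (distSq a z * deriv (fun t => ψ t * e t) (distSq a z)
                + n * (ψ (distSq a z) * e (distSq a z))))) := by
  have hm0 : (m : ℂ) ≠ 0 := by simp; omega
  set C : ℂ := ((((n - 2).factorial : ℝ) / (Real.pi ^ n * m) : ℝ) : ℂ) with hC
  have h1 : ∀ (j k : Fin n) (w : Cn n), (ψ (distSq a w) : ℂ) *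
      wedgeTop (factors m (Matrix.single j k 1) fun _ => radialForm m e a w)
      = (if j = k then C * (n - m) else 0) * (ψ (distSq a w) : ℂ)
        + C * (n * (m - 1)) * ((((fun t => ψ t * e t) (distSq a w) : ℝ) : ℂ)
          * (conj (coord a k w) * coord a j w)) := by
    intro j k w
    have hp : (ψ (distSq a w) : ℂ) * (e (distSq a w) * distSq a w) = ψ (distSq a w) := by
      exact_mod_cast heψ (distSq a w)
    rw [radialForm, wedgeTop_factors hm hmn, radialForm_dotProduct, hC]
    simp only [Matrix.trace_single_mul, vecMulVec_apply, one_smul]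
    by_cases hjk : j = k
    · subst hjk
      simp only [Matrix.trace_single_eq_same, if_true]
      push_cast
      field_simp
      linear_combination (-((n - 2).factorial * n * ((m : ℂ) - 1))) * hp
    · simp only [Matrix.trace_single_eq_of_ne _ _ _ hjk, hjk, if_false]
      push_cast
      field_simp
      ring
  have hψe : ContDiff ℝ ∞ (fun t => ψ t * e t) := hψ.mul he
  have h2 : ∀ (j k : Fin n), dz j (dzbar k (fun w => (ψ (distSq a w) : ℂ) *
      wedgeTop (factors m (Matrix.single j k 1) fun _ => radialForm m e a w))) z
      = (if j = k then C * (n - m) else 0) * dz j (dzbar k (fun w => (ψ (distSq a w) : ℂ))) z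
        + C * (n * (m - 1)) * dz j (dzbar k (fun w => (((fun t => ψ t * e t) (distSq a w) : ℝ) : ℂ)
          * (conj (coord a k w) * coord a j w))) z := by
    intro j k
    simp only [h1]
    have c1 := contDiff_radial (n := n) hψ a
    have c2 := (contDiff_radial (n := n) hψe a).mul
      ((contDiff_conj_coord a k).mul (contDiff_coord a j))
    rw [dz_dzbar_add (contDiff_const.mul c1) (contDiff_const.mul c2), dz_dzbar_const_mul c1,
      dz_dzbar_const_mul c2]
  rw [ddcDensity]
  simp only [h2, Finset.sum_add_distrib, ← Finset.mul_sum]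
  rw [sum_dz_dzbar_radial_mul hψe]
  simp only [ite_mul, zero_mul, Finset.sum_ite_eq, Finset.mem_univ, if_true, ← Finset.mul_sum]
  rw [sum_dz_dzbar_radial hψ, hC, ← Complex.ofReal_natCast n, ← Complex.ofReal_natCast m,
    ← Complex.ofReal_one]
  simp only [← Complex.ofReal_mul, ← Complex.ofReal_sub, ← Complex.ofReal_add, Complex.ofReal_re]
  ring

end Wirtinger

/-! ### Polar coordinates -/

section Polar

open Measure

variable {n : ℕ}

lemma finrank_real_Cn (n : ℕ) : Module.finrank ℝ (Cn n) = 2 * n := by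
  rw [← Module.finrank_mul_finrank ℝ ℂ]; simp

lemma nontrivial_Cn (hn : 0 < n) : Nontrivial (Cn n) := by
  have : NeZero n := ⟨hn.ne'⟩
  infer_instance

instance isFiniteMeasure_unitSphereMeasure : IsFiniteMeasure (unitSphereMeasure n) := by
  unfold unitSphereMeasure; infer_instance

lemma measurable_polar (a : Cn n) :
    Measurable fun p : sphere (0 : Cn n) 1 × ℝ => a + p.2 • (p.1 : Cn n) := by
  fun_prop

lemma lintegral_volumeIoiPow (k : ℕ) {g : ℝ → ENNReal} (hg : Measurable g) :
    ∫⁻ r, g r ∂(volumeIoiPow k) = ∫⁻ r in Set.Ioi 0, ENNReal.ofReal (r ^ k) * g r := by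
  rw [volumeIoiPow, lintegral_withDensity_eq_lintegral_mul _ (by fun_prop) (by fun_prop),
    ← lintegral_subtype_comap measurableSet_Ioi]
  rfl

lemma integral_volumeIoiPow (k : ℕ) (g : ℝ → ℝ) :
    ∫ r, g r ∂(volumeIoiPow k) = ∫ r in Set.Ioi 0, r ^ k * g r := by
  simp only [volumeIoiPow, ENNReal.ofReal]
  rw [integral_withDensity_eq_integral_smul (by fun_prop),
    integral_subtype_comap measurableSet_Ioi fun a ↦ Real.toNNReal (a ^ k) • g a]
  refine setIntegral_congr_fun measurableSet_Ioi fun x hx ↦ ?_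
  simp only [NNReal.smul_def, Real.coe_toNNReal _ (pow_nonneg (le_of_lt hx) _), smul_eq_mul]

/-- Integration in polar coordinates around `a`. -/
theorem lintegral_polar (hn : 0 < n) (a : Cn n) {g : Cn n → ENNReal} (hg : Measurable g) :
    ∫⁻ z, g z = ∫⁻ r in Set.Ioi 0, ENNReal.ofReal (r ^ (2 * n - 1)) *
      ∫⁻ ξ : sphere (0 : Cn n) 1, g (a + r • (ξ : Cn n)) ∂(unitSphereMeasure n) := by
  have := nontrivial_Cn hn
  have hm : Measurable fun p : sphere (0 : Cn n) 1 × ℝ => g (a + p.2 • (p.1 : Cn n)) :=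
    hg.comp (measurable_polar a)
  calc ∫⁻ z, g z = ∫⁻ z, g (a + z) := (lintegral_add_left_eq_self g a).symm
    _ = ∫⁻ z : ({(0)}ᶜ : Set (Cn n)), g (a + z) ∂(volume.comap Subtype.val) := by
        rw [lintegral_subtype_comap (measurableSet_singleton _).compl fun z => g (a + z),
          restrict_compl_singleton]
    _ = ∫⁻ p : sphere (0 : Cn n) 1 × Set.Ioi (0 : ℝ), g (a + (p.2 : ℝ) • (p.1 : Cn n))
          ∂((unitSphereMeasure n).prod (volumeIoiPow (2 * n - 1))) := by
        have h := (volume : Measure (Cn n)).measurePreserving_homeomorphUnitSphereProd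
        rw [finrank_real_Cn] at h
        rw [unitSphereMeasure, ← h.lintegral_comp_emb (Homeomorph.measurableEmbedding _)]
        refine lintegral_congr fun z => ?_
        have hz : ‖(z : Cn n)‖ ≠ 0 := norm_ne_zero_iff.2 z.2
        simp [smul_smul, hz]
    _ = ∫⁻ r : Set.Ioi (0 : ℝ), ∫⁻ ξ : sphere (0 : Cn n) 1, g (a + (r : ℝ) • (ξ : Cn n))
          ∂(unitSphereMeasure n) ∂(volumeIoiPow (2 * n - 1)) := by
        rw [lintegral_prod_symm]
        exact (hg.comp (by fun_prop)).aemeasurable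
    _ = _ := by
        rw [lintegral_volumeIoiPow (g := fun r => ∫⁻ ξ : sphere (0 : Cn n) 1,
          g (a + r • (ξ : Cn n)) ∂(unitSphereMeasure n)) _ hm.lintegral_prod_left']

lemma unitSphereMeasure_univ_ne_zero (hn : 0 < n) : unitSphereMeasure n Set.univ ≠ 0 := by
  have := nontrivial_Cn hn
  rw [unitSphereMeasure, Ne, Measure.measure_univ_eq_zero]
  exact toSphere_ne_zero _

lemma comp_homeomorphUnitSphereProd (a : Cn n) (g : Cn n → ℝ) :
    (fun z : ({(0)}ᶜ : Set (Cn n)) => g (a + z))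
      = (fun p : sphere (0 : Cn n) 1 × Set.Ioi (0 : ℝ) => g (a + (p.2 : ℝ) • (p.1 : Cn n))) ∘
        homeomorphUnitSphereProd (Cn n) := by
  funext z
  have hz : ‖(z : Cn n)‖ ≠ 0 := norm_ne_zero_iff.2 z.2
  simp [smul_smul, hz]

lemma measurePreserving_polar (hn : 0 < n) :
    MeasurePreserving (homeomorphUnitSphereProd (Cn n))
      ((volume : Measure (Cn n)).comap Subtype.val)
      ((unitSphereMeasure n).prod (volumeIoiPow (2 * n - 1))) := by
  have := nontrivial_Cn hn
  have h := (volume : Measure (Cn n)).measurePreserving_homeomorphUnitSphereProd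
  rwa [finrank_real_Cn] at h

lemma integrable_comp_polar (hn : 0 < n) (a : Cn n) {g : Cn n → ℝ} (hg : Integrable g) :
    Integrable (fun p : sphere (0 : Cn n) 1 × Set.Ioi (0 : ℝ) => g (a + (p.2 : ℝ) • (p.1 : Cn n)))
      ((unitSphereMeasure n).prod (volumeIoiPow (2 * n - 1))) := by
  have he := (homeomorphUnitSphereProd (Cn n)).measurableEmbedding
  have hi : Integrable (fun z : ({(0)}ᶜ : Set (Cn n)) => g (a + z)) (volume.comap Subtype.val) := by
    have := (hg.comp_add_left a).integrableOn (s := ({(0)}ᶜ : Set (Cn n)))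
    rwa [integrableOn_iff_comap_subtypeVal (measurableSet_singleton _).compl] at this
  rwa [comp_homeomorphUnitSphereProd, (measurePreserving_polar hn).integrable_comp_emb he] at hi

lemma integrable_volumeIoiPow_iff (k : ℕ) (g : ℝ → ℝ) :
    Integrable (fun r : Set.Ioi (0 : ℝ) => g r) (volumeIoiPow k)
      ↔ IntegrableOn (fun r => r ^ k * g r) (Set.Ioi 0) := by
  rw [integrableOn_iff_comap_subtypeVal measurableSet_Ioi, volumeIoiPow,
    integrable_withDensity_iff_integrable_smul' (by fun_prop) (by simp)]
  refine integrable_congr (Eventually.of_forall fun r => ?_)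
  have hr : (0 : ℝ) ≤ (r : ℝ) ^ k := pow_nonneg (le_of_lt r.2) _
  simp [ENNReal.toReal_ofReal hr]

/-- Integrability in polar coordinates around `a`. -/
theorem integrable_polar (hn : 0 < n) (a : Cn n) {g : Cn n → ℝ} (hg : Integrable g) :
    IntegrableOn (fun r => r ^ (2 * n - 1) *
      ∫ ξ : sphere (0 : Cn n) 1, g (a + r • (ξ : Cn n)) ∂(unitSphereMeasure n)) (Set.Ioi 0) :=
  (integrable_volumeIoiPow_iff _ _).1 (integrable_comp_polar hn a hg).integral_prod_right

/-- Integration in polar coordinates around `a`. -/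
theorem integral_polar (hn : 0 < n) (a : Cn n) {g : Cn n → ℝ} (hg : Integrable g) :
    ∫ z, g z = ∫ r in Set.Ioi 0, r ^ (2 * n - 1) *
      ∫ ξ : sphere (0 : Cn n) 1, g (a + r • (ξ : Cn n)) ∂(unitSphereMeasure n) := by
  have he := (homeomorphUnitSphereProd (Cn n)).measurableEmbedding
  calc ∫ z, g z = ∫ z, g (a + z) := (integral_add_left_eq_self g a).symm
    _ = ∫ z : ({(0)}ᶜ : Set (Cn n)), g (a + z) ∂(volume.comap Subtype.val) := by
        have := nontrivial_Cn hn
        rw [integral_subtype_comap (measurableSet_singleton _).compl fun z => g (a + z),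
          restrict_compl_singleton]
    _ = ∫ p : sphere (0 : Cn n) 1 × Set.Ioi (0 : ℝ), g (a + (p.2 : ℝ) • (p.1 : Cn n))
          ∂((unitSphereMeasure n).prod (volumeIoiPow (2 * n - 1))) := by
        rw [comp_homeomorphUnitSphereProd]
        exact (measurePreserving_polar hn).integral_comp he
          fun p : sphere (0 : Cn n) 1 × Set.Ioi (0 : ℝ) => g (a + (p.2 : ℝ) • (p.1 : Cn n))
    _ = ∫ r : Set.Ioi (0 : ℝ), ∫ ξ : sphere (0 : Cn n) 1, g (a + (r : ℝ) • (ξ : Cn n))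
          ∂(unitSphereMeasure n) ∂(volumeIoiPow (2 * n - 1)) :=
        integral_prod_symm _ (integrable_comp_polar hn a hg)
    _ = _ := integral_volumeIoiPow _ fun r => ∫ ξ : sphere (0 : Cn n) 1,
          g (a + r • (ξ : Cn n)) ∂(unitSphereMeasure n)

lemma mem_ball_polar (a : Cn n) {r R : ℝ} (hr : 0 < r) (ξ : sphere (0 : Cn n) 1) :
    a + r • (ξ : Cn n) ∈ ball a R ↔ r < R := by
  simp [norm_smul, abs_of_pos hr]

lemma mem_closedBall_polar (a : Cn n) {r R : ℝ} (hr : 0 < r) (ξ : sphere (0 : Cn n) 1) :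
    a + r • (ξ : Cn n) ∈ closedBall a R ↔ r ≤ R := by
  simp [norm_smul, abs_of_pos hr]

lemma distSq_polar (a : Cn n) (r : ℝ) (ξ : sphere (0 : Cn n) 1) :
    distSq a (a + r • (ξ : Cn n)) = r ^ 2 := by
  simp [distSq, norm_smul]

lemma lintegral_ball_polar (hn : 0 < n) (a : Cn n) {g : Cn n → ENNReal} (hg : Measurable g)
    (R : ℝ) :
    ∫⁻ z in ball a R, g z = ∫⁻ r in Set.Ioo 0 R, ENNReal.ofReal (r ^ (2 * n - 1)) *
      ∫⁻ ξ : sphere (0 : Cn n) 1, g (a + r • (ξ : Cn n)) ∂(unitSphereMeasure n) := by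
  rw [← lintegral_indicator measurableSet_ball,
    lintegral_polar hn a (hg.indicator measurableSet_ball), ← Set.Ioi_inter_Iio,
    Set.inter_comm, ← Measure.restrict_restrict measurableSet_Iio,
    ← lintegral_indicator measurableSet_Iio]
  refine setLIntegral_congr_fun measurableSet_Ioi fun r hr => ?_
  by_cases hrR : r < R
  · simp only [Set.indicator, mem_ball_polar a hr, hrR, if_true, Set.mem_Iio]
  · simp only [Set.indicator, mem_ball_polar a hr, hrR, if_false, Set.mem_Iio, lintegral_zero,
      mul_zero]

lemma setIntegral_ball_polar (hn : 0 < n) (a : Cn n) {g : Cn n → ℝ} {R : ℝ}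
    (hg : IntegrableOn g (ball a R)) :
    ∫ z in ball a R, g z = ∫ r in Set.Ioo 0 R, r ^ (2 * n - 1) *
      ∫ ξ : sphere (0 : Cn n) 1, g (a + r • (ξ : Cn n)) ∂(unitSphereMeasure n) := by
  rw [← integral_indicator measurableSet_ball,
    integral_polar hn a ((integrable_indicator_iff measurableSet_ball).2 hg), ← Set.Ioi_inter_Iio,
    Set.inter_comm, ← Measure.restrict_restrict measurableSet_Iio,
    ← integral_indicator measurableSet_Iio]
  refine setIntegral_congr_fun measurableSet_Ioi fun r hr => ?_
  by_cases hrR : r < R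
  · simp only [Set.indicator, mem_ball_polar a hr, hrR, if_true, Set.mem_Iio]
  · simp only [Set.indicator, mem_ball_polar a hr, hrR, if_false, Set.mem_Iio, integral_zero,
      mul_zero]

end Polar

/-! ### Subharmonic functions are locally integrable -/

section Subharmonic

variable {n : ℕ} {Ω : Set (Cn n)} {φ : Cn n → EReal}

/-- The function `M - φ` with values in `[0, ∞]`. -/
def gap (φ : Cn n → EReal) (M : ℝ) (z : Cn n) : ENNReal := ((M : EReal) - φ z).toENNReal

lemma measurable_gap (hφm : Measurable φ) (M : ℝ) : Measurable (gap φ M) := by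
  unfold gap
  exact (measurable_const.sub hφm).ereal_toENNReal

lemma gap_of_eq_bot {M : ℝ} {z : Cn n} (h : φ z = ⊥) : gap φ M z = ⊤ := by
  simp [gap, h]

lemma gap_of_ne_bot {M : ℝ} {z : Cn n} (h : φ z ≠ ⊥) (hM : φ z ≤ M) :
    gap φ M z = ENNReal.ofReal (M - (φ z).toReal) := by
  have ht : φ z ≠ ⊤ := fun h' => by simp [h'] at hM
  rw [gap]
  conv_lhs => rw [← EReal.coe_toReal ht h]
  rw [← EReal.coe_sub, EReal.toENNReal_of_ne_top (EReal.coe_ne_top _), EReal.toReal_coe]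

lemma toReal_le_of_le {M : ℝ} {z : Cn n} (h : φ z ≠ ⊥) (hM : φ z ≤ M) : (φ z).toReal ≤ M := by
  have ht : φ z ≠ ⊤ := fun h' => by simp [h'] at hM
  rwa [← EReal.coe_le_coe_iff, EReal.coe_toReal ht h]

/-- The identity `M - φ = M + φ⁻ - φ⁺`, written without subtraction so that it makes sense in `[0,
∞]`, including at points where `φ = -∞`. -/
lemma gap_add_pos {M : ℝ} (hM0 : 0 ≤ M) {z : Cn n} (hM : φ z ≤ M) :
    gap φ M z + (φ z).toENNReal = ENNReal.ofReal M + (-φ z).toENNReal := by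
  by_cases h : φ z = ⊥
  · simp [gap_of_eq_bot h, h]
  have ht : φ z ≠ ⊤ := fun h' => by simp [h'] at hM
  have hle := toReal_le_of_le h hM
  rw [gap_of_ne_bot h hM]
  obtain ⟨c, hc⟩ : ∃ c : ℝ, φ z = c := ⟨_, (EReal.coe_toReal ht h).symm⟩
  rw [hc] at hle ⊢
  rw [EReal.toReal_coe] at *
  rw [← EReal.coe_neg, EReal.toENNReal_of_ne_top (EReal.coe_ne_top _),
    EReal.toENNReal_of_ne_top (EReal.coe_ne_top _), EReal.toReal_coe, EReal.toReal_coe]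
  rcases le_total 0 c with h0 | h0
  · rw [← ENNReal.ofReal_add (by linarith) h0, ENNReal.ofReal_of_nonpos (p := -c) (by linarith)]
    simp
  · rw [← ENNReal.ofReal_add hM0 (by linarith), ENNReal.ofReal_of_nonpos h0]
    simp [sub_eq_add_neg]

/-- The sub-mean value inequality for `M - φ`. -/
lemma IsSubharmonic.lintegral_sphere_gap_le (hn : 0 < n) (hφ : IsSubharmonic Ω φ)
    (hφm : Measurable φ) {M : ℝ} (hM0 : 0 ≤ M) {z : Cn n} {r : ℝ} (hr : 0 < r)
    (hz : closedBall z r ⊆ Ω) (hM : ∀ w ∈ closedBall z r, φ w ≤ M) :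
    ∫⁻ ξ : sphere (0 : Cn n) 1, gap φ M (z + r • (ξ : Cn n)) ∂(unitSphereMeasure n)
      ≤ unitSphereMeasure n Set.univ * gap φ M z := by
  have h0 := unitSphereMeasure_univ_ne_zero hn
  have htop : unitSphereMeasure n Set.univ ≠ ⊤ := measure_ne_top _ _
  by_cases hbot : φ z = ⊥
  · rw [gap_of_eq_bot hbot, ENNReal.mul_top h0]
    exact le_top
  have hMz : φ z ≤ M := hM z (mem_closedBall_self hr.le)
  have ht : φ z ≠ ⊤ := fun h' => by simp [h'] at hMz
  set μ := (unitSphereMeasure n Set.univ)⁻¹ • unitSphereMeasure n with hμ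
  have hprob : μ Set.univ = 1 := by
    simp [hμ, ENNReal.inv_mul_cancel h0 htop]
  have hmem : ∀ ξ : sphere (0 : Cn n) 1, φ (z + r • (ξ : Cn n)) ≤ M := fun ξ =>
    hM _ ((mem_closedBall_polar z hr ξ).2 le_rfl)
  have hmeas : Measurable fun ξ : sphere (0 : Cn n) 1 => φ (z + r • (ξ : Cn n)) :=
    hφm.comp (by fun_prop)
  have hsub : φ z ≤ ((∫⁻ ξ : sphere (0 : Cn n) 1, (φ (z + r • (ξ : Cn n))).toENNReal ∂μ : ENNReal)
      : EReal) - ((∫⁻ ξ : sphere (0 : Cn n) 1, (-φ (z + r • (ξ : Cn n))).toENNReal ∂μ : ENNReal)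
      : EReal) := hφ.submean z r hr hz
  set P := ∫⁻ ξ : sphere (0 : Cn n) 1, (φ (z + r • (ξ : Cn n))).toENNReal ∂μ
  set Q := ∫⁻ ξ : sphere (0 : Cn n) 1, (-φ (z + r • (ξ : Cn n))).toENNReal ∂μ
  set D := ∫⁻ ξ : sphere (0 : Cn n) 1, gap φ M (z + r • (ξ : Cn n)) ∂μ with hD
  have hsum : D + P = ENNReal.ofReal M + Q := by
    rw [← lintegral_add_right _ hmeas.ereal_toENNReal]
    simp only [gap_add_pos hM0 (hmem _)]
    rw [lintegral_add_left measurable_const, lintegral_const, hprob, mul_one]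
  have hP : P ≠ ⊤ := by
    refine ne_top_of_le_ne_top (ENNReal.ofReal_ne_top (r := M)) ?_
    calc P ≤ ∫⁻ _ : sphere (0 : Cn n) 1, ENNReal.ofReal M ∂μ := by
          refine lintegral_mono fun ξ => ?_
          rw [show ENNReal.ofReal M = (M : EReal).toENNReal by
            rw [EReal.toENNReal_of_ne_top (EReal.coe_ne_top M), EReal.toReal_coe]]
          exact EReal.toENNReal_le_toENNReal (hmem ξ)
      _ = _ := by rw [lintegral_const, hprob, mul_one]
  -- An infinite negative part would make the mean `-∞`, which is less than `φ z`.
  have hQ : Q ≠ ⊤ := by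
    intro hQ
    rw [hQ] at hsub
    simp only [EReal.coe_ennreal_top, EReal.sub_top] at hsub
    exact hbot (le_bot_iff.1 hsub)
  have hDt : D ≠ ⊤ := by
    intro h
    rw [h, top_add] at hsum
    exact (ENNReal.add_ne_top.2 ⟨ENNReal.ofReal_ne_top, hQ⟩) hsum.symm
  have hle : D ≤ gap φ M z := by
    rw [gap_of_ne_bot hbot hMz, ← ENNReal.ofReal_toReal hDt]
    refine ENNReal.ofReal_le_ofReal ?_
    have e1 : D.toReal + P.toReal = M + Q.toReal := by
      rw [← ENNReal.toReal_add hDt hP, hsum, ENNReal.toReal_add ENNReal.ofReal_ne_top hQ,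
        ENNReal.toReal_ofReal hM0]
    have e2 : (φ z).toReal ≤ P.toReal - Q.toReal := by
      rw [← EReal.coe_le_coe_iff, EReal.coe_toReal ht hbot, EReal.coe_sub]
      rwa [EReal.coe_ennreal_toReal hP, EReal.coe_ennreal_toReal hQ]
    linarith
  have hDe : D = (unitSphereMeasure n Set.univ)⁻¹ *
      ∫⁻ ξ : sphere (0 : Cn n) 1, gap φ M (z + r • (ξ : Cn n)) ∂(unitSphereMeasure n) := by
    rw [hD, hμ, lintegral_smul_measure, smul_eq_mul]
  rw [hDe] at hle
  calc _ = unitSphereMeasure n Set.univ * ((unitSphereMeasure n Set.univ)⁻¹ *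
      ∫⁻ ξ : sphere (0 : Cn n) 1, gap φ M (z + r • (ξ : Cn n)) ∂(unitSphereMeasure n)) := by
        rw [← mul_assoc, ENNReal.mul_inv_cancel h0 htop, one_mul]
    _ ≤ _ := by gcongr

/-- The inequality for spheres, integrated over the radius in polar coordinates. -/
lemma IsSubharmonic.lintegral_ball_gap_le (hn : 0 < n) (hφ : IsSubharmonic Ω φ)
    (hφm : Measurable φ) {M : ℝ} (hM0 : 0 ≤ M) {z : Cn n} {r : ℝ}
    (hz : closedBall z r ⊆ Ω) (hM : ∀ w ∈ closedBall z r, φ w ≤ M) :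
    ∫⁻ w in ball z r, gap φ M w ≤ volume (ball z r) * gap φ M z := by
  have h1 : volume (ball z r) = ∫⁻ s in Set.Ioo 0 r, ENNReal.ofReal (s ^ (2 * n - 1)) *
      unitSphereMeasure n Set.univ := by
    have := lintegral_ball_polar hn z (measurable_const (a := (1 : ENNReal))) r
    simpa using this
  rw [lintegral_ball_polar hn z (measurable_gap hφm M), h1,
    ← lintegral_mul_const _ (by fun_prop)]
  refine setLIntegral_mono' measurableSet_Ioo fun s hs => ?_
  rw [mul_assoc]
  gcongr
  have hsub : closedBall z s ⊆ closedBall z r := closedBall_subset_closedBall hs.2.le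
  exact hφ.lintegral_sphere_gap_le hn hφm hM0 hs.1 (hsub.trans hz) fun w hw => hM w (hsub hw)

lemma IsSubharmonic.exists_bound (hφ : IsSubharmonic Ω φ) {K : Set (Cn n)} (hK : IsCompact K)
    (hKΩ : K ⊆ Ω) : ∃ M : ℝ, 0 ≤ M ∧ ∀ z ∈ K, φ z ≤ M := by
  rcases K.eq_empty_or_nonempty with rfl | hne
  · exact ⟨0, le_rfl, by simp⟩
  obtain ⟨x, hx, hmax⟩ := (hφ.usc.mono hKΩ).exists_isMaxOn hne hK
  refine ⟨max 0 (φ x).toReal, le_max_left _ _, fun z hz => (hmax hz).trans ?_⟩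
  exact (EReal.le_coe_toReal (hφ.ne_top x (hKΩ hx))).trans
    (EReal.coe_le_coe_iff.2 (le_max_right _ _))

/-- `M - φ` is integrable near `z` for some upper bound `M` of `φ` near `z`. -/
def IntegrableNear (Ω : Set (Cn n)) (φ : Cn n → EReal) (z : Cn n) : Prop :=
  ∃ r > 0, ∃ M : ℝ, closedBall z r ⊆ Ω ∧ (∀ w ∈ closedBall z r, φ w ≤ M) ∧
    ∫⁻ w in ball z r, gap φ M w < ⊤

lemma IntegrableNear.mono {z w : Cn n} {r s M : ℝ} (hs : 0 < s) (hΩ : closedBall z r ⊆ Ω)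
    (hM : ∀ w ∈ closedBall z r, φ w ≤ M) (hint : ∫⁻ w in ball z r, gap φ M w < ⊤)
    (hsub : dist w z + s < r) : IntegrableNear Ω φ w := by
  have h1 : closedBall w s ⊆ closedBall z r := closedBall_subset_closedBall' (by linarith)
  have h2 : ball w s ⊆ ball z r := ball_subset_ball' (by linarith)
  exact ⟨s, hs, M, h1.trans hΩ, fun v hv => hM v (h1 hv),
    (lintegral_mono_set h2).trans_lt hint⟩

/-- The points of `Ω` where integrability holds and those where it fails both form open sets.
Indeed, one point `w` near `z` with `φ w > -∞` makes `M - φ` integrable on a ball around `w` that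
contains `z`; so near a point of failure `φ` is identically `-∞`. A connected component cannot meet
both sets, and on each component `φ` is finite somewhere. -/
theorem IsSubharmonic.integrableNear (hn : 0 < n) (hΩ : IsOpen Ω) (hφ : IsSubharmonic Ω φ)
    (hφm : Measurable φ) {a : Cn n} (ha : a ∈ Ω) : IntegrableNear Ω φ a := by
  have hball : ∀ z ∈ Ω, ∃ R > 0, closedBall z (3 * R) ⊆ Ω := by
    intro z hz
    obtain ⟨ε, hε, hb⟩ := Metric.isOpen_iff.1 hΩ z hz
    exact ⟨ε / 4, by positivity, (closedBall_subset_ball (by linarith)).trans hb⟩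
  set A := {z | IntegrableNear Ω φ z} with hA
  set B := {z ∈ Ω | ¬ IntegrableNear Ω φ z} with hB
  have hAo : IsOpen A := by
    rw [Metric.isOpen_iff]
    rintro z ⟨r, hr, M, h1, h2, h3⟩
    refine ⟨r / 2, by positivity, fun w hw => ?_⟩
    exact IntegrableNear.mono (s := r / 4) (by positivity) h1 h2 h3
      (by rw [mem_ball] at hw; linarith)
  -- near a point of `B` the function is identically `-∞`
  have hbotB : ∀ z R, 0 < R → closedBall z (3 * R) ⊆ Ω → ¬ IntegrableNear Ω φ z →
      ∀ w ∈ ball z R, φ w = ⊥ := by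
    intro z R hR hz hnot w hw
    by_contra hw'
    rw [mem_ball] at hw
    have h1 : closedBall w (2 * R) ⊆ Ω :=
      (closedBall_subset_closedBall' (by linarith)).trans hz
    obtain ⟨M, hM0, hM⟩ := hφ.exists_bound (isCompact_closedBall w (2 * R)) h1
    have h2 := hφ.lintegral_ball_gap_le hn hφm hM0 h1 hM
    have h3 : ∫⁻ v in ball w (2 * R), gap φ M v < ⊤ := by
      refine h2.trans_lt (ENNReal.mul_lt_top measure_ball_lt_top ?_)
      rw [gap_of_ne_bot hw' (hM w (mem_closedBall_self (by linarith)))]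
      exact ENNReal.ofReal_lt_top
    exact hnot (IntegrableNear.mono (s := R / 2) (by positivity) h1 hM h3
      (by rw [dist_comm]; linarith))
  have hBo : IsOpen B := by
    rw [Metric.isOpen_iff]
    rintro z ⟨hz, hnot⟩
    obtain ⟨R, hR, hzR⟩ := hball z hz
    refine ⟨R, hR, fun w hw => ⟨hzR (ball_subset_closedBall
      (ball_subset_ball (by linarith) hw)), ?_⟩⟩
    rintro ⟨r, hr, M, -, -, h3⟩
    have hbot := hbotB z R hR hzR hnot
    have hpos : 0 < volume (ball w r ∩ ball z R) :=
      (isOpen_ball.inter isOpen_ball).measure_pos _ ⟨w, mem_ball_self hr, hw⟩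
    refine absurd h3 (not_lt.2 ?_)
    calc (⊤ : ENNReal) = ∫⁻ _ in ball w r ∩ ball z R, ⊤ := by
          rw [lintegral_const, Measure.restrict_apply_univ, ENNReal.top_mul hpos.ne']
      _ = ∫⁻ v in ball w r ∩ ball z R, gap φ M v :=
          setLIntegral_congr_fun (measurableSet_ball.inter measurableSet_ball)
            fun v hv => (gap_of_eq_bot (hbot v hv.2)).symm
      _ ≤ _ := lintegral_mono_set Set.inter_subset_left
  obtain ⟨x, hx, hxbot⟩ := hφ.not_bot a ha
  have hxΩ : x ∈ Ω := connectedComponentIn_subset _ _ hx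
  have hxA : x ∈ A := by
    by_contra h
    obtain ⟨R, hR, hxR⟩ := hball x hxΩ
    exact hxbot (hbotB x R hR hxR h x (mem_ball_self hR))
  by_contra hnot
  have haB : a ∈ B := ⟨ha, hnot⟩
  obtain ⟨y, -, hyA, hyB⟩ := (isPreconnected_connectedComponentIn (F := Ω) (x := a)) A B hAo hBo
    (fun z hz => by
      by_cases h : IntegrableNear Ω φ z
      · exact Or.inl h
      · exact Or.inr ⟨connectedComponentIn_subset _ _ hz, h⟩)
    ⟨x, hx, hxA⟩ ⟨a, mem_connectedComponentIn ha, haB⟩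
  exact hyB.2 hyA

lemma ae_ne_bot_of_lintegral_gap {s : Set (Cn n)} (hφm : Measurable φ) {M : ℝ}
    (h : ∫⁻ w in s, gap φ M w < ⊤) : ∀ᵐ w ∂(volume.restrict s), φ w ≠ ⊥ := by
  filter_upwards [ae_lt_top (measurable_gap hφm M) h.ne] with w hw hbot
  simp [gap_of_eq_bot hbot] at hw

lemma integrableOn_toReal_of_lintegral_gap {s : Set (Cn n)} (hs : MeasurableSet s)
    (hs' : volume s < ⊤)
    (hφm : Measurable φ) {M : ℝ} (hM : ∀ w ∈ s, φ w ≤ M)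
    (h : ∫⁻ w in s, gap φ M w < ⊤) : IntegrableOn (fun z => (φ z).toReal) s := by
  have h1 : Integrable (fun w => M - (gap φ M w).toReal) (volume.restrict s) := by
    have : IsFiniteMeasure (volume.restrict s) := ⟨by simpa using hs'⟩
    exact (integrable_const M).sub
      (integrable_toReal_of_lintegral_ne_top (measurable_gap hφm M).aemeasurable h.ne)
  refine h1.congr ?_
  filter_upwards [ae_ne_bot_of_lintegral_gap hφm h, ae_restrict_mem hs] with w hw hws
  rw [gap_of_ne_bot hw (hM w hws), ENNReal.toReal_ofReal
    (sub_nonneg.2 (toReal_le_of_le hw (hM w hws)))]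
  ring

theorem IsSubharmonic.locallyIntegrableOn (hn : 0 < n) (hΩ : IsOpen Ω) (hφ : IsSubharmonic Ω φ)
    (hφm : Measurable φ) : LocallyIntegrableOn (fun z => (φ z).toReal) Ω := by
  intro z hz
  obtain ⟨r, hr, M, -, h2, h3⟩ := hφ.integrableNear hn hΩ hφm hz
  exact ⟨ball z r, mem_nhdsWithin_of_mem_nhds (ball_mem_nhds z hr),
    integrableOn_toReal_of_lintegral_gap measurableSet_ball measure_ball_lt_top hφm
      (fun w hw => h2 w (ball_subset_closedBall hw)) h3⟩

theorem IsSubharmonic.ae_ne_bot (hn : 0 < n) (hΩ : IsOpen Ω) (hφ : IsSubharmonic Ω φ)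
    (hφm : Measurable φ) : ∀ᵐ z, z ∈ Ω → φ z ≠ ⊥ := by
  have : volume {z | z ∈ Ω ∧ φ z = ⊥} = 0 := by
    refine measure_null_of_locally_null _ fun z hz => ?_
    obtain ⟨r, hr, M, -, -, h3⟩ := hφ.integrableNear hn hΩ hφm hz.1
    refine ⟨{z | z ∈ Ω ∧ φ z = ⊥} ∩ ball z r, inter_mem_nhdsWithin _ (ball_mem_nhds z hr), ?_⟩
    have h4 := ae_ne_bot_of_lintegral_gap hφm h3
    rw [ae_restrict_iff' measurableSet_ball, ae_iff] at h4
    refine measure_mono_null (fun w hw => ?_) h4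
    simp only [Set.mem_ofPred_eq, ne_eq, Classical.not_imp, not_not]
    exact ⟨hw.2, hw.1.2⟩
  rw [ae_iff]
  simpa using this

end Subharmonic

/-! ### The trace measure -/

section Trace

open scoped CompactlySupported Manifold

variable {n : ℕ} {Ω : Set (Cn n)} {φ : Cn n → EReal}

lemma exists_contDiff_eq_one {E : Type*} [NormedAddCommGroup E] [NormedSpace ℝ E]
    [FiniteDimensional ℝ E] {V K : Set E} (hV : IsOpen V) (hK : IsCompact K) (hKV : K ⊆ V) :
    ∃ κ : E → ℝ, ContDiff ℝ ∞ κ ∧ HasCompactSupport κ ∧ tsupport κ ⊆ V ∧ (∀ z, 0 ≤ κ z) ∧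
      (∀ z, κ z ≤ 1) ∧ ∀ z ∈ K, κ z = 1 := by
  have : ProperSpace E := FiniteDimensional.proper ℝ E
  obtain ⟨L, hL, hKL, hLV⟩ := exists_compact_between hK hV hKV
  obtain ⟨f, h0, h1, h01⟩ := exists_contMDiffMap_zero_one_of_isClosed (n := (⊤ : ℕ∞)) 𝓘(ℝ, E)
    (s := (interior L)ᶜ) (t := K) isOpen_interior.isClosed_compl hK.isClosed
    (Set.disjoint_left.2 fun x hx hxK => hx (hKL hxK))
  have hs : tsupport f ⊆ L := by
    refine closure_minimal (fun z hz => ?_) hL.isClosed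
    by_contra hzL
    exact hz (h0 fun h => hzL (interior_subset h))
  exact ⟨f, f.contMDiff.contDiff, hL.of_isClosed_subset (isClosed_tsupport _) hs, hs.trans hLV,
    fun z => (h01 z).1, fun z => (h01 z).2, fun z hz => h1 hz⟩

lemma exists_isTest_eq_one {V K : Set (Cn n)} (hV : IsOpen V) (hK : IsCompact K) (hKV : K ⊆ V) :
    ∃ κ : Cn n → ℝ, IsTest V κ ∧ (∀ z, 0 ≤ κ z) ∧ (∀ z, κ z ≤ 1) ∧ ∀ z ∈ K, κ z = 1 := by
  obtain ⟨κ, h1, h2, h3, h4⟩ := exists_contDiff_eq_one hV hK hKV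
  exact ⟨κ, ⟨h1, h2, h3⟩, h4⟩

lemma laplaceDensity_add {χ χ' : Cn n → ℝ} (hχ : ContDiff ℝ ∞ χ) (hχ' : ContDiff ℝ ∞ χ')
    (z : Cn n) :
    laplaceDensity (fun w => χ w + χ' w) z = laplaceDensity χ z + laplaceDensity χ' z := by
  simp only [laplaceDensity, Complex.ofReal_add, dz_dzbar_add (contDiff_ofReal hχ)
    (contDiff_ofReal hχ'), Finset.sum_add_distrib, Complex.add_re]
  ring

lemma laplaceDensity_const_mul {χ : Cn n → ℝ} (hχ : ContDiff ℝ ∞ χ) (c : ℝ) (z : Cn n) :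
    laplaceDensity (fun w => c * χ w) z = c * laplaceDensity χ z := by
  simp only [laplaceDensity, Complex.ofReal_mul, dz_dzbar_const_mul (contDiff_ofReal hχ),
    ← Finset.mul_sum, Complex.re_ofReal_mul]
  ring

lemma continuous_laplaceDensity {χ : Cn n → ℝ} (hχ : ContDiff ℝ ∞ χ) :
    Continuous (laplaceDensity χ) := by
  refine continuous_const.mul (Complex.continuous_re.comp (continuous_finsetSum _ fun j _ => ?_))
  exact (contDiff_dz (contDiff_dzbar (contDiff_ofReal hχ) j) j).continuous

lemma laplaceDensity_eq_zero {χ : Cn n → ℝ} {z : Cn n} (hz : z ∉ tsupport χ) :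
    laplaceDensity χ z = 0 := by
  have h1 : tsupport (fun w => (χ w : ℂ)) ⊆ tsupport χ :=
    closure_mono fun w hw h => hw (by simp [h])
  rw [laplaceDensity, Finset.sum_eq_zero, Complex.zero_re, mul_zero]
  intro j _
  exact dz_eq_zero (fun h => hz (h1 (tsupport_dzbar_subset _ _ h))) j

lemma integrableOn_mul_of_tsupport {f g : Cn n → ℝ} (hf : LocallyIntegrableOn f Ω)
    {K : Set (Cn n)} (hK : IsCompact K) (hKΩ : K ⊆ Ω) (hg : Continuous g)
    (hgK : ∀ z ∉ K, g z = 0) : Integrable (fun z => f z * g z) := by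
  refine (integrableOn_iff_integrable_of_support_subset ?_).1
    ((hf.integrableOn_compact_subset hKΩ hK).mul_continuousOn hg.continuousOn hK)
  intro z hz
  by_contra h
  exact hz (by simp [hgK z h])

lemma IsTest.integrable_mul_laplaceDensity {f χ : Cn n → ℝ} (hf : LocallyIntegrableOn f Ω)
    (hχ : IsTest Ω χ) : Integrable (fun z => f z * laplaceDensity χ z) :=
  integrableOn_mul_of_tsupport hf hχ.2.1 hχ.2.2 (continuous_laplaceDensity hχ.1)
    fun _ => laplaceDensity_eq_zero

lemma ddcPairing_one {m : ℕ} (hm : 1 ≤ m) (hmn : m < n) {χ : Cn n → ℝ} (hχ : IsTest Ω χ) :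
    ddcPairing m Ω φ χ (fun _ _ => 1) = ∫ z in Ω, (φ z).toReal * laplaceDensity χ z := by
  simp only [ddcPairing, ddcDensity_one hm hmn hχ.1]

/-- The choice `α_k = β` is `m`-positive, so `dd^c φ ∧ β^{n-1}` is a positive distribution. -/
lemma IsMPositiveDdc.integral_laplaceDensity_nonneg {m : ℕ} (hm : 1 ≤ m) (hmn : m < n)
    (hφ : IsMPositiveDdc m Ω φ) {χ : Cn n → ℝ} (hχ : IsTest Ω χ) (h0 : ∀ z, 0 ≤ χ z) :
    0 ≤ ∫ z in Ω, (φ z).toReal * laplaceDensity χ z := by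
  rw [← ddcPairing_one hm hmn hχ]
  refine hφ χ (fun _ _ => 1) hχ h0 fun k _ _ => ⟨fun i j => contDiffOn_const, fun z _ => ?_⟩
  have := isMPositive_one_sub hm hmn (0 : Fin n → ℂ) 0 (s := 0) (by simp) (by positivity)
    (by simp)
  simpa using this

/-- Extension by zero of a compactly supported function on `Ω`. -/
def extendZero (F : C_c(Ω, ℝ)) : Cn n → ℝ := Function.extend Subtype.val F 0

lemma extendZero_coe (F : C_c(Ω, ℝ)) (z : Ω) : extendZero F z = F z :=
  Subtype.val_injective.extend_apply _ _ _

lemma extendZero_of_notMem (F : C_c(Ω, ℝ)) {z : Cn n} (hz : z ∉ Ω) : extendZero F z = 0 :=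
  Function.extend_apply' _ _ _ fun ⟨w, hw⟩ => hz (hw ▸ w.2)

lemma extendZero_add (F G : C_c(Ω, ℝ)) :
    extendZero (F + G) = fun z => extendZero F z + extendZero G z := by
  funext z
  by_cases hz : z ∈ Ω
  · lift z to Ω using hz
    simp [extendZero_coe]
  · simp [extendZero_of_notMem _ hz]

lemma extendZero_smul (c : ℝ) (F : C_c(Ω, ℝ)) :
    extendZero (c • F) = fun z => c * extendZero F z := by
  funext z
  by_cases hz : z ∈ Ω
  · lift z to Ω using hz
    simp [extendZero_coe]
  · simp [extendZero_of_notMem _ hz]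

lemma extendZero_zero : extendZero (0 : C_c(Ω, ℝ)) = fun _ => 0 := by
  funext z
  by_cases hz : z ∈ Ω
  · lift z to Ω using hz
    simp [extendZero_coe]
  · simp [extendZero_of_notMem _ hz]

lemma isTest_zero : IsTest Ω (fun _ => 0) :=
  ⟨contDiff_const, HasCompactSupport.zero, by simp [tsupport]⟩

lemma IsTest.add {χ χ' : Cn n → ℝ} (h : IsTest Ω χ) (h' : IsTest Ω χ') :
    IsTest Ω (fun z => χ z + χ' z) :=
  ⟨h.1.add h'.1, h.2.1.add h'.2.1, (tsupport_add χ χ').trans (Set.union_subset h.2.2 h'.2.2)⟩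

lemma IsTest.const_mul {χ : Cn n → ℝ} (h : IsTest Ω χ) (c : ℝ) : IsTest Ω (fun z => c * χ z) :=
  ⟨contDiff_const.mul h.1, h.2.1.mul_left,
    (closure_mono fun _ hz => right_ne_zero_of_mul hz).trans h.2.2⟩

lemma isCompact_preimage_coe {K : Set (Cn n)} (hK : IsCompact K) (hKΩ : K ⊆ Ω) :
    IsCompact ((↑) ⁻¹' K : Set Ω) :=
  (Topology.IsInducing.subtypeVal.isCompact_preimage_iff (by simpa using hKΩ)).2 hK

/-- Restriction of a test function to `Ω`. -/
def restrictTest (χ : Cn n → ℝ) (hχ : IsTest Ω χ) : C_c(Ω, ℝ) where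
  toFun z := χ z
  continuous_toFun := hχ.1.continuous.comp continuous_subtype_val
  hasCompactSupport' := HasCompactSupport.intro (isCompact_preimage_coe hχ.2.1 hχ.2.2)
    fun _ hz => image_eq_zero_of_notMem_tsupport hz

lemma extendZero_restrictTest {χ : Cn n → ℝ} (hχ : IsTest Ω χ) :
    extendZero (restrictTest χ hχ) = χ := by
  funext z
  by_cases hz : z ∈ Ω
  · lift z to Ω using hz
    exact extendZero_coe _ _
  · rw [extendZero_of_notMem _ hz, image_eq_zero_of_notMem_tsupport fun h => hz (hχ.2.2 h)]

/-- The functional `χ ↦ ∫ f dd^c χ ∧ β^{n-1}` on the test functions in `Ω`. -/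
def laplaceFunctional {f : Cn n → ℝ} (hf : LocallyIntegrableOn f Ω) : C_c(Ω, ℝ) →ₗ.[ℝ] ℝ where
  domain :=
    { carrier := {F | IsTest Ω (extendZero F)}
      add_mem' := fun {F G} hF hG => by
        simp only [Set.mem_ofPred_eq] at hF hG ⊢
        rw [extendZero_add]; exact hF.add hG
      zero_mem' := by simp only [Set.mem_ofPred_eq]; rw [extendZero_zero]; exact isTest_zero
      smul_mem' := fun c F hF => by
        simp only [Set.mem_ofPred_eq] at hF ⊢
        rw [extendZero_smul]; exact hF.const_mul c }
  toFun :=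
    { toFun := fun F => ∫ z in Ω, f z * laplaceDensity (extendZero (F : C_c(Ω, ℝ))) z
      map_add' := fun F G => by
        have hF : IsTest Ω (extendZero (F : C_c(Ω, ℝ))) := F.2
        have hG : IsTest Ω (extendZero (G : C_c(Ω, ℝ))) := G.2
        rw [← integral_add (hF.integrable_mul_laplaceDensity hf).integrableOn
          (hG.integrable_mul_laplaceDensity hf).integrableOn]
        refine integral_congr_ae (Eventually.of_forall fun z => ?_)
        simp only [Submodule.coe_add, extendZero_add, laplaceDensity_add hF.1 hG.1]
        ring
      map_smul' := fun c F => by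
        have hF : IsTest Ω (extendZero (F : C_c(Ω, ℝ))) := F.2
        rw [RingHom.id_apply, smul_eq_mul, ← integral_const_mul]
        refine integral_congr_ae (Eventually.of_forall fun z => ?_)
        simp only [Submodule.coe_smul, extendZero_smul, laplaceDensity_const_mul hF.1]
        ring }

/-! ### Existence and uniqueness of the trace measure -/

/-- The functional is positive on the subspace of test functions. The M. Riesz extension theorem
extends it to a positive functional on all of `C_c(Ω)`, and the Riesz–Markov–Kakutani theorem
represents the extension by a measure; no approximation of continuous functions by smooth ones is
needed. -/
theorem exists_isTraceMeasure (hn : 1 < n) (hΩ : IsOpen Ω)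
    (hf : LocallyIntegrableOn (fun z => (φ z).toReal) Ω)
    (hpos : ∀ χ, IsTest Ω χ → (∀ z, 0 ≤ χ z) →
      0 ≤ ∫ z in Ω, (φ z).toReal * laplaceDensity χ z) :
    ∃ μ, IsTraceMeasure Ω φ μ := by
  let s : PointedCone ℝ C_c(Ω, ℝ) :=
    { carrier := {F | ∀ z, 0 ≤ F z}
      add_mem' := fun hF hG z => add_nonneg (hF z) (hG z)
      zero_mem' := fun z => le_rfl
      smul_mem' := fun c F hF z => mul_nonneg c.2 (hF z) }
  obtain ⟨g, hg, hg0⟩ := riesz_extension s (laplaceFunctional hf) (by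
    rintro ⟨F, hF⟩ hF0
    refine hpos _ hF fun z => ?_
    by_cases hz : z ∈ Ω
    · lift z to Ω using hz
      rw [extendZero_coe]; exact hF0 z
    · rw [extendZero_of_notMem _ hz]) (by
    intro F
    have hK : IsCompact ((↑) '' tsupport F : Set (Cn n)) :=
      F.hasCompactSupport.isCompact.image continuous_subtype_val
    have hKΩ : ((↑) '' tsupport F : Set (Cn n)) ⊆ Ω := by
      rintro _ ⟨z, -, rfl⟩; exact z.2
    -- Cofinality for the extension theorem: a multiple of a smooth cutoff that is `1` on the
    -- support of `F` dominates `-F`.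
    obtain ⟨κ, hκ, hκ0, -, hκ1⟩ := exists_isTest_eq_one hΩ hK hKΩ
    obtain ⟨C, hC⟩ := F.continuous.bounded_above_of_compact_support F.hasCompactSupport
    have hκ' : IsTest Ω (fun z => |C| * κ z) := hκ.const_mul |C|
    refine ⟨⟨restrictTest _ hκ', ?_⟩, fun z => ?_⟩
    · change IsTest Ω (extendZero (restrictTest _ hκ'))
      rw [extendZero_restrictTest]; exact hκ'
    · change 0 ≤ |C| * κ z + F z
      by_cases hz : z ∈ tsupport F
      · rw [hκ1 _ ⟨z, hz, rfl⟩]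
        have h1 : |F z| ≤ C := hC z
        linarith [neg_abs_le (F z), le_abs_self C]
      · rw [image_eq_zero_of_notMem_tsupport hz]
        have := hκ0 z
        positivity)
  have : LocallyCompactSpace Ω := hΩ.locallyCompactSpace
  let Λ : C_c(Ω, ℝ) →ₚ[ℝ] ℝ := PositiveLinearMap.mk₀ g fun F hF => hg0 F fun z => hF z
  have hmeas : MeasurableEmbedding (Subtype.val : Ω → Cn n) :=
    MeasurableEmbedding.subtype_coe hΩ.measurableSet
  refine ⟨(RealRMK.rieszMeasure Λ).map Subtype.val, ?_, fun K hK hKΩ => ?_, fun χ hχ => ?_⟩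
  · rw [hmeas.map_apply]
    convert! measure_empty (μ := RealRMK.rieszMeasure Λ)
    ext z; simp
  · rw [hmeas.map_apply]
    exact (isCompact_preimage_coe hK hKΩ).measure_lt_top
  · rw [hmeas.integral_map, ddcPairing_one le_rfl hn hχ]
    have h1 := RealRMK.integral_rieszMeasure Λ (restrictTest χ hχ)
    have hdom : restrictTest χ hχ ∈ (laplaceFunctional hf).domain := by
      change IsTest Ω (extendZero (restrictTest _ hχ))
      rw [extendZero_restrictTest]; exact hχ
    have h2 : g (restrictTest χ hχ) =
        ∫ z in Ω, (φ z).toReal * laplaceDensity (extendZero (restrictTest χ hχ)) z :=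
      hg ⟨_, hdom⟩
    rw [extendZero_restrictTest] at h2
    exact h1.trans h2

lemma IsTraceMeasure.integrable {μ : Measure (Cn n)} (hμ : IsTraceMeasure Ω φ μ) {χ : Cn n → ℝ}
    (hχ : Continuous χ) (hc : HasCompactSupport χ) (hs : tsupport χ ⊆ Ω) : Integrable χ μ := by
  refine (integrableOn_iff_integrable_of_support_subset (subset_tsupport χ)).1 ?_
  obtain ⟨C, hC⟩ := hχ.bounded_above_of_compact_support hc
  exact Measure.integrableOn_of_bounded (hμ.finite _ hc hs).ne hχ.aestronglyMeasurable
    (Eventually.of_forall hC)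

/-- A test function squeezed between the indicators of `K` and of a closed thickening has the same
integral for both measures. Letting the thickening shrink to `K` gives the inequality. -/
lemma IsTraceMeasure.measure_le {μ μ' : Measure (Cn n)} (hΩ : IsOpen Ω)
    (hμ : IsTraceMeasure Ω φ μ) (hμ' : IsTraceMeasure Ω φ μ') {K : Set (Cn n)}
    (hK : IsCompact K) (hKΩ : K ⊆ Ω) : μ K ≤ μ' K := by
  obtain ⟨δ, hδ, hδΩ⟩ := hK.exists_cthickening_subset_open hΩ hKΩ
  have hlim := tendsto_measure_cthickening_of_isClosed (μ := μ')
    ⟨δ, hδ, (hμ'.finite _ hK.cthickening hδΩ).ne⟩ hK.isClosed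
  refine ge_of_tendsto (hlim.mono_left (nhdsWithin_le_nhds (s := Set.Ioi 0))) ?_
  filter_upwards [Ioo_mem_nhdsGT hδ] with r hr
  obtain ⟨κ, hκ, hκ0, hκ1, hκK⟩ := exists_isTest_eq_one isOpen_thickening hK
    (self_subset_thickening hr.1 K)
  have hsub : cthickening r K ⊆ Ω := (cthickening_mono hr.2.le K).trans hδΩ
  have hκΩ : IsTest Ω κ :=
    ⟨hκ.1, hκ.2.1, hκ.2.2.trans ((thickening_subset_cthickening r K).trans hsub)⟩
  have e : ∫ z, κ z ∂μ = ∫ z, κ z ∂μ' := by rw [hμ.integral_eq κ hκΩ, hμ'.integral_eq κ hκΩ]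
  have i1 := hμ.integrable hκ.1.continuous hκ.2.1 hκΩ.2.2
  have i2 := hμ'.integrable hκ.1.continuous hκ.2.1 hκΩ.2.2
  calc μ K = ∫⁻ z, K.indicator 1 z ∂μ := (lintegral_indicator_one hK.measurableSet).symm
    _ ≤ ∫⁻ z, ENNReal.ofReal (κ z) ∂μ := by
        refine lintegral_mono fun z => ?_
        by_cases hz : z ∈ K
        · simp [hz, hκK z hz]
        · simp [hz]
    _ = ∫⁻ z, ENNReal.ofReal (κ z) ∂μ' := by
        rw [← ofReal_integral_eq_lintegral_ofReal i1 (Eventually.of_forall hκ0),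
          ← ofReal_integral_eq_lintegral_ofReal i2 (Eventually.of_forall hκ0), e]
    _ ≤ ∫⁻ z, (cthickening r K).indicator 1 z ∂μ' := by
        refine lintegral_mono fun z => ?_
        by_cases hz : z ∈ cthickening r K
        · simpa [hz] using hκ1 z
        · have : κ z = 0 := image_eq_zero_of_notMem_tsupport fun h =>
            hz (thickening_subset_cthickening r K (hκ.2.2 h))
          simp [this]
    _ = μ' (cthickening r K) := lintegral_indicator_one isClosed_cthickening.measurableSet

/-- `measure_le` in both directions settles compact sets. On each member of a countable compact
exhaustion the closed sets then form a generating `π`-system on which the finite restrictions agree.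
-/
theorem IsTraceMeasure.unique {μ μ' : Measure (Cn n)} (hΩ : IsOpen Ω)
    (hμ : IsTraceMeasure Ω φ μ) (hμ' : IsTraceMeasure Ω φ μ') : μ = μ' := by
  obtain ⟨F, hFc, hFΩ, hFU, -⟩ := hΩ.exists_iUnion_isClosed
  set S : ℕ × ℕ → Set (Cn n) := fun p => F p.1 ∩ closedBall 0 (p.2 : ℝ) with hS
  have hSc : ∀ p, IsCompact (S p) := fun p => (isCompact_closedBall 0 _).inter_left (hFc p.1)
  have hSΩ : ∀ p, S p ⊆ Ω := fun p => Set.inter_subset_left.trans (hFΩ _)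
  have hSU : ⋃ p, S p = Ω := by
    refine Set.Subset.antisymm (Set.iUnion_subset hSΩ) fun z hz => ?_
    rw [← hFU] at hz
    obtain ⟨k, hk⟩ := Set.mem_iUnion.1 hz
    obtain ⟨j, hj⟩ := exists_nat_ge ‖z‖
    exact Set.mem_iUnion.2 ⟨(k, j), hk, by simpa using hj⟩
  have hK : ∀ K, IsCompact K → K ⊆ Ω → μ K = μ' K := fun K hK hKΩ =>
    le_antisymm (hμ.measure_le hΩ hμ' hK hKΩ) (hμ'.measure_le hΩ hμ hK hKΩ)
  have hres : ∀ p, μ.restrict (S p) = μ'.restrict (S p) := by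
    intro p
    have : IsFiniteMeasure (μ.restrict (S p)) :=
      ⟨by simpa using hμ.finite _ (hSc p) (hSΩ p)⟩
    refine ext_of_generate_finite _ (BorelSpace.measurable_eq.trans borel_eq_generateFrom_isClosed)
      isPiSystem_isClosed (fun A hA => ?_) ?_
    · have hA' : IsClosed A := hA
      rw [Measure.restrict_apply hA'.measurableSet, Measure.restrict_apply hA'.measurableSet]
      exact hK _ ((hSc p).inter_left hA') (Set.inter_subset_right.trans (hSΩ p))
    · simpa using hK _ (hSc p) (hSΩ p)
  have h1 := Measure.restrict_iUnion_congr.2 hres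
  rw [hSU] at h1
  rwa [Measure.restrict_eq_self_of_ae_mem (mem_ae_iff.2 hμ.compl_eq_zero),
    Measure.restrict_eq_self_of_ae_mem (mem_ae_iff.2 hμ'.compl_eq_zero)] at h1

lemma traceMeasure_spec (h : ∃ μ, IsTraceMeasure Ω φ μ) :
    IsTraceMeasure Ω φ (traceMeasure Ω φ) := by
  rw [traceMeasure, dif_pos h]
  exact h.choose_spec

end Trace

/-! ### Radial test functions -/

section Radial

variable {n m : ℕ} {Ω : Set (Cn n)} {φ : Cn n → EReal} {a : Cn n}

/-- The squares of the radii `r > 0` for which the closed ball of radius `r` lies in `Ω`. -/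
def radiiSq (Ω : Set (Cn n)) (a : Cn n) : Set ℝ := {t | 0 < t ∧ closedBall a √t ⊆ Ω}

lemma exists_radii_gt (hΩ : IsOpen Ω) {r : ℝ} (hr0 : 0 ≤ r) (hr : closedBall a r ⊆ Ω) :
    ∃ r' > r, r' ∈ radii Ω a := by
  obtain ⟨δ, hδ, h⟩ := (isCompact_closedBall a r).exists_cthickening_subset_open hΩ hr
  rw [cthickening_closedBall hδ.le hr0] at h
  exact ⟨δ + r, by linarith, by positivity, h⟩

lemma sq_mem_radiiSq {r : ℝ} (hr : r ∈ radii Ω a) : r ^ 2 ∈ radiiSq Ω a :=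
  ⟨pow_pos hr.1 2, by rw [Real.sqrt_sq hr.1.le]; exact hr.2⟩

lemma radiiSq_subset_Ioi : radiiSq Ω a ⊆ Set.Ioi 0 := fun _ ht => ht.1

lemma mem_radiiSq_of_le {s t : ℝ} (ht : t ∈ radiiSq Ω a) (hs : 0 < s) (hst : s ≤ t) :
    s ∈ radiiSq Ω a :=
  ⟨hs, (closedBall_subset_closedBall (Real.sqrt_le_sqrt hst)).trans ht.2⟩

lemma ordConnected_radiiSq : (radiiSq Ω a).OrdConnected :=
  ⟨fun _ hs _ ht _ hx => mem_radiiSq_of_le ht (hs.1.trans_le hx.1) hx.2⟩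

lemma exists_radiiSq_gt (hΩ : IsOpen Ω) {t : ℝ} (ht : t ∈ radiiSq Ω a) :
    ∃ T > t, T ∈ radiiSq Ω a := by
  obtain ⟨r, hr, hr'⟩ := exists_radii_gt hΩ (Real.sqrt_nonneg t) ht.2
  exact ⟨r ^ 2, (Real.sqrt_lt' hr'.1).1 hr, sq_mem_radiiSq hr'⟩

lemma isOpen_radiiSq (hΩ : IsOpen Ω) : IsOpen (radiiSq Ω a) := by
  rw [isOpen_iff_mem_nhds]
  intro t ht
  obtain ⟨T, hT, hT'⟩ := exists_radiiSq_gt hΩ ht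
  filter_upwards [Ioo_mem_nhds ht.1 hT] with s hs
  exact mem_radiiSq_of_le hT' hs.1 hs.2.le

lemma nonempty_radii (hΩ : IsOpen Ω) (ha : a ∈ Ω) : (radii Ω a).Nonempty := by
  obtain ⟨r, -, hr⟩ := exists_radii_gt (r := 0) hΩ le_rfl (by simpa using ha)
  exact ⟨r, hr⟩

lemma nonempty_radiiSq (hΩ : IsOpen Ω) (ha : a ∈ Ω) : (radiiSq Ω a).Nonempty := by
  obtain ⟨r, hr⟩ := nonempty_radii hΩ ha
  exact ⟨_, sq_mem_radiiSq hr⟩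

lemma mem_closedBall_sqrt {t : ℝ} (ht : 0 ≤ t) (z : Cn n) :
    z ∈ closedBall a √t ↔ distSq a z ≤ t := by
  rw [mem_closedBall, dist_eq_norm, distSq, Real.le_sqrt (norm_nonneg _) ht]

lemma isTest_comp_distSq {h : ℝ → ℝ} (hh : ContDiff ℝ ∞ h)
    {B : ℝ} (hB : B ∈ radiiSq Ω a) (h0 : ∀ t, B ≤ t → h t = 0) :
    IsTest Ω (fun z => h (distSq a z)) := by
  have hs : tsupport (fun z => h (distSq a z)) ⊆ closedBall a √B := by
    refine closure_minimal (fun z hz => ?_) isClosed_closedBall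
    rw [mem_closedBall_sqrt hB.1.le]
    by_contra hlt
    exact hz (h0 _ (not_le.1 hlt).le)
  exact ⟨hh.comp (contDiff_distSq a),
    (isCompact_closedBall a √B).of_isClosed_subset (isClosed_tsupport _) hs, hs.trans hB.2⟩

lemma eq_zero_of_le {g : ℝ → ℝ} {A B : ℝ} (hs : tsupport g ⊆ Set.Ioo A B)
    {t : ℝ} (ht : B ≤ t) : g t = 0 :=
  image_eq_zero_of_notMem_tsupport fun h => absurd (hs h).2 (not_lt.2 ht)

/-- The mean over the sphere of squared radius `t`. -/
def meanSq (φ : Cn n → EReal) (a : Cn n) (t : ℝ) : ℝ := sphereMean φ a √t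

lemma sphereMean_eq {r : ℝ} (hr : 0 < r) :
    sphereMean φ a r = ((n - 1).factorial : ℝ) / (2 * Real.pi ^ n) *
      ∫ ξ : sphere (0 : Cn n) 1, (φ (a + r • (ξ : Cn n))).toReal ∂(unitSphereMeasure n) := by
  have h1 : r ^ (2 * n - 1) ≠ 0 := by positivity
  have h2 : Real.pi ^ n ≠ 0 := by positivity
  rw [sphereMean]
  field_simp

lemma integral_sphere_eq {r : ℝ} (hr : 0 < r) :
    ∫ ξ : sphere (0 : Cn n) 1, (φ (a + r • (ξ : Cn n))).toReal ∂(unitSphereMeasure n)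
      = 2 * Real.pi ^ n / (n - 1).factorial * meanSq φ a (r ^ 2) := by
  have h2 : Real.pi ^ n ≠ 0 := by positivity
  have h3 : ((n - 1).factorial : ℝ) ≠ 0 := by positivity
  rw [meanSq, Real.sqrt_sq hr.le, sphereMean_eq hr]
  field_simp

lemma pow_two_mul_sub_one (hn : 0 < n) (r : ℝ) : r ^ (2 * n - 1) = r * (r ^ 2) ^ (n - 1) := by
  obtain ⟨k, rfl⟩ := Nat.exists_eq_succ_of_ne_zero hn.ne'
  rw [← pow_mul, ← pow_succ']
  congr 1

lemma integral_Ioi_comp_sq (g : ℝ → ℝ) :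
    ∫ r in Set.Ioi 0, 2 * r * g (r ^ 2) = ∫ t in Set.Ioi 0, g t := by
  rw [← integral_comp_rpow_Ioi_of_pos (g := g) (p := 2) (by norm_num)]
  refine setIntegral_congr_fun measurableSet_Ioi fun r _ => ?_
  simp only [smul_eq_mul, Real.rpow_two]
  norm_num

/-- Pairing of `φ` with a radial function. -/
theorem integral_mul_radial (hn : 0 < n) (hΩ : IsOpen Ω) (ha : a ∈ Ω)
    (hf : LocallyIntegrableOn (fun z => (φ z).toReal) Ω) {F : ℝ → ℝ}
    (hF : IsTestReal (radiiSq Ω a) F) :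
    ((n - 1).factorial : ℝ) / Real.pi ^ n * ∫ z in Ω, (φ z).toReal * F (distSq a z)
      = ∫ t, t ^ (n - 1) * F t * meanSq φ a t := by
  obtain ⟨A, hA, B, hB, hAB, hs⟩ :=
    hF.exists_support_subset (isOpen_radiiSq hΩ) (nonempty_radiiSq hΩ ha)
  have h0 : ∀ z ∉ closedBall a √B, F (distSq a z) = 0 := by
    intro z hz
    rw [mem_closedBall_sqrt hB.1.le, not_le] at hz
    exact eq_zero_of_le hs hz.le
  have hi : Integrable (fun z => (φ z).toReal * F (distSq a z)) :=
    integrableOn_mul_of_tsupport hf (isCompact_closedBall a √B) hB.2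
      (hF.smooth.continuous.comp (contDiff_distSq a).continuous) h0
  rw [setIntegral_eq_integral_of_forall_compl_eq_zero
    (fun z hz => by rw [h0 z fun h => hz (hB.2 h), mul_zero]), integral_polar hn a hi]
  -- For `t = r²` one has `r^{2n-1} dr = t^{n-1} dt / 2`, and the integral over the unit sphere is
  -- `2 π^n / (n-1)!` times the mean.
  have e1 : ∀ r ∈ Set.Ioi (0 : ℝ), r ^ (2 * n - 1) *
      ∫ ξ : sphere (0 : Cn n) 1, (φ (a + r • (ξ : Cn n))).toReal * F (distSq a (a + r • (ξ : Cn n)))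
        ∂(unitSphereMeasure n)
      = Real.pi ^ n / (n - 1).factorial *
        (2 * r * ((fun t => t ^ (n - 1) * F t * meanSq φ a t) (r ^ 2))) := by
    intro r hr
    simp only [distSq_polar, integral_mul_const]
    rw [integral_sphere_eq hr, pow_two_mul_sub_one hn]
    ring
  rw [setIntegral_congr_fun measurableSet_Ioi e1, integral_const_mul,
    integral_Ioi_comp_sq (fun t => t ^ (n - 1) * F t * meanSq φ a t),
    setIntegral_eq_integral_of_forall_compl_eq_zero, ← mul_assoc]
  · have h2 : Real.pi ^ n ≠ 0 := by positivity
    have h3 : ((n - 1).factorial : ℝ) ≠ 0 := by positivity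
    field_simp
  · intro t ht
    rw [hF.eq_zero fun h => ht h.1]
    simp

/-- The mean values are locally integrable as a function of the squared radius. -/
theorem locallyIntegrableOn_meanSq (hn : 0 < n) (hΩ : IsOpen Ω)
    (hf : LocallyIntegrableOn (fun z => (φ z).toReal) Ω) :
    LocallyIntegrableOn (meanSq φ a) (radiiSq Ω a) := by
  have := nontrivial_Cn hn
  intro x hx
  obtain ⟨T, hxT, hT⟩ := exists_radiiSq_gt hΩ hx
  have hi : Integrable ((closedBall a √T).indicator fun z => (φ z).toReal) :=
    (integrable_indicator_iff measurableSet_closedBall).2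
      (hf.integrableOn_compact_subset hT.2 (isCompact_closedBall a √T))
  -- Truncation at `T` gives a function on the whole half line, where the substitution `t = r²`
  -- preserves integrability; the weight `t ^ (n - 1)` is removed afterwards on a compact interval
  -- away from `0`.
  set H : ℝ → ℝ := fun t => t ^ (n - 1) * (if t ≤ T then meanSq φ a t else 0) with hH
  have h1 : IntegrableOn (fun r => (|2| * r ^ ((2 : ℝ) - 1)) • H (r ^ (2 : ℝ))) (Set.Ioi 0) := by
    have h2 := (integrable_polar hn a hi).const_mul (((n - 1).factorial : ℝ) / Real.pi ^ n)
    refine IntegrableOn.congr_fun h2 (fun r hr => ?_) measurableSet_Ioi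
    have hr' : (r : ℝ) ^ (2 : ℝ) = r ^ 2 := Real.rpow_two r
    have hiff : ∀ ξ : sphere (0 : Cn n) 1, a + r • (ξ : Cn n) ∈ closedBall a √T ↔ r ^ 2 ≤ T :=
      fun ξ => by rw [mem_closedBall_sqrt hT.1.le, distSq_polar]
    have h3 : Real.pi ^ n ≠ 0 := by positivity
    have h4 : ((n - 1).factorial : ℝ) ≠ 0 := by positivity
    simp only [Set.indicator, hiff, hH, hr', smul_eq_mul]
    by_cases hrT : r ^ 2 ≤ T
    · simp only [hrT, if_true]
      rw [integral_sphere_eq hr, pow_two_mul_sub_one hn]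
      norm_num
      field_simp
    · simp [hrT]
  rw [integrableOn_Ioi_comp_rpow_iff H two_ne_zero] at h1
  have hsub : Set.Icc (x / 2) T ⊆ Set.Ioi 0 := fun t ht => (half_pos hx.1).trans_le ht.1
  have h2 : IntegrableOn (fun t => (t ^ (n - 1))⁻¹ * H t) (Set.Icc (x / 2) T) := by
    refine IntegrableOn.continuousOn_mul ?_ (h1.mono_set hsub) isCompact_Icc
    exact (continuous_pow _).continuousOn.inv₀ fun t ht => (pow_pos (hsub ht) _).ne'
  refine ⟨Set.Icc (x / 2) T, mem_nhdsWithin_of_mem_nhds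
    (Icc_mem_nhds (by linarith [hx.1]) hxT), ?_⟩
  refine h2.congr_fun (fun t ht => ?_) measurableSet_Icc
  have : t ^ (n - 1) ≠ 0 := (pow_pos (hsub ht) _).ne'
  simp only [hH, ht.2, if_true]
  field_simp

end Radial

/-! ### The mass of balls -/

section Mass

variable {n m : ℕ} {Ω : Set (Cn n)} {φ : Cn n → EReal} {a : Cn n} {μ : Measure (Cn n)}

/-- The mass of the closed ball of squared radius `t`. -/
def massSq (μ : Measure (Cn n)) (a : Cn n) (t : ℝ) : ℝ := μ.real (closedBall a √t)

lemma massSq_nonneg (t : ℝ) : 0 ≤ massSq μ a t := measureReal_nonneg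

lemma IsTraceMeasure.measure_closedBall_lt_top (hμ : IsTraceMeasure Ω φ μ) {r : ℝ}
    (hr : closedBall a r ⊆ Ω) : μ (closedBall a r) < ⊤ :=
  hμ.finite _ (isCompact_closedBall a r) hr

lemma IsTraceMeasure.monotoneOn_massSq (hμ : IsTraceMeasure Ω φ μ) :
    MonotoneOn (massSq μ a) (radiiSq Ω a) := fun _ _ _ ht hst =>
  ENNReal.toReal_mono (hμ.measure_closedBall_lt_top ht.2).ne
    (measure_mono (closedBall_subset_closedBall (Real.sqrt_le_sqrt hst)))

/-- Closed balls of radii decreasing to `√t` shrink to the closed ball of radius `√t`, and their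
measures are eventually finite. This right continuity is the reason for working with closed balls.
-/
lemma IsTraceMeasure.continuousWithinAt_massSq (hμ : IsTraceMeasure Ω φ μ) (hΩ : IsOpen Ω) {t : ℝ}
    (ht : t ∈ radiiSq Ω a) : ContinuousWithinAt (massSq μ a) (Set.Ioi t) t := by
  obtain ⟨R, hR, hR'⟩ := exists_radii_gt hΩ (Real.sqrt_nonneg t) ht.2
  have h1 := tendsto_measure_cthickening_of_isClosed (μ := μ) (s := closedBall a √t)
    ⟨R - √t, by linarith, by
      rw [cthickening_closedBall (by linarith) (Real.sqrt_nonneg t), sub_add_cancel]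
      exact (hμ.measure_closedBall_lt_top hR'.2).ne⟩ isClosed_closedBall
  have h2 : Tendsto (fun s => √s - √t) (𝓝[>] t) (𝓝 0) := by
    have : Tendsto (fun s => √s - √t) (𝓝 t) (𝓝 (√t - √t)) :=
      (Real.continuous_sqrt.tendsto t).sub_const _
    rw [sub_self] at this
    exact this.mono_left nhdsWithin_le_nhds
  have h3 := (ENNReal.tendsto_toReal (hμ.measure_closedBall_lt_top ht.2).ne).comp (h1.comp h2)
  refine Tendsto.congr' ?_ h3
  filter_upwards [self_mem_nhdsWithin] with s hs
  have : √t ≤ √s := Real.sqrt_le_sqrt (le_of_lt hs)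
  simp only [Function.comp, massSq, Measure.real]
  rw [cthickening_closedBall (by linarith) (Real.sqrt_nonneg t), sub_add_cancel]

lemma integral_Ici_eq_sub_primitive {k : ℝ → ℝ} (hk : Integrable k) {A : ℝ}
    (hA : ∀ t ≤ A, k t = 0) (s : ℝ) :
    ∫ t in Set.Ici s, k t = (∫ t, k t) - ∫ t in A..s, k t := by
  rw [integral_Ici_eq_integral_Ioi, ← intervalIntegral.integral_Iic_add_Ioi (b := s)
    hk.integrableOn hk.integrableOn, ← intervalIntegral.integral_Iic_sub_Iic
    hk.integrableOn hk.integrableOn,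
    setIntegral_eq_zero_of_forall_eq_zero (t := Set.Iic A) fun t ht => hA t ht]
  ring

/-- Layer cake formula for radial functions. -/
lemma IsTraceMeasure.integral_integral_Ici (hμ : IsTraceMeasure Ω φ μ) {k : ℝ → ℝ}
    (hk : Integrable k) (hk0 : ∀ t < 0, k t = 0) {B : ℝ} (hB : B ∈ radiiSq Ω a)
    (hkB : ∀ t, B < t → k t = 0) :
    ∫ z, (∫ t in Set.Ici (distSq a z), k t) ∂μ = ∫ t, k t * massSq μ a t := by
  set μB := μ.restrict (closedBall a √B)
  have hfin : IsFiniteMeasure μB :=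
    ⟨by simpa [μB] using hμ.measure_closedBall_lt_top hB.2⟩
  have hmeas : MeasurableSet {p : Cn n × ℝ | distSq a p.1 ≤ p.2} :=
    measurableSet_le ((contDiff_distSq a).continuous.measurable.comp measurable_fst) measurable_snd
  have hint : Integrable (Function.uncurry fun z t => (Set.Ici (distSq a z)).indicator k t)
      (μB.prod volume) := by
    have h1 : Integrable (fun p : Cn n × ℝ => k p.2) (μB.prod volume) := hk.comp_snd μB
    refine (h1.indicator hmeas).congr (Eventually.of_forall fun p => ?_)
    simp [Set.indicator, Function.uncurry]
  calc ∫ z, (∫ t in Set.Ici (distSq a z), k t) ∂μ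
      = ∫ z, (∫ t in Set.Ici (distSq a z), k t) ∂μB := by
        refine (setIntegral_eq_integral_of_forall_compl_eq_zero fun z hz => ?_).symm
        rw [mem_closedBall_sqrt hB.1.le, not_le] at hz
        exact setIntegral_eq_zero_of_forall_eq_zero fun t ht => hkB t (hz.trans_le ht)
    _ = ∫ z, (∫ t, (Set.Ici (distSq a z)).indicator k t) ∂μB := by
        simp only [integral_indicator measurableSet_Ici]
    _ = ∫ t, (∫ z, (Set.Ici (distSq a z)).indicator k t ∂μB) := integral_integral_swap hint
    _ = ∫ t, k t * massSq μ a t := by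
        refine integral_congr_ae (Eventually.of_forall fun t => ?_)
        simp only
        by_cases ht : B < t
        · simp [Set.indicator, hkB t ht]
        -- For `t < 0` the convention `√t = 0` makes the closed ball `{a}`, while no `z` has `distSq
        -- a z ≤ t`; the vanishing of `k` there removes the mismatch.
        by_cases ht0 : t < 0
        · simp [Set.indicator, hk0 t ht0]
        have e1 : ∀ z, (Set.Ici (distSq a z)).indicator k t
            = (closedBall a √t).indicator (fun _ => k t) z := by
          intro z
          by_cases hz : distSq a z ≤ t
          · rw [Set.indicator_of_mem ((mem_closedBall_sqrt (not_lt.1 ht0) z).2 hz),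
              Set.indicator_of_mem (Set.mem_Ici.2 hz)]
          · rw [Set.indicator_of_notMem
                (fun h => hz ((mem_closedBall_sqrt (not_lt.1 ht0) z).1 h)),
              Set.indicator_of_notMem fun h => hz (Set.mem_Ici.1 h)]
        have hsub : closedBall a √t ⊆ closedBall a √B :=
          closedBall_subset_closedBall (Real.sqrt_le_sqrt (not_lt.1 ht))
        simp only [e1]
        rw [integral_indicator measurableSet_closedBall, setIntegral_const, smul_eq_mul, mul_comm,
          massSq, measureReal_restrict_apply measurableSet_closedBall,
          Set.inter_eq_left.2 hsub]

/-- The derivative of the spherical means, in the sense of distributions, is `N(t) / t ^ n`. -/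
theorem IsTraceMeasure.integral_meanSq_mul_deriv (hn : 1 < n) (hΩ : IsOpen Ω) (ha : a ∈ Ω)
    (hf : LocallyIntegrableOn (fun z => (φ z).toReal) Ω) (hμ : IsTraceMeasure Ω φ μ)
    {g : ℝ → ℝ} (hg : IsTestReal (radiiSq Ω a) g) :
    ∫ t, meanSq φ a t * deriv g t = - ∫ t, massSq μ a t / t ^ n * g t := by
  have hU := isOpen_radiiSq (a := a) hΩ
  have hk : IsTestReal (radiiSq Ω a) (fun t => (t ^ n)⁻¹ * g t) :=
    hg.mul_left hU ((contDiff_id.pow n).contDiffOn.inv fun t ht => (pow_pos ht.1 n).ne')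
  -- The radial test function `h` below satisfies `h' = k` and vanishes beyond the support of `k`,
  -- that is `h(s) = -∫_s^∞ k`. Its density is a multiple of `t k' + n k`, and `t^{n-1} (t k' + n k)
  -- = (t^n k)' = g'`.
  set k : ℝ → ℝ := fun t => (t ^ n)⁻¹ * g t with hkdef
  obtain ⟨A, hA, B, hB, hAB, hts⟩ := hk.exists_support_subset hU (nonempty_radiiSq hΩ ha)
  have hs := (subset_tsupport k).trans hts
  have hki : Integrable k := hk.smooth.continuous.integrable_of_hasCompactSupport hk.compact
  set h : ℝ → ℝ := fun s => (∫ t in A..s, k t) - ∫ t, k t with hh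
  have hprim := contDiff_primitive hk.smooth A
  have hhs : ContDiff ℝ ∞ h := hprim.1.sub contDiff_const
  have hhd : deriv h = k := funext fun t => ((hprim.2 t).sub_const _).deriv
  have htest : IsTest Ω (fun z => h (distSq a z)) :=
    isTest_comp_distSq hhs hB fun t ht => by
      simp only [hh]; rw [primitive_eq_integral hs ht, sub_self]
  have e1 := hμ.integral_eq _ htest
  rw [ddcPairing_one le_rfl hn htest] at e1
  -- the left hand side of `e1`
  have e2 : ∫ z, h (distSq a z) ∂μ = - ∫ t, k t * massSq μ a t := by
    rw [← hμ.integral_integral_Ici hki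
      (fun t ht => hk.eq_zero fun h => absurd h.1 (not_lt.2 ht.le)) hB fun t ht => eq_zero_of_le hts ht.le, ← integral_neg]
    refine integral_congr_ae (Eventually.of_forall fun z => ?_)
    simp only [hh]
    rw [integral_Ici_eq_sub_primitive hki (A := A) fun t ht => ?_]
    · ring
    · by_contra hne; exact absurd (hs hne).1 (not_lt.2 ht)
  -- the right hand side of `e1`
  have hF : IsTestReal (radiiSq Ω a) (fun t => t * deriv k t + n * k t) :=
    (hk.deriv.mul_left hU contDiffOn_id).add (hk.const_mul _)
  have e3 : ∫ z in Ω, (φ z).toReal * laplaceDensity (fun z => h (distSq a z)) z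
      = ∫ t, t ^ (n - 1) * (t * deriv k t + n * k t) * meanSq φ a t := by
    rw [← integral_mul_radial (by omega) hΩ ha hf hF, ← integral_const_mul]
    refine integral_congr_ae (Eventually.of_forall fun z => ?_)
    simp only [laplaceDensity_radial hhs, hhd]
    ring
  have e4 : ∀ t, t ^ (n - 1) * (t * deriv k t + n * k t) * meanSq φ a t
      = meanSq φ a t * deriv g t := by
    intro t
    by_cases ht : t ∈ radiiSq Ω a
    · have hev : g =ᶠ[𝓝 t] fun s => s ^ n * k s := by
        filter_upwards [hU.mem_nhds ht] with s hs'
        have : s ^ n ≠ 0 := (pow_pos hs'.1 n).ne'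
        simp only [hkdef]
        field_simp
      have hd : HasDerivAt (fun s => s ^ n * k s) (n * t ^ (n - 1) * k t + t ^ n * deriv k t) t :=
        (hasDerivAt_pow n t).mul (hk.hasDerivAt t)
      rw [hev.deriv_eq, hd.deriv]
      obtain ⟨j, rfl⟩ := Nat.exists_eq_succ_of_ne_zero (show n ≠ 0 by omega)
      simp only [Nat.succ_eq_add_one, Nat.add_sub_cancel, pow_succ]
      ring
    · rw [hk.eq_zero ht, hk.deriv.eq_zero ht, hg.deriv.eq_zero ht]
      simp
  rw [e2, e3] at e1
  simp only [e4] at e1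
  rw [← e1]
  congr 1
  refine integral_congr_ae (Eventually.of_forall fun t => ?_)
  simp only [hkdef]
  ring

/-- The inequality for the spherical means obtained from `m`-positivity. -/
theorem IsMPositiveDdc.integral_meanSq_nonneg (hm : 1 ≤ m) (hmn : m < n) (hΩ : IsOpen Ω)
    (ha : a ∈ Ω) (hf : LocallyIntegrableOn (fun z => (φ z).toReal) Ω)
    (hφ : IsMPositiveDdc m Ω φ) {ψ : ℝ → ℝ} (hψ : IsTestReal (radiiSq Ω a) ψ)
    (hψ0 : ∀ t, 0 ≤ ψ t) :
    0 ≤ ∫ t, meanSq φ a t *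
      deriv (fun t => t ^ (n - 1) * (m * t * deriv ψ t + n * (m - 1) * ψ t)) t := by
  have hU := isOpen_radiiSq (a := a) hΩ
  -- The form should be `1 - (n/m) t⁻¹ w̄ wᵀ`, which is `t^{n/m}` times the Hessian of `φ_m`. The
  -- cutoff `κ` keeps it smooth at `a` without changing it on the support of `ψ`, and `e(t) t = κ ≤
  -- 1` keeps it `m`-positive everywhere.
  obtain ⟨κ, hκ1, hκ2, hκ3, hκ4, hκ5, hκ6⟩ := exists_contDiff_eq_one hU hψ.compact hψ.subset
  have hκ : IsTestReal (radiiSq Ω a) κ := ⟨hκ1, hκ2, hκ3⟩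
  have hinv : ContDiffOn ℝ ∞ (fun t : ℝ => t⁻¹) (radiiSq Ω a) :=
    contDiffOn_id.inv fun t ht => ht.1.ne'
  have he : IsTestReal (radiiSq Ω a) (fun t => t⁻¹ * κ t) := hκ.mul_left hU hinv
  set e : ℝ → ℝ := fun t => t⁻¹ * κ t with hedef
  have het : ∀ t ∈ radiiSq Ω a, e t * t = κ t := fun t ht => by
    have := ht.1.ne'
    simp only [hedef]; field_simp
  have heψ : ∀ t, ψ t * (e t * t) = ψ t := by
    intro t
    by_cases ht : t ∈ tsupport ψ
    · rw [het t (hψ.subset ht), hκ6 t ht, mul_one]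
    · rw [image_eq_zero_of_notMem_tsupport ht, zero_mul]
  have he1 : ∀ t, 0 ≤ t → e t * t ≤ 1 := by
    intro t _
    by_cases ht : t ∈ radiiSq Ω a
    · rw [het t ht]; exact hκ5 t
    · rw [he.eq_zero ht]; simp
  have hψe : IsTestReal (radiiSq Ω a) (fun t => ψ t * e t) :=
    he.mul_left hU hψ.smooth.contDiffOn
  obtain ⟨A, hA, B, hB, hAB, hts⟩ := hψ.exists_support_subset hU (nonempty_radiiSq hΩ ha)
  have htest : IsTest Ω (fun z => ψ (distSq a z)) :=
    isTest_comp_distSq hψ.smooth hB fun t ht => eq_zero_of_le hts ht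
  have h1 := hφ (fun z => ψ (distSq a z)) (fun _ z => radialForm m e a z) htest
    (fun z => hψ0 _) fun k _ _ => ⟨fun i j => (contDiff_radialForm he.smooth a i j).contDiffOn,
      fun z _ => isMPositive_radialForm hm hmn he1 a z⟩
  set F : ℝ → ℝ := fun t => (n - m) * (t * deriv (deriv ψ) t + n * deriv ψ t)
    + n * (m - 1) * (t * deriv (fun t => t * deriv (fun t => ψ t * e t) t + n * (ψ t * e t)) t
      + n * (t * deriv (fun t => ψ t * e t) t + n * (ψ t * e t))) with hFdef
  have hG : IsTestReal (radiiSq Ω a)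
      (fun t => t * deriv (fun t => ψ t * e t) t + n * (ψ t * e t)) :=
    (hψe.deriv.mul_left hU contDiffOn_id).add (hψe.const_mul _)
  have hF : IsTestReal (radiiSq Ω a) F :=
    (((hψ.deriv.deriv.mul_left hU contDiffOn_id).add (hψ.deriv.const_mul _)).const_mul _).add
      (((hG.deriv.mul_left hU contDiffOn_id).add (hG.const_mul _)).const_mul _)
  have h2 : ddcPairing m Ω φ (fun z => ψ (distSq a z)) (fun _ z => radialForm m e a z)
      = ((n - 2).factorial : ℝ) / (Real.pi ^ n * m) *
        ∫ z in Ω, (φ z).toReal * F (distSq a z) := by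
    rw [ddcPairing, ← integral_const_mul]
    refine integral_congr_ae (Eventually.of_forall fun z => ?_)
    simp only [ddcDensity_radialForm hm hmn he.smooth hψ.smooth heψ, hFdef]
    ring
  have h3 := integral_mul_radial (by omega) hΩ ha hf hF
  have hn1 : (0 : ℝ) < n - 1 := by
    have : (1 : ℝ) < n := by exact_mod_cast (show 1 < n by omega)
    linarith
  -- With `t^{n-1} (t f' + n f) = (t^n f)'`, applied to `f = ψ'` and to `f = ψ' + (n - 1) ψ / t`,
  -- the coefficients of `(t^n ψ')'` add up to `n - m + n (m - 1) = m (n - 1)`, so a factor `n - 1`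
  -- splits off.
  have h4 : ∀ t, t ^ (n - 1) * F t * meanSq φ a t = (n - 1) * (meanSq φ a t *
      deriv (fun t => t ^ (n - 1) * (m * t * deriv ψ t + n * (m - 1) * ψ t)) t) := by
    intro t
    by_cases ht : t ∈ radiiSq Ω a
    · have ht0 : t ≠ 0 := ht.1.ne'
      have hd1 : HasDerivAt (fun t => t ^ (n - 1) * (m * t * deriv ψ t + n * (m - 1) * ψ t))
          (((n - 1 : ℕ) : ℝ) * t ^ (n - 1 - 1) * (m * t * deriv ψ t + n * (m - 1) * ψ t)
            + t ^ (n - 1) * ((m * 1 * deriv ψ t + m * t * deriv (deriv ψ) t)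
              + n * (m - 1) * deriv ψ t)) t :=
        (hasDerivAt_pow (n - 1) t).mul (((((hasDerivAt_id t).const_mul (m : ℝ)).mul
          (hψ.deriv.hasDerivAt t))).add ((hψ.hasDerivAt t).const_mul _))
      have hev : ∀ s ∈ radiiSq Ω a, (fun t => ψ t * e t) =ᶠ[𝓝 s] fun t => ψ t / t := by
        intro s hs
        filter_upwards [hU.mem_nhds hs] with x hx
        have := heψ x
        have hx0 := hx.1.ne'
        field_simp
        linarith
      have hd2 : ∀ s ∈ radiiSq Ω a,
          deriv (fun t => ψ t * e t) s = (deriv ψ s * s - ψ s * 1) / s ^ 2 := fun s hs => by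
        rw [(hev s hs).deriv_eq]
        exact ((hψ.hasDerivAt s).div (hasDerivAt_id s) hs.1.ne').deriv
      have hev2 : (fun t => t * deriv (fun t => ψ t * e t) t + n * (ψ t * e t)) =ᶠ[𝓝 t]
          fun s => deriv ψ s + (n - 1) * (ψ s / s) := by
        filter_upwards [hU.mem_nhds ht] with x hx
        have hx0 := hx.1.ne'
        rw [hd2 x hx, (hev x hx).eq_of_nhds]
        field_simp
        ring
      have hd3 : HasDerivAt (fun s => deriv ψ s + (n - 1) * (ψ s / s))
          (deriv (deriv ψ) t + (n - 1) * ((deriv ψ t * t - ψ t * 1) / t ^ 2)) t :=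
        (hψ.deriv.hasDerivAt t).add
          (((hψ.hasDerivAt t).div (hasDerivAt_id t) ht0).const_mul _)
      have hev3 := hev2.eq_of_nhds
      rw [hd1.deriv]
      simp only [hFdef]
      rw [hev2.deriv_eq, hd3.deriv, hev3]
      obtain ⟨j, hj⟩ := Nat.exists_eq_add_of_le (show 2 ≤ n by omega)
      have hjn : (n : ℝ) = 2 + j := by rw [hj]; push_cast; ring
      rw [show n - 1 = j + 1 by omega, show j + 1 - 1 = j by omega, hjn, pow_succ]
      push_cast
      field_simp
      ring
    · have hz : deriv (fun t => t ^ (n - 1) * (m * t * deriv ψ t + n * (m - 1) * ψ t)) t = 0 := by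
        have : IsTestReal (radiiSq Ω a)
            (fun t => t ^ (n - 1) * (m * t * deriv ψ t + n * (m - 1) * ψ t)) :=
          ((hψ.deriv.mul_left hU (contDiffOn_const.mul contDiffOn_id)).add
            (hψ.const_mul _)).mul_left hU (contDiffOn_id.pow _)
        exact this.deriv.eq_zero ht
      rw [hz, hF.eq_zero ht]
      simp
  simp only [h4, integral_const_mul] at h3
  rw [h2] at h1
  have hm0 : (0 : ℝ) < m := by positivity
  have c1 : (0 : ℝ) < ((n - 2).factorial : ℝ) / (Real.pi ^ n * m) := by positivity
  have c2 : (0 : ℝ) < ((n - 1).factorial : ℝ) / Real.pi ^ n := by positivity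
  have h5 := nonneg_of_mul_nonneg_right h1 c1
  have h6 : 0 ≤ (n - 1 : ℝ) * ∫ t, meanSq φ a t *
      deriv (fun t => t ^ (n - 1) * (m * t * deriv ψ t + n * (m - 1) * ψ t)) t := by
    rw [← h3]; exact mul_nonneg c2.le h5
  exact nonneg_of_mul_nonneg_right h6 hn1

end Mass

/-! ### Spherical caps -/

section Cap

open Measure
open scoped Pointwise

variable {n : ℕ}

/-- For the underlying real inner product, the reflection in the hyperplane orthogonal to `v - w`
interchanges two vectors of equal norm. -/
lemma exists_linearIsometryEquiv_apply_eq {v w : Cn n} (h : ‖v‖ = ‖w‖) :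
    ∃ e : Cn n ≃ₗᵢ[ℝ] Cn n, e v = w := by
  let _ : InnerProductSpace ℝ (Cn n) := InnerProductSpace.rclikeToReal ℂ (Cn n)
  exact ⟨_, Submodule.reflection_sub h⟩

/-- The image of Lebesgue measure is a Haar measure, hence a multiple of it, and the factor is `1`
because the unit ball is preserved. -/
lemma volume_image_linearIsometryEquiv (e : Cn n ≃ₗᵢ[ℝ] Cn n) (s : Set (Cn n)) :
    volume (e '' s) = volume s := by
  set L := e.symm.toContinuousLinearEquiv
  have hL : IsAddHaarMeasure ((volume : Measure (Cn n)).map L) := inferInstance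
  have h1 : ∀ s, (volume : Measure (Cn n)).map L s = volume (e '' s) := by
    intro s
    have : (volume : Measure (Cn n)).map L s = volume (L ⁻¹' s) :=
      L.toHomeomorph.toMeasurableEquiv.map_apply s
    rw [this]
    congr 1
    exact (e.toEquiv.image_eq_preimage_symm s).symm
  have h2 := isAddLeftInvariant_eq_smul ((volume : Measure (Cn n)).map L) volume
  set c := addHaarScalarFactor ((volume : Measure (Cn n)).map L) volume
  have h3 : (volume : Measure (Cn n)).map L (ball 0 1) = volume (ball (0 : Cn n) 1) := by
    rw [h1, e.image_ball, map_zero]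
  have h4 : (c : ENNReal) = 1 := by
    rw [h2, Measure.smul_apply] at h3
    have h5 : (c : ENNReal) * volume (ball (0 : Cn n) 1) = 1 * volume (ball (0 : Cn n) 1) := by
      rw [one_mul]; exact h3
    exact (ENNReal.mul_left_inj (measure_ball_pos _ _ one_pos).ne' measure_ball_lt_top.ne).1 h5
  rw [← h1, h2, Measure.smul_apply]
  change (c : ENNReal) * volume s = volume s
  rw [h4, one_mul]

/-- The measure of the set of those `ξ` on the unit sphere for which `r ξ` has distance less than
`δ` from `z`. -/
def capMeasure (r δ : ℝ) (z : Cn n) : ENNReal :=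
  unitSphereMeasure n {ξ | ‖z - r • (ξ : Cn n)‖ < δ}

lemma measurableSet_cap (r δ : ℝ) :
    MeasurableSet {p : Cn n × sphere (0 : Cn n) 1 | ‖p.1 - r • (p.2 : Cn n)‖ < δ} := by
  have : Continuous fun p : Cn n × sphere (0 : Cn n) 1 => ‖p.1 - r • (p.2 : Cn n)‖ := by fun_prop
  exact (isOpen_lt this continuous_const).measurableSet

lemma measurable_capMeasure (r δ : ℝ) : Measurable (capMeasure (n := n) r δ) :=
  measurable_measure_prodMk_left (measurableSet_cap r δ)

/-- Rotation invariance. The spherical measure of a set is a constant times the volume of the cone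
over it, and an isometry taking `z` to `w` maps the cone over one cap onto the cone over the other.
-/
lemma capMeasure_eq_of_norm_eq (r δ : ℝ) {z w : Cn n} (h : ‖z‖ = ‖w‖) :
    capMeasure r δ z = capMeasure r δ w := by
  obtain ⟨e, rfl⟩ := exists_linearIsometryEquiv_apply_eq h
  have hms : ∀ z : Cn n, MeasurableSet {ξ : sphere (0 : Cn n) 1 | ‖z - r • (ξ : Cn n)‖ < δ} :=
    fun z => measurable_prodMk_left (measurableSet_cap r δ)
  rw [capMeasure, capMeasure, unitSphereMeasure, toSphere_apply' _ (hms _),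
    toSphere_apply' _ (hms _)]
  congr 1
  rw [← volume_image_linearIsometryEquiv e]
  congr 1
  ext x
  simp only [Set.mem_smul, Set.mem_image, Set.mem_ofPred_eq]
  constructor
  · rintro ⟨_, ⟨s, hs, _, ⟨ξ, hξ, rfl⟩, rfl⟩, rfl⟩
    refine ⟨s, hs, e ξ, ⟨⟨e ξ, by simp⟩, ?_, rfl⟩, by simp⟩
    rwa [← map_smul, ← map_sub, e.norm_map]
  · rintro ⟨s, hs, _, ⟨ξ, hξ, rfl⟩, rfl⟩
    refine ⟨s • e.symm ξ, ⟨s, hs, _, ⟨⟨e.symm ξ, by simp⟩, ?_, rfl⟩, rfl⟩, by simp⟩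
    rw [← e.norm_map]
    simpa using hξ

lemma capMeasure_eq_zero {r δ : ℝ} (hr : 0 ≤ r) {z : Cn n} (h : δ ≤ |‖z‖ - r|) :
    capMeasure r δ z = 0 := by
  have : {ξ : sphere (0 : Cn n) 1 | ‖z - r • (ξ : Cn n)‖ < δ} = ∅ := by
    ext ξ
    simp only [Set.mem_ofPred_eq, Set.mem_empty_iff_false, iff_false, not_lt]
    refine h.trans ?_
    have h1 : ‖r • (ξ : Cn n)‖ = r := by rw [norm_smul, norm_eq_of_mem_sphere, mul_one,
      Real.norm_of_nonneg hr]
    have h2 := abs_norm_sub_norm_le z (r • (ξ : Cn n))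
    rwa [h1] at h2
  rw [capMeasure, this, measure_empty]

/-- Averages over balls centered on a sphere. -/
lemma lintegral_sphere_lintegral_ball (a : Cn n) (r δ : ℝ) {g : Cn n → ENNReal}
    (hg : Measurable g) :
    ∫⁻ ξ : sphere (0 : Cn n) 1, (∫⁻ z in ball (a + r • (ξ : Cn n)) δ, g z) ∂(unitSphereMeasure n)
      = ∫⁻ z, capMeasure r δ (z - a) * g z := by
  have h1 : ∀ (z : Cn n) (ξ : sphere (0 : Cn n) 1),
      z ∈ ball (a + r • (ξ : Cn n)) δ ↔ ‖z - a - r • (ξ : Cn n)‖ < δ := by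
    intro z ξ
    rw [mem_ball, dist_eq_norm, sub_sub]
  have hS : MeasurableSet {p : sphere (0 : Cn n) 1 × Cn n | p.2 ∈ ball (a + r • (p.1 : Cn n)) δ} := by
    have : Continuous fun p : sphere (0 : Cn n) 1 × Cn n => ‖p.2 - a - r • (p.1 : Cn n)‖ := by
      fun_prop
    simp only [h1]
    exact (isOpen_lt this continuous_const).measurableSet
  calc _ = ∫⁻ ξ : sphere (0 : Cn n) 1, (∫⁻ z, (ball (a + r • (ξ : Cn n)) δ).indicator g z)
          ∂(unitSphereMeasure n) := by
        simp only [lintegral_indicator measurableSet_ball]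
    _ = ∫⁻ z, (∫⁻ ξ : sphere (0 : Cn n) 1, (ball (a + r • (ξ : Cn n)) δ).indicator g z
          ∂(unitSphereMeasure n)) := by
        refine lintegral_lintegral_swap (Measurable.aemeasurable ?_)
        exact (hg.comp measurable_snd).indicator hS
    _ = _ := by
        refine lintegral_congr fun z => ?_
        have hms : MeasurableSet {ξ : sphere (0 : Cn n) 1 | ‖z - a - r • (ξ : Cn n)‖ < δ} :=
          measurable_prodMk_left (measurableSet_cap r δ)
        rw [capMeasure, mul_comm, ← lintegral_indicator_const hms]
        refine lintegral_congr fun ξ => ?_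
        simp only [Set.indicator, h1, Set.mem_ofPred_eq]

/-- A lower bound for the means over concentric spheres is a lower bound for the averages over balls
centered on a sphere. -/
lemma mul_volume_ball_le_lintegral_sphere (hn : 0 < n) (a : Cn n) {r δ : ℝ} (hr : 0 ≤ r)
    {g : Cn n → ENNReal} (hg : Measurable g) {c : ENNReal}
    (hc : ∀ᵐ s, s ∈ Set.Ioo (r - δ) (r + δ) → 0 < s →
      c ≤ ∫⁻ ξ : sphere (0 : Cn n) 1, g (a + s • (ξ : Cn n)) ∂(unitSphereMeasure n)) :
    c * volume (ball (0 : Cn n) δ) ≤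
      ∫⁻ ξ : sphere (0 : Cn n) 1, (∫⁻ z in ball (a + r • (ξ : Cn n)) δ, g z)
        ∂(unitSphereMeasure n) := by
  have := nontrivial_Cn hn
  set S := unitSphereMeasure n Set.univ
  have hS0 : S ≠ 0 := unitSphereMeasure_univ_ne_zero hn
  have hStop : S ≠ ⊤ := measure_ne_top _ _
  obtain ⟨v, hv⟩ := exists_norm_eq (Cn n) zero_le_one
  set κ : ℝ → ENNReal := fun s => capMeasure r δ (s • v) with hκ
  have hcap : ∀ s, 0 < s → ∀ ξ : sphere (0 : Cn n) 1,
      capMeasure r δ (a + s • (ξ : Cn n) - a) = κ s := by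
    intro s _ ξ
    refine capMeasure_eq_of_norm_eq r δ ?_
    rw [add_sub_cancel_left, norm_smul, norm_smul, norm_eq_of_mem_sphere, hv]
  have hmc : Measurable fun z : Cn n => capMeasure r δ (z - a) :=
    (measurable_capMeasure r δ).comp (measurable_id.sub_const a)
  have hpol : ∀ f : Cn n → ENNReal, Measurable f →
      ∫⁻ ξ : sphere (0 : Cn n) 1, (∫⁻ z in ball (a + r • (ξ : Cn n)) δ, f z)
        ∂(unitSphereMeasure n) = ∫⁻ s in Set.Ioi 0, ENNReal.ofReal (s ^ (2 * n - 1)) * (κ s *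
          ∫⁻ ξ : sphere (0 : Cn n) 1, f (a + s • (ξ : Cn n)) ∂(unitSphereMeasure n)) := by
    intro f hf
    rw [lintegral_sphere_lintegral_ball a r δ hf, lintegral_polar hn a (g := fun z => capMeasure r δ (z - a) * f z) (hmc.mul hf)]
    refine setLIntegral_congr_fun measurableSet_Ioi fun s hs => ?_
    simp only [hcap s hs]
    rw [lintegral_const_mul _ (show Measurable fun ξ : sphere (0 : Cn n) 1 => f (a + s • (ξ : Cn n))
      by fun_prop)]
  -- The constant function `1` shows that the total weight `∫ s^{2n-1} κ(s) ds` is the volume of a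
  -- ball of radius `δ`.
  have h1 := hpol (fun _ => 1) measurable_const
  simp only [lintegral_const, one_mul, Measure.restrict_apply_univ,
    addHaar_ball_center] at h1
  have hmκ : Measurable κ := (measurable_capMeasure r δ).comp (by fun_prop)
  have h2 : volume (ball (0 : Cn n) δ) * S
      = (∫⁻ s in Set.Ioi 0, ENNReal.ofReal (s ^ (2 * n - 1)) * κ s) * S := by
    rw [h1, ← lintegral_mul_const _ (by fun_prop)]
    simp only [mul_assoc, S]
  rw [(ENNReal.mul_left_inj hS0 hStop).1 h2, hpol g hg, ← lintegral_const_mul _ (by fun_prop)]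
  refine lintegral_mono_ae ?_
  refine (ae_restrict_iff' measurableSet_Ioi).2 ?_
  filter_upwards [hc] with s hs hs0
  rw [mul_left_comm, mul_comm c]
  by_cases hmem : s ∈ Set.Ioo (r - δ) (r + δ)
  · gcongr
    exact hs hmem hs0
  · have : κ s = 0 := by
      refine capMeasure_eq_zero hr ?_
      rw [norm_smul, hv, mul_one, Real.norm_of_nonneg (le_of_lt hs0)]
      by_contra hlt
      rw [not_le, abs_lt] at hlt
      exact hmem ⟨by linarith, by linarith⟩
    simp [this]

end Cap

/-! ### Continuity of spherical means -/

section SphericalMeans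

variable {n : ℕ} {Ω : Set (Cn n)} {φ : Cn n → EReal} {a : Cn n} {M r R : ℝ}

/-- The integral of `M - φ` over a sphere, normalised to the unit sphere. -/
def sphereGap (φ : Cn n → EReal) (M : ℝ) (a : Cn n) (r : ℝ) : ENNReal :=
  ∫⁻ ξ : sphere (0 : Cn n) 1, gap φ M (a + r • (ξ : Cn n)) ∂(unitSphereMeasure n)

lemma polar_mem_closedBall (a : Cn n) (hr : 0 ≤ r) (hrR : r ≤ R) (ξ : sphere (0 : Cn n) 1) :
    a + r • (ξ : Cn n) ∈ closedBall a R := by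
  rw [mem_closedBall, dist_self_add_left, norm_smul, norm_eq_of_mem_sphere, mul_one,
    Real.norm_of_nonneg hr]
  exact hrR

lemma measurable_gap_polar (hφm : Measurable φ) (M : ℝ) (a : Cn n) (r : ℝ) :
    Measurable fun ξ : sphere (0 : Cn n) 1 => gap φ M (a + r • (ξ : Cn n)) :=
  (measurable_gap hφm M).comp (by fun_prop)

lemma sphereIntegrable_of_sphereGap (hφm : Measurable φ)
    (hM : ∀ ξ : sphere (0 : Cn n) 1, φ (a + r • (ξ : Cn n)) ≤ M) (h : sphereGap φ M a r < ⊤) :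
    SphereIntegrable φ a r := by
  have hne : ∀ᵐ ξ : sphere (0 : Cn n) 1 ∂(unitSphereMeasure n), φ (a + r • (ξ : Cn n)) ≠ ⊥ := by
    filter_upwards [ae_lt_top (measurable_gap_polar hφm M a r) h.ne] with ξ hξ hbot
    simp [gap_of_eq_bot hbot] at hξ
  refine ⟨hne, ?_⟩
  have h1 := (integrable_const (μ := unitSphereMeasure n) M).sub
    (integrable_toReal_of_lintegral_ne_top (measurable_gap_polar hφm M a r).aemeasurable h.ne)
  refine h1.congr ?_
  filter_upwards [hne] with ξ hξ
  simp only [Pi.sub_apply]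
  rw [gap_of_ne_bot hξ (hM ξ), ENNReal.toReal_ofReal
    (sub_nonneg.2 (toReal_le_of_le hξ (hM ξ)))]
  ring

lemma SphereIntegrable.sphereGap_eq (hr : 0 < r)
    (hM : ∀ ξ : sphere (0 : Cn n) 1, φ (a + r • (ξ : Cn n)) ≤ M) (h : SphereIntegrable φ a r) :
    0 ≤ (unitSphereMeasure n).real Set.univ * M
        - 2 * Real.pi ^ n / (n - 1).factorial * sphereMean φ a r ∧
      sphereGap φ M a r = ENNReal.ofReal ((unitSphereMeasure n).real Set.univ * M
        - 2 * Real.pi ^ n / (n - 1).factorial * sphereMean φ a r) := by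
  have h0 : 0 ≤ᵐ[unitSphereMeasure n]
      fun ξ : sphere (0 : Cn n) 1 => M - (φ (a + r • (ξ : Cn n))).toReal := by
    filter_upwards [h.1] with ξ hξ using sub_nonneg.2 (toReal_le_of_le hξ (hM ξ))
  have h1 : ∫ ξ : sphere (0 : Cn n) 1, (M - (φ (a + r • (ξ : Cn n))).toReal)
      ∂(unitSphereMeasure n) = (unitSphereMeasure n).real Set.univ * M
        - 2 * Real.pi ^ n / (n - 1).factorial * sphereMean φ a r := by
    rw [integral_sub (integrable_const _) h.2, integral_sphere_eq hr, integral_const, smul_eq_mul,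
      meanSq, Real.sqrt_sq hr.le]
  rw [← h1]
  refine ⟨integral_nonneg_of_ae h0, ?_⟩
  rw [ofReal_integral_eq_lintegral_ofReal
    (f := fun ξ : sphere (0 : Cn n) 1 => M - (φ (a + r • (ξ : Cn n))).toReal)
    ((integrable_const _).sub h.2) h0]
  refine lintegral_congr_ae ?_
  filter_upwards [h.1] with ξ hξ using gap_of_ne_bot hξ (hM ξ)

lemma IsSubharmonic.ae_sphereGap_lt_top (hn : 0 < n) (hΩ : IsOpen Ω) (hφ : IsSubharmonic Ω φ)
    (hφm : Measurable φ) (hR : closedBall a R ⊆ Ω) (hM : ∀ z ∈ closedBall a R, φ z ≤ M) :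
    ∀ᵐ r, r ∈ Set.Ioo 0 R → sphereGap φ M a r < ⊤ := by
  have hf : IntegrableOn (fun z => (φ z).toReal) (ball a R) :=
    ((hφ.locallyIntegrableOn hn hΩ hφm).integrableOn_compact_subset hR
      (isCompact_closedBall a R)).mono_set ball_subset_closedBall
  have h1 : ∫⁻ z in ball a R, gap φ M z < ⊤ := by
    have h2 : ∫⁻ z in ball a R, gap φ M z
        = ∫⁻ z in ball a R, ENNReal.ofReal (M - (φ z).toReal) := by
      refine setLIntegral_congr_fun_ae measurableSet_ball ?_
      filter_upwards [hφ.ae_ne_bot hn hΩ hφm] with z hz hzR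
      exact gap_of_ne_bot (hz (hR (ball_subset_closedBall hzR)))
        (hM z (ball_subset_closedBall hzR))
    rw [h2]
    have hfin : IsFiniteMeasure (volume.restrict (ball a R)) :=
      ⟨by simpa using measure_ball_lt_top⟩
    exact ((integrable_const M).sub hf).lintegral_lt_top
  rw [lintegral_ball_polar hn a (measurable_gap hφm M)] at h1
  have hmeas : Measurable fun r => ENNReal.ofReal (r ^ (2 * n - 1)) * sphereGap φ M a r := by
    refine Measurable.mul (by fun_prop) ?_
    refine Measurable.lintegral_prod_right' (f := fun p : ℝ × sphere (0 : Cn n) 1 =>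
      gap φ M (a + p.1 • (p.2 : Cn n))) ?_
    exact (measurable_gap hφm M).comp (by fun_prop)
  have h3 := ae_lt_top hmeas h1.ne
  rw [ae_restrict_iff' measurableSet_Ioo] at h3
  filter_upwards [h3] with r hr hrR
  have h4 := hr hrR
  by_contra hne
  rw [not_lt, top_le_iff] at hne
  have hpos : ENNReal.ofReal (r ^ (2 * n - 1)) ≠ 0 := by
    simpa using pow_pos hrR.1 _
  rw [hne, ENNReal.mul_top hpos] at h4
  exact lt_irrefl _ h4

lemma IsSubharmonic.lowerSemicontinuousOn_gap (hφ : IsSubharmonic Ω φ) (M : ℝ) :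
    LowerSemicontinuousOn (gap φ M) Ω := by
  have hc : Continuous fun x : EReal => ((M : EReal) - x).toENNReal := by
    have : Continuous fun x : EReal => (M : EReal) - x := by
      simp only [sub_eq_add_neg]
      refine continuous_iff_continuousAt.2 fun x => ?_
      exact (EReal.continuousAt_add (Or.inl (EReal.coe_ne_top _)) (Or.inl (EReal.coe_ne_bot _))).comp
        (f := fun x : EReal => ((M : EReal), -x)) (by fun_prop)
    exact this.ereal_toENNReal
  exact hc.comp_upperSemicontinuousOn_antitone hφ.usc fun x y hxy =>
    EReal.toENNReal_le_toENNReal (EReal.sub_le_sub le_rfl hxy)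

/-- Fatou's lemma, combined with the lower semicontinuity of `M - φ` along each ray. -/
lemma IsSubharmonic.sphereGap_le_liminf (hΩ : IsOpen Ω) (hφ : IsSubharmonic Ω φ)
    (hφm : Measurable φ) (M : ℝ) (hr : 0 ≤ r) (hrΩ : closedBall a r ⊆ Ω) {u : ℕ → ℝ}
    (hu : Tendsto u atTop (𝓝 r)) :
    sphereGap φ M a r ≤ liminf (fun k => sphereGap φ M a (u k)) atTop := by
  refine le_trans ?_ (lintegral_liminf_le fun k => measurable_gap_polar hφm M a (u k))
  refine lintegral_mono fun ξ => ?_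
  have hmem : a + r • (ξ : Cn n) ∈ Ω := hrΩ (polar_mem_closedBall a hr le_rfl ξ)
  have h1 := lowerSemicontinuousWithinAt_iff_le_liminf.1 (hφ.lowerSemicontinuousOn_gap M _ hmem)
  rw [hΩ.nhdsWithin_eq hmem] at h1
  have h2 : Tendsto (fun k => a + u k • (ξ : Cn n)) atTop (𝓝 (a + r • (ξ : Cn n))) :=
    (hu.smul_const _).const_add _
  refine h1.trans ?_
  exact liminf_le_liminf_of_le h2

/-- Spherical means that agree almost everywhere with a continuous function agree everywhere. -/
theorem IsSubharmonic.sphereMean_eq_of_ae (hn : 0 < n) (hΩ : IsOpen Ω) (hφ : IsSubharmonic Ω φ)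
    (hφm : Measurable φ) (hR : closedBall a R ⊆ Ω) {F : ℝ → ℝ}
    (hF : ContinuousOn F (Set.Ioo 0 R)) (h : ∀ᵐ r, r ∈ Set.Ioo 0 R → sphereMean φ a r = F r)
    (hr : r ∈ Set.Ioo 0 R) : SphereIntegrable φ a r ∧ sphereMean φ a r = F r := by
  obtain ⟨M, hM0, hM⟩ := hφ.exists_bound (isCompact_closedBall a R) hR
  set S := (unitSphereMeasure n).real Set.univ
  set C : ℝ := 2 * Real.pi ^ n / (n - 1).factorial with hC
  have hCpos : 0 < C := by positivity
  have hMξ : ∀ s ∈ Set.Ioo 0 R, ∀ ξ : sphere (0 : Cn n) 1, φ (a + s • (ξ : Cn n)) ≤ M :=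
    fun s hs ξ => hM _ (polar_mem_closedBall a hs.1.le hs.2.le ξ)
  set H : ℝ → ℝ := fun s => S * M - C * F s
  have hH : ContinuousOn H (Set.Ioo 0 R) := by fun_prop
  have hHr : ContinuousAt H r := hH.continuousAt (Ioo_mem_nhds hr.1 hr.2)
  have hgood : ∀ᵐ s, s ∈ Set.Ioo 0 R → 0 ≤ H s ∧ sphereGap φ M a s = ENNReal.ofReal (H s) := by
    filter_upwards [h, hφ.ae_sphereGap_lt_top hn hΩ hφm hR hM] with s hs1 hs2 hs
    have := (sphereIntegrable_of_sphereGap hφm (hMξ s hs) (hs2 hs)).sphereGap_eq hs.1 (hMξ s hs)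
    rwa [hs1 hs] at this
  -- The radii where the formula holds have full measure and are therefore dense; a sequence of them
  -- converging to `r` gives `≤` by `sphereGap_le_liminf`.
  obtain ⟨u, hu, hur⟩ := mem_closure_iff_seq_limit.1 (Measure.dense_of_ae hgood r)
  have hev : ∀ᶠ k in atTop, u k ∈ Set.Ioo 0 R := hur (Ioo_mem_nhds hr.1 hr.2)
  have hHu : Tendsto (fun k => H (u k)) atTop (𝓝 (H r)) := hHr.tendsto.comp hur
  have hH0 : 0 ≤ H r := by
    refine ge_of_tendsto hHu ?_
    filter_upwards [hev] with k hk using (hu k hk).1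
  have hle : sphereGap φ M a r ≤ ENNReal.ofReal (H r) := by
    refine (hφ.sphereGap_le_liminf hΩ hφm M hr.1.le
      ((closedBall_subset_closedBall hr.2.le).trans hR) hur).trans_eq ?_
    refine Tendsto.liminf_eq ?_
    refine ((ENNReal.continuous_ofReal.tendsto _).comp hHu).congr' ?_
    filter_upwards [hev] with k hk using (hu k hk).2.symm
  have hge : ENNReal.ofReal (H r) ≤ sphereGap φ M a r := by
    refine le_of_forall_lt_imp_le_of_dense fun c hc => ?_
    have hcont : ContinuousAt (fun s => ENNReal.ofReal (H s)) r :=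
      ENNReal.continuous_ofReal.continuousAt.comp hHr
    obtain ⟨δ, hδ, hball⟩ := Metric.mem_nhds_iff.1
      ((hcont.eventually (lt_mem_nhds hc)).and (Ioo_mem_nhds hr.1 hr.2))
    have hmem : ∀ s ∈ Set.Ioo (r - δ) (r + δ), c < ENNReal.ofReal (H s) ∧ s ∈ Set.Ioo 0 R :=
      fun s hs => hball (by rwa [Real.ball_eq_Ioo])
    have hlast := (hmem (r + δ / 2) ⟨by linarith, by linarith⟩).2
    -- For `≥`, the average of `M - φ` over small balls centred on the sphere is at most its mean
    -- over the sphere, by the sub-mean value inequality. On the other hand it is a weighted average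
    -- of means over nearby concentric spheres, almost all of which exceed `c`.
    have h1 := mul_volume_ball_le_lintegral_sphere hn a (δ := δ / 2) hr.1.le
      (measurable_gap hφm M) (c := c) (by
        filter_upwards [hgood] with s hs hsδ _
        obtain ⟨h3, h4⟩ := hmem s ⟨by linarith [hsδ.1], by linarith [hsδ.2]⟩
        exact ((hs h4).2 ▸ h3.le :))
    have h2 : ∀ ξ : sphere (0 : Cn n) 1, ∫⁻ z in ball (a + r • (ξ : Cn n)) (δ / 2), gap φ M z
        ≤ volume (ball (0 : Cn n) (δ / 2)) * gap φ M (a + r • (ξ : Cn n)) := by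
      intro ξ
      have hsub : closedBall (a + r • (ξ : Cn n)) (δ / 2) ⊆ closedBall a R := by
        refine closedBall_subset_closedBall' ?_
        have := polar_mem_closedBall a hr.1.le le_rfl ξ
        rw [mem_closedBall] at this
        linarith [hlast.2]
      have := hφ.lintegral_ball_gap_le hn hφm hM0 (hsub.trans hR) fun w hw => hM w (hsub hw)
      rwa [Measure.addHaar_ball_center] at this
    have h3 := h1.trans (lintegral_mono h2)
    rw [lintegral_const_mul _ (measurable_gap_polar hφm M a r), mul_comm] at h3
    exact (ENNReal.mul_le_mul_iff_right (measure_ball_pos _ _ (half_pos hδ)).ne'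
      measure_ball_lt_top.ne).1 h3
  have hSI := sphereIntegrable_of_sphereGap hφm (hMξ r hr) (hle.trans_lt ENNReal.ofReal_lt_top)
  refine ⟨hSI, ?_⟩
  obtain ⟨h1, h2⟩ := hSI.sphereGap_eq hr.1 (hMξ r hr)
  rw [h2] at hle hge
  have h3 := (ENNReal.ofReal_eq_ofReal_iff h1 hH0).1 (le_antisymm hle hge)
  have h4 : C * sphereMean φ a r = C * F r := by
    simp only [H] at h3; linarith
  exact mul_left_cancel₀ hCpos.ne' h4

end SphericalMeans

/-! ### Slopes and limits -/

section Slopes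

/-- Division by `X → -∞` makes the additive constants negligible and reverses inequalities: the
upper bound for `F` controls the quotient from below, and the lower bounds with slopes `c' > c`
control it from above. -/
lemma tendsto_div_of_linear_bounds {F X : ℝ → ℝ} {l : Filter ℝ} {c : ℝ} (hX : Tendsto X l atBot)
    (hle : ∃ A, ∀ᶠ r in l, F r ≤ A + c * X r)
    (hge : ∀ c' > c, ∃ B, ∀ᶠ r in l, B + c' * X r ≤ F r) :
    Tendsto (fun r => F r / X r) l (𝓝 c) := by
  have hlim : ∀ A c : ℝ, Tendsto (fun r => A / X r + c) l (𝓝 c) := by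
    intro A c
    simpa using (hX.const_div_atBot A).add_const c
  rw [tendsto_order]
  constructor
  · intro b hb
    obtain ⟨A, hA⟩ := hle
    filter_upwards [hA, (hlim A c).eventually (lt_mem_nhds hb), hX.eventually (eventually_lt_atBot 0)]
      with r h1 h2 h3
    refine h2.trans_le ?_
    rw [div_add' _ _ _ h3.ne, div_le_div_right_of_neg h3]
    exact h1
  · intro b hb
    obtain ⟨B, hB⟩ := hge ((c + b) / 2) (by linarith)
    filter_upwards [hB, (hlim B ((c + b) / 2)).eventually (gt_mem_nhds (show (c + b) / 2 < b by linarith)),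
      hX.eventually (eventually_lt_atBot 0)] with r h1 h2 h3
    refine lt_of_le_of_lt ?_ h2
    rw [div_add' _ _ _ h3.ne, div_le_div_right_of_neg h3]
    exact h1

/-- A function whose difference quotients with respect to `Φ` lie between the values at the end
points of a nonnegative function is a convex nondecreasing function of `Φ`. -/
lemma exists_convexOn_of_slope_bounds {R : Set ℝ} (hR : R.OrdConnected) {Φ F v : ℝ → ℝ}
    (hc : ContinuousOn Φ R) (hΦ : StrictMonoOn Φ R) (hv : ∀ r ∈ R, 0 ≤ v r)
    (hF : ∀ s ∈ R, ∀ t ∈ R, s ≤ t →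
      v s * (Φ t - Φ s) ≤ F t - F s ∧ F t - F s ≤ v t * (Φ t - Φ s)) :
    ∃ G : ℝ → ℝ, ConvexOn ℝ (Φ '' R) G ∧ MonotoneOn G (Φ '' R) ∧ ∀ r ∈ R, F r = G (Φ r) := by
  have hG : ∀ r ∈ R, F r = F (Function.invFunOn Φ R (Φ r)) := fun r hr => by
    rw [hΦ.injOn.leftInvOn_invFunOn hr]
  have hconv : Convex ℝ (Φ '' R) :=
    ((hR.isPreconnected.image Φ hc).ordConnected).convex
  refine ⟨fun x => F (Function.invFunOn Φ R x), ?_, ?_, hG⟩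
  · refine convexOn_of_slope_mono_adjacent hconv ?_
    rintro _ y _ ⟨s, hs, rfl⟩ ⟨t, ht, rfl⟩ hxy hyz
    obtain ⟨u, hu, rfl⟩ : y ∈ Φ '' R := hconv.ordConnected.out ⟨s, hs, rfl⟩ ⟨t, ht, rfl⟩
      ⟨hxy.le, hyz.le⟩
    simp only [← hG s hs, ← hG t ht, ← hG u hu]
    have h1 := (hΦ.lt_iff_lt hs hu).1 hxy
    have h2 := (hΦ.lt_iff_lt hu ht).1 hyz
    -- The value of `v` at the middle point separates the two adjacent slopes.
    calc (F u - F s) / (Φ u - Φ s) ≤ v u :=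
          (div_le_iff₀ (sub_pos.2 hxy)).2 (hF s hs u hu h1.le).2
      _ ≤ _ := (le_div_iff₀ (sub_pos.2 hyz)).2 (hF u hu t ht h2.le).1
  · rintro _ ⟨s, hs, rfl⟩ _ ⟨t, ht, rfl⟩ hst
    simp only [← hG s hs, ← hG t ht]
    have h1 := (hΦ.le_iff_le hs ht).1 hst
    exact sub_nonneg.1 ((mul_nonneg (hv s hs) (sub_nonneg.2 hst)).trans (hF s hs t ht h1).1)

variable {n m : ℕ} {r : ℝ}

lemma phi_eq_phiSq (hr : 0 ≤ r) : phi n m r = phiSq n m (r ^ 2) := by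
  rw [phi, phiSq, ← Real.rpow_natCast r 2, ← Real.rpow_mul hr]
  norm_num

lemma hasDerivAt_phi_pos (hm : 1 ≤ m) (hmn : m < n) (hr : 0 < r) :
    ∃ d > 0, HasDerivAt (fun r => phiSq n m (r ^ 2)) d r := by
  have h := (hasDerivAt_phiSq hm hmn (t := r ^ 2) (by positivity)).comp r (hasDerivAt_pow 2 r)
  exact ⟨_, by positivity, h⟩

lemma strictMonoOn_phi (hm : 1 ≤ m) (hmn : m < n) : StrictMonoOn (phi n m) (Set.Ioi 0) := by
  have h : StrictMonoOn (fun r => phiSq n m (r ^ 2)) (Set.Ioi 0) := by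
    refine strictMonoOn_of_deriv_pos (convex_Ioi 0) (fun r hr => ?_) fun r hr => ?_
    · obtain ⟨d, -, hd⟩ := hasDerivAt_phi_pos hm hmn hr
      exact hd.continuousAt.continuousWithinAt
    · rw [interior_Ioi] at hr
      obtain ⟨d, hd, hd'⟩ := hasDerivAt_phi_pos hm hmn hr
      rwa [hd'.deriv]
  exact h.congr fun r hr => (phi_eq_phiSq (le_of_lt hr)).symm

lemma continuousOn_phi (hm : 1 ≤ m) (hmn : m < n) : ContinuousOn (phi n m) (Set.Ioi 0) := by
  have h : ContinuousOn (fun r => phiSq n m (r ^ 2)) (Set.Ioi 0) := fun r hr => by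
    obtain ⟨d, -, hd⟩ := hasDerivAt_phi_pos hm hmn hr
    exact hd.continuousAt.continuousWithinAt
  exact h.congr fun r hr => phi_eq_phiSq (le_of_lt hr)

lemma phi_eq_rpow (hr : 0 < r) :
    phi n m r = -(1 / ((n / m : ℝ) - 1)) * r ^ (-(2 * ((n / m : ℝ) - 1))) := by
  rw [phi, Real.rpow_neg hr.le, one_div, one_div, mul_inv, neg_mul]

lemma tendsto_phi (hm : 1 ≤ m) (hmn : m < n) : Tendsto (phi n m) (𝓝[>] 0) atBot := by
  have hq := one_lt_div hm hmn
  have h1 := tendsto_rpow_neg_nhdsGT_zero (y := -(2 * ((n / m : ℝ) - 1))) (by linarith)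
  have hneg : -(1 / ((n / m : ℝ) - 1)) < 0 := by
    have : 0 < 1 / ((n / m : ℝ) - 1) := one_div_pos.2 (by linarith)
    linarith
  refine (h1.const_mul_atTop_of_neg hneg).congr' ?_
  filter_upwards [self_mem_nhdsWithin] with r hr using (phi_eq_rpow hr).symm

/-- With `q = n/m - 1 ≤ n - 1` the integral of `s^{2n-1-2q}` converges at `0` and equals `r^{2n-2q}
/ (2 (n - q))`. This is the origin of the factor `n / (n - q)` relating means over balls to means
over spheres. -/
lemma integral_pow_mul_phi (hm : 1 ≤ m) (hmn : m < n) (hr : 0 < r) (A B : ℝ) :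
    IntegrableOn (fun s => s ^ (2 * n - 1) * (A + B * phi n m s)) (Set.Ioo 0 r) ∧
      2 * n / r ^ (2 * n) * ∫ s in Set.Ioo 0 r, s ^ (2 * n - 1) * (A + B * phi n m s)
        = A + n / (n - ((n / m : ℝ) - 1)) * B * phi n m r := by
  set q : ℝ := (n / m : ℝ) - 1 with hq
  have hq0 : 0 < q := by have := one_lt_div hm hmn; linarith
  have hm1 : (1 : ℝ) ≤ m := by exact_mod_cast hm
  have hn1 : (1 : ℝ) < n := by exact_mod_cast hm.trans_lt hmn
  have hqn : q + 1 ≤ n := by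
    rw [hq, sub_add_cancel]
    exact div_le_self (by linarith) hm1
  have hcongr : ∀ s ∈ Set.Ioo 0 r, s ^ (2 * n - 1) * (A + B * phi n m s)
      = A * s ^ (2 * n - 1 : ℝ) + -(B / q) * s ^ (2 * n - 1 - 2 * q) := by
    intro s hs
    have e1 : s ^ (2 * n - 1) = s ^ (2 * n - 1 : ℝ) := by
      rw [← Real.rpow_natCast, Nat.cast_sub (by omega)]
      push_cast
      rfl
    rw [phi_eq_rpow hs.1, e1, Real.rpow_sub hs.1 (2 * n - 1) (2 * q), Real.rpow_neg hs.1.le, ← hq]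
    ring
  have i1 : IntervalIntegrable (fun s : ℝ => A * s ^ (2 * n - 1 : ℝ)) volume 0 r :=
    (intervalIntegral.intervalIntegrable_rpow' (by linarith)).const_mul A
  have i2 : IntervalIntegrable (fun s : ℝ => -(B / q) * s ^ (2 * n - 1 - 2 * q)) volume 0 r :=
    (intervalIntegral.intervalIntegrable_rpow' (by linarith)).const_mul _
  constructor
  · refine IntegrableOn.congr_fun ?_ (fun s hs => (hcongr s hs).symm) measurableSet_Ioo
    exact ((intervalIntegrable_iff_integrableOn_Ioo_of_le hr.le).1 (i1.add i2) :)
  · rw [setIntegral_congr_fun measurableSet_Ioo hcongr, ← integral_Ioc_eq_integral_Ioo,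
      ← intervalIntegral.integral_of_le hr.le, intervalIntegral.integral_add i1 i2,
      intervalIntegral.integral_const_mul, intervalIntegral.integral_const_mul,
      integral_rpow (Or.inl (by linarith)), integral_rpow (Or.inl (by linarith)),
      phi_eq_rpow hr, ← hq, Real.zero_rpow (by linarith), Real.zero_rpow (by linarith)]
    have e2 : r ^ (2 * n - 1 - 2 * q + 1) = r ^ (2 * n) * r ^ (-(2 * q)) := by
      rw [← Real.rpow_natCast r, ← Real.rpow_add hr]
      congr 1
      push_cast
      ring
    have e3 : r ^ ((2 * n - 1 : ℝ) + 1) = r ^ (2 * n) := by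
      rw [← Real.rpow_natCast r]
      congr 1
      push_cast
      ring
    rw [e2, e3]
    have h1 : r ^ (2 * n) ≠ 0 := by positivity
    have h2 : (n : ℝ) - q ≠ 0 := by linarith
    have h3 : 2 * (n : ℝ) - 1 - 2 * q + 1 ≠ 0 := by
      have : 2 * (n : ℝ) - 1 - 2 * q + 1 = 2 * (n - q) := by ring
      rw [this]; positivity
    have h4 : (2 * (n : ℝ) - 1 + 1) ≠ 0 := by linarith
    have h5 : q ≠ 0 := hq0.ne'
    have h6 : 2 * (n : ℝ) - 1 - 2 * q + 1 = 2 * (n - q) := by ring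
    have h7 : 2 * (n : ℝ) - 1 + 1 = 2 * n := by ring
    rw [h6, h7]
    have h8 : (n : ℝ) ≠ 0 := by linarith
    field_simp
    ring

end Slopes

/-! ### Lelong numbers and mean values -/

section Lelong

variable {n m : ℕ} {Ω : Set (Cn n)} {φ : Cn n → EReal} {a : Cn n} {μ : Measure (Cn n)}

lemma ordConnected_radii : (radii Ω a).OrdConnected :=
  ⟨fun _ hs _ ht _ hx =>
    ⟨hs.1.trans_le hx.1, (closedBall_subset_closedBall hx.2).trans ht.2⟩⟩

lemma mem_radii_of_le {s t : ℝ} (ht : t ∈ radii Ω a) (hs : 0 < s) (hst : s ≤ t) :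
    s ∈ radii Ω a :=
  ⟨hs, (closedBall_subset_closedBall hst).trans ht.2⟩

lemma radii_subset_Ioi : radii Ω a ⊆ Set.Ioi 0 := fun _ hr => hr.1

/-- The quotient of the mass of the closed ball of radius `r` and `r ^ (2 n (m - 1) / m)`. -/
def massQuot (n m : ℕ) (μ : Measure (Cn n)) (a : Cn n) (r : ℝ) : ℝ :=
  massSq μ a (r ^ 2) * (r ^ 2) ^ (-(n * (m - 1) / m : ℝ))

lemma massQuot_nonneg (r : ℝ) : 0 ≤ massQuot n m μ a r :=
  mul_nonneg (massSq_nonneg _) (Real.rpow_nonneg (sq_nonneg r) _)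

/-- The square root is differentiable on the positive half line and so maps null sets there to null
sets. -/
lemma ae_comp_sq {p : ℝ → Prop} (h : ∀ᵐ t, 0 < t → p t) : ∀ᵐ r, 0 < r → p (r ^ 2) := by
  rw [ae_iff] at h ⊢
  have hd : DifferentiableOn ℝ Real.sqrt {t | ¬(0 < t → p t)} := fun t ht => by
    simp only [Set.mem_ofPred_eq, Classical.not_imp] at ht
    exact (Real.hasDerivAt_sqrt ht.1.ne').differentiableAt.differentiableWithinAt
  refine measure_mono_null (fun r hr => ?_)
    (addHaar_image_eq_zero_of_differentiableOn_of_addHaar_eq_zero volume hd h)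
  simp only [Set.mem_ofPred_eq, Classical.not_imp] at hr
  exact ⟨r ^ 2, fun hp => hr.2 (hp (pow_pos hr.1 2)), Real.sqrt_sq hr.1.le⟩

theorem IsMSubharmonic.monotoneOn_massQuot (hm : 1 ≤ m) (hmn : m < n) (hΩ : IsOpen Ω) (ha : a ∈ Ω)
    (hφ : IsMSubharmonic m Ω φ) (hφm : Measurable φ) (hμ : IsTraceMeasure Ω φ μ) :
    MonotoneOn (fun t => massSq μ a t * t ^ (-(n * (m - 1) / m : ℝ))) (radiiSq Ω a) := by
  have hf := hφ.subharmonic.locallyIntegrableOn (by omega) hΩ hφm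
  exact monotoneOn_div_rpow hm hmn (isOpen_radiiSq hΩ) ordConnected_radiiSq radiiSq_subset_Ioi
    hμ.monotoneOn_massSq (fun t ht => hμ.continuousWithinAt_massSq hΩ ht)
    (fun g hg => hμ.integral_meanSq_mul_deriv (by omega) hΩ ha hf hg)
    fun ψ hψ hψ0 => hφ.mpositive.integral_meanSq_nonneg hm hmn hΩ ha hf hψ hψ0

/-- The spherical means are finite, and their difference quotients with respect to `φ_m(r)` are
controlled by the mass quotients. -/
theorem IsMSubharmonic.sphereMean_slope_bounds (hm : 1 ≤ m) (hmn : m < n) (hΩ : IsOpen Ω)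
    (ha : a ∈ Ω) (hφ : IsMSubharmonic m Ω φ) (hφm : Measurable φ) (hμ : IsTraceMeasure Ω φ μ) :
    (∀ r ∈ radii Ω a, SphereIntegrable φ a r) ∧
      ∀ s ∈ radii Ω a, ∀ t ∈ radii Ω a, s ≤ t →
        massQuot n m μ a s * (phi n m t - phi n m s) ≤ sphereMean φ a t - sphereMean φ a s ∧
        sphereMean φ a t - sphereMean φ a s ≤ massQuot n m μ a t * (phi n m t - phi n m s) := by
  have hn : 0 < n := by omega
  have hU := isOpen_radiiSq (a := a) hΩ
  have hUc := ordConnected_radiiSq (Ω := Ω) (a := a)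
  have hf := hφ.subharmonic.locallyIntegrableOn hn hΩ hφm
  have hcont : ContinuousOn (fun t : ℝ => (t ^ n)⁻¹) (radiiSq Ω a) :=
    (continuous_pow n).continuousOn.inv₀ fun t ht => (pow_pos ht.1 n).ne'
  have hw : LocallyIntegrableOn (fun t => massSq μ a t / t ^ n) (radiiSq Ω a) := by
    simp only [div_eq_mul_inv]
    exact (locallyIntegrableOn_of_monotoneOn hU hμ.monotoneOn_massSq).mul_continuousOn hcont
      hU.isLocallyClosed
  have hwr : ∀ t ∈ radiiSq Ω a,
      ContinuousWithinAt (fun t => massSq μ a t / t ^ n) (Set.Ioi t) t := fun t ht => by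
    simp only [div_eq_mul_inv]
    exact (hμ.continuousWithinAt_massSq hΩ ht).mul
      (hcont.continuousAt (hU.mem_nhds ht)).continuousWithinAt
  obtain ⟨t₀, ht₀⟩ := nonempty_radiiSq hΩ ha
  obtain ⟨K, hK⟩ := ae_eq_primitive_of_integral_deriv hU hUc (locallyIntegrableOn_meanSq hn hΩ hf)
    hw hwr (fun g hg => hμ.integral_meanSq_mul_deriv (by omega) hΩ ha hf hg) ht₀
  have hG := (continuousOn_primitive hU hUc hw ht₀).const_add K
  -- The formula holds for almost every squared radius, hence for almost every radius; its right
  -- side is continuous, so `sphereMean_eq_of_ae` extends it to every radius.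
  have hall : ∀ r ∈ radii Ω a, SphereIntegrable φ a r ∧
      sphereMean φ a r = K + ∫ x in t₀..r ^ 2, massSq μ a x / x ^ n := by
    intro r hr
    obtain ⟨R, hrR, hR⟩ := exists_radii_gt hΩ hr.1.le hr.2
    have hsub : ∀ s ∈ Set.Ioo 0 R, s ^ 2 ∈ radiiSq Ω a := fun s hs =>
      sq_mem_radiiSq (mem_radii_of_le hR hs.1 hs.2.le)
    refine hφ.subharmonic.sphereMean_eq_of_ae hn hΩ hφm hR.2
      (F := fun r => K + ∫ x in t₀..r ^ 2, massSq μ a x / x ^ n)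
      (hG.comp (continuous_pow 2).continuousOn hsub) ?_ ⟨hr.1, hrR⟩
    filter_upwards [ae_comp_sq (hK.mono fun t ht _ => ht)] with s hs hsR
    rw [← hs hsR.1 (hsub s hsR), meanSq, Real.sqrt_sq hsR.1.le]
  refine ⟨fun r hr => (hall r hr).1, fun s hs t ht hst => ?_⟩
  have hs2 := sq_mem_radiiSq hs
  have ht2 := sq_mem_radiiSq ht
  have hst2 : s ^ 2 ≤ t ^ 2 := pow_le_pow_left₀ hs.1.le hst 2
  have hI : ∀ x ∈ radiiSq Ω a, ∀ y ∈ radiiSq Ω a,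
      IntervalIntegrable (fun t => massSq μ a t / t ^ n) volume x y := fun x hx y hy =>
    (hw.integrableOn_compact_subset (hUc.uIcc_subset hx hy) isCompact_uIcc).intervalIntegrable
  rw [(hall s hs).2, (hall t ht).2, add_sub_add_left_eq_sub,
    intervalIntegral.integral_interval_sub_left (hI _ ht₀ _ ht2) (hI _ ht₀ _ hs2),
    phi_eq_phiSq hs.1.le, phi_eq_phiSq ht.1.le]
  exact primitive_slope_bounds hm hmn hs2.1 hst2 (hI _ hs2 _ ht2)
    ((hφ.monotoneOn_massQuot hm hmn hΩ ha hφm hμ).mono (hUc.out hs2 ht2))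

lemma ballMean_eq (hn : 0 < n) (hf : LocallyIntegrableOn (fun z => (φ z).toReal) Ω) {r : ℝ}
    (hr : r ∈ radii Ω a) :
    IntegrableOn (fun s => s ^ (2 * n - 1) * sphereMean φ a s) (Set.Ioo 0 r) ∧
      ballMean φ a r
        = 2 * n / r ^ (2 * n) * ∫ s in Set.Ioo 0 r, s ^ (2 * n - 1) * sphereMean φ a s := by
  have hfr : IntegrableOn (fun z => (φ z).toReal) (ball a r) :=
    (hf.integrableOn_compact_subset hr.2 (isCompact_closedBall a r)).mono_set ball_subset_closedBall
  have h2 : Real.pi ^ n ≠ 0 := by positivity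
  have h3 : ((n - 1).factorial : ℝ) ≠ 0 := by positivity
  constructor
  · have h := (integrable_polar hn a ((integrable_indicator_iff measurableSet_ball).2 hfr)).mono_set
      (s := Set.Ioo 0 r) Set.Ioo_subset_Ioi_self
    refine IntegrableOn.congr_fun (h.const_mul (((n - 1).factorial : ℝ) / (2 * Real.pi ^ n)))
      (fun s hs => ?_) measurableSet_Ioo
    simp only [sphereMean_eq hs.1, Set.indicator, mem_ball_polar a hs.1, hs.2, if_true]
    ring
  · rw [ballMean, setIntegral_ball_polar hn a hfr, ← integral_const_mul, ← integral_const_mul]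
    refine setIntegral_congr_fun measurableSet_Ioo fun s hs => ?_
    have h4 : (n.factorial : ℝ) = n * (n - 1).factorial := by
      exact_mod_cast (Nat.mul_factorial_pred hn.ne').symm
    have h5 : r ^ (2 * n) ≠ 0 := (pow_pos hr.1 _).ne'
    simp only [sphereMean_eq hs.1, h4]
    field_simp

/-- Bounds for spherical means carry over to averages over balls. -/
lemma ballMean_bounds (hm : 1 ≤ m) (hmn : m < n)
    (hf : LocallyIntegrableOn (fun z => (φ z).toReal) Ω) {r : ℝ} (hr : r ∈ radii Ω a)
    {A B A' B' : ℝ} (h : ∀ s ∈ Set.Ioo 0 r, A + B * phi n m s ≤ sphereMean φ a s ∧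
      sphereMean φ a s ≤ A' + B' * phi n m s) :
    A + n / (n - ((n / m : ℝ) - 1)) * B * phi n m r ≤ ballMean φ a r ∧
      ballMean φ a r ≤ A' + n / (n - ((n / m : ℝ) - 1)) * B' * phi n m r := by
  obtain ⟨h1, h2⟩ := ballMean_eq (by omega) hf hr
  obtain ⟨i1, e1⟩ := integral_pow_mul_phi hm hmn hr.1 A B
  obtain ⟨i2, e2⟩ := integral_pow_mul_phi hm hmn hr.1 A' B'
  have hr0 := hr.1
  rw [h2, ← e1, ← e2]
  constructor
  · refine mul_le_mul_of_nonneg_left (setIntegral_mono_on i1 h1 measurableSet_Ioo fun s hs => ?_)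
      (by positivity)
    exact mul_le_mul_of_nonneg_left (h s hs).1 (pow_pos hs.1 _).le
  · refine mul_le_mul_of_nonneg_left (setIntegral_mono_on h1 i2 measurableSet_Ioo fun s hs => ?_)
      (by positivity)
    exact mul_le_mul_of_nonneg_left (h s hs).2 (pow_pos hs.1 _).le

lemma massQuot_eq {r : ℝ} (hr : 0 < r) :
    massQuot n m μ a r = 1 / r ^ ((2 * n / m : ℝ) * (m - 1)) * μ.real (closedBall a r) := by
  rw [massQuot, massSq, Real.sqrt_sq hr.le, ← Real.rpow_natCast r 2, ← Real.rpow_mul hr.le, one_div,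
    ← Real.rpow_neg hr.le, mul_comm]
  congr 2
  push_cast
  ring

/-- The Lelong number, defined with open balls, is the limit of the mass quotients. -/
lemma tendsto_mass_ball (hμ : IsTraceMeasure Ω φ μ) {R ν : ℝ} (hR : R ∈ radii Ω a)
    (hν : ∀ r ∈ radii Ω a, ν ≤ massQuot n m μ a r)
    (hlim : Tendsto (massQuot n m μ a) (𝓝[>] 0) (𝓝 ν)) :
    Tendsto (fun r => 1 / r ^ ((2 * n / m : ℝ) * (m - 1)) * μ.real (ball a r)) (𝓝[>] 0) (𝓝 ν) := by
  have hmem : ∀ᶠ r in 𝓝[>] (0 : ℝ), r ∈ radii Ω a := by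
    filter_upwards [Ioo_mem_nhdsGT hR.1] with r hr using mem_radii_of_le hR hr.1 hr.2.le
  refine tendsto_of_tendsto_of_tendsto_of_le_of_le' tendsto_const_nhds hlim ?_ ?_
  · filter_upwards [hmem] with r hr
    set p : ℝ := (2 * n / m : ℝ) * (m - 1)
    have hpos : 0 < r ^ p := Real.rpow_pos_of_pos hr.1 _
    rw [one_div_mul_eq_div, le_div_iff₀ hpos]
    -- The lower bound for open balls is obtained by exhausting `ball a r` with the closed balls of
    -- radius `s < r`.
    have hc : Tendsto (fun s : ℝ => ν * s ^ p) (𝓝[<] r) (𝓝 (ν * r ^ p)) :=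
      (((Real.continuousAt_rpow_const _ _ (Or.inl hr.1.ne')).tendsto.const_mul ν).mono_left
        nhdsWithin_le_nhds)
    refine le_of_tendsto hc ?_
    filter_upwards [Ioo_mem_nhdsLT hr.1] with s hs
    have h1 := hν s (mem_radii_of_le hr hs.1 hs.2.le)
    rw [massQuot_eq hs.1, one_div_mul_eq_div, le_div_iff₀ (Real.rpow_pos_of_pos hs.1 _)] at h1
    refine h1.trans (ENNReal.toReal_mono ?_ (measure_mono (closedBall_subset_ball hs.2)))
    exact ((measure_mono ball_subset_closedBall).trans_lt (hμ.measure_closedBall_lt_top hr.2)).ne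
  · filter_upwards [hmem] with r hr
    rw [massQuot_eq hr.1]
    have : 0 < r ^ ((2 * n / m : ℝ) * (m - 1)) := Real.rpow_pos_of_pos hr.1 _
    refine mul_le_mul_of_nonneg_left ?_ (by positivity)
    exact ENNReal.toReal_mono (hμ.measure_closedBall_lt_top hr.2).ne
      (measure_mono ball_subset_closedBall)

/-- A form of l'Hôpital's rule. Below a fixed radius `τ` the mean lies between two affine functions
of `φ_m`, with slopes `massQuot` at `τ` and its infimum `ν`. Averaging over balls preserves such
bounds up to the factor `κ` on the slopes, and `τ → 0` makes the slopes agree. -/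
theorem IsMSubharmonic.exists_lelong (hm : 1 ≤ m) (hmn : m < n) (hΩ : IsOpen Ω) (ha : a ∈ Ω)
    (hφ : IsMSubharmonic m Ω φ) (hφm : Measurable φ) (hμ : IsTraceMeasure Ω φ μ) :
    ∃ ν, 0 ≤ ν ∧
      Tendsto (fun r => 1 / r ^ ((2 * n / m : ℝ) * (m - 1)) * μ.real (ball a r)) (𝓝[>] 0) (𝓝 ν) ∧
      Tendsto (fun r => sphereMean φ a r / phi n m r) (𝓝[>] 0) (𝓝 ν) ∧
      Tendsto (fun r => ballMean φ a r / phi n m r) (𝓝[>] 0)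
        (𝓝 (n / (n - ((n / m : ℝ) - 1)) * ν)) := by
  obtain ⟨R, hR⟩ := nonempty_radii hΩ ha
  have hf := hφ.subharmonic.locallyIntegrableOn (by omega) hΩ hφm
  obtain ⟨-, hslope⟩ := hφ.sphereMean_slope_bounds hm hmn hΩ ha hφm hμ
  have hmonot : MonotoneOn (massQuot n m μ a) (radii Ω a) := fun s hs t ht hst =>
    hφ.monotoneOn_massQuot hm hmn hΩ ha hφm hμ (sq_mem_radiiSq hs) (sq_mem_radiiSq ht)
      (pow_le_pow_left₀ hs.1.le hst 2)
  have hsub : Set.Ioo 0 R ⊆ radii Ω a := fun r hr => mem_radii_of_le hR hr.1 hr.2.le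
  have hbdd : BddBelow (massQuot n m μ a '' Set.Ioo 0 R) :=
    ⟨0, by rintro _ ⟨r, -, rfl⟩; exact massQuot_nonneg r⟩
  have hlim := (hmonot.mono hsub).tendsto_nhdsWithin_Ioo_right (Set.nonempty_Ioo.2 hR.1) hbdd
  set ν := sInf (massQuot n m μ a '' Set.Ioo 0 R)
  have hν0 : 0 ≤ ν := ge_of_tendsto' hlim fun r => massQuot_nonneg r
  have hν : ∀ r ∈ radii Ω a, ν ≤ massQuot n m μ a r := by
    intro r hr
    refine le_of_tendsto hlim ?_
    filter_upwards [Ioo_mem_nhdsGT hr.1] with s hs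
    exact hmonot (mem_radii_of_le hr hs.1 hs.2.le) hr hs.2.le
  have hX := tendsto_phi hm hmn
  have hphi : ∀ τ ∈ radii Ω a, ∀ r ∈ Set.Ioo 0 τ,
      sphereMean φ a τ - massQuot n m μ a τ * phi n m τ + massQuot n m μ a τ * phi n m r
        ≤ sphereMean φ a r ∧
      sphereMean φ a r ≤ sphereMean φ a τ - ν * phi n m τ + ν * phi n m r := by
    intro τ hτ r hr
    have hr' := mem_radii_of_le hτ hr.1 hr.2.le
    obtain ⟨h1, h2⟩ := hslope r hr' τ hτ hr.2.le
    have h3 := mul_le_mul_of_nonneg_right (hν r hr')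
      (sub_nonneg.2 (strictMonoOn_phi hm hmn hr.1 hτ.1 hr.2).le)
    constructor <;> linarith
  have hκ : 0 < (n : ℝ) / (n - ((n / m : ℝ) - 1)) := by
    have hn1 : (0 : ℝ) < n := by exact_mod_cast (show 0 < n by omega)
    have h1 : (n / m : ℝ) ≤ n := div_le_self hn1.le (by exact_mod_cast hm)
    exact div_pos hn1 (by linarith)
  set κ : ℝ := (n : ℝ) / (n - ((n / m : ℝ) - 1))
  have hgeneral : ∀ (F : ℝ → ℝ) (k : ℝ), 0 < k → (∀ τ ∈ radii Ω a, ∀ r ∈ Set.Ioo 0 τ,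
      sphereMean φ a τ - massQuot n m μ a τ * phi n m τ + k * massQuot n m μ a τ * phi n m r ≤ F r ∧
      F r ≤ sphereMean φ a τ - ν * phi n m τ + k * ν * phi n m r) →
      Tendsto (fun r => F r / phi n m r) (𝓝[>] 0) (𝓝 (k * ν)) := by
    intro F k hk hF
    refine tendsto_div_of_linear_bounds hX ⟨sphereMean φ a R - ν * phi n m R, ?_⟩ fun c hc => ?_
    · filter_upwards [Ioo_mem_nhdsGT hR.1] with r hr using (hF R hR r hr).2
    -- `τ` is taken so small that the slope `k * massQuot` at `τ` is below `c`. Since `φ_m ≤ 0`,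
    -- replacing this slope by the larger `c` only lowers the bound.
    · obtain ⟨τ, hτ, hτR⟩ := (((hlim.const_mul k).eventually (gt_mem_nhds hc)).and
        (Ioo_mem_nhdsGT hR.1)).exists
      have hτ' := hsub hτR
      refine ⟨sphereMean φ a τ - massQuot n m μ a τ * phi n m τ, ?_⟩
      filter_upwards [Ioo_mem_nhdsGT hτR.1, hX.eventually (eventually_le_atBot 0)] with r hr hr0
      have h1 := (hF τ hτ' r hr).1
      have h2 := mul_le_mul_of_nonpos_right hτ.le hr0
      linarith
  refine ⟨ν, hν0, tendsto_mass_ball hμ hR hν hlim, ?_, ?_⟩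
  · have := hgeneral (sphereMean φ a) 1 one_pos (by simpa using hphi)
    rwa [one_mul] at this
  · refine hgeneral (ballMean φ a) κ hκ fun τ hτ r hr => ?_
    exact ballMean_bounds hm hmn hf (mem_radii_of_le hτ hr.1 hr.2.le)
      fun s hs => hphi τ hτ s ⟨hs.1, hs.2.trans hr.2⟩

/-- The means of a bounded function are negligible compared to `φ_m(r)`. -/
lemma tendsto_sphereMean_div_phi_of_bounded (hm : 1 ≤ m) (hmn : m < n) {C : ℝ}
    (h : ∀ᶠ z in 𝓝 a, ((-C : ℝ) : EReal) ≤ φ z ∧ φ z ≤ (C : EReal)) :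
    Tendsto (fun r => sphereMean φ a r / phi n m r) (𝓝[>] 0) (𝓝 0) := by
  have hX := tendsto_phi hm hmn
  obtain ⟨δ, hδ, hball⟩ := Metric.eventually_nhds_iff_ball.1 h
  set D := ((n - 1).factorial : ℝ) / (2 * Real.pi ^ n) *
    (C * (unitSphereMeasure n).real Set.univ)
  have hD : ∀ r ∈ Set.Ioo 0 δ, |sphereMean φ a r| ≤ D := by
    intro r hr
    rw [sphereMean_eq hr.1, abs_mul, abs_of_pos (by positivity)]
    refine mul_le_mul_of_nonneg_left ?_ (by positivity)
    rw [← Real.norm_eq_abs]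
    refine norm_integral_le_of_norm_le_const (μ := unitSphereMeasure n) (Eventually.of_forall fun ξ => ?_)
    obtain ⟨h1, h2⟩ := hball (a + r • (ξ : Cn n)) ((mem_ball_polar a hr.1 ξ).2 hr.2)
    have hbot : φ (a + r • (ξ : Cn n)) ≠ ⊥ := fun hb => by simp [hb] at h1
    have htop : φ (a + r • (ξ : Cn n)) ≠ ⊤ := fun hb => by simp [hb] at h2
    rw [Real.norm_eq_abs, abs_le]
    rw [← EReal.coe_toReal htop hbot, EReal.coe_le_coe_iff] at h1 h2
    exact ⟨h1, h2⟩
  refine tendsto_div_of_linear_bounds hX ⟨D, ?_⟩ fun c hc => ⟨-D, ?_⟩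
  · filter_upwards [Ioo_mem_nhdsGT hδ] with r hr
    linarith [(abs_le.1 (hD r hr)).2]
  · filter_upwards [Ioo_mem_nhdsGT hδ, hX.eventually (eventually_le_atBot 0)] with r hr hr0
    have := mul_nonpos_of_nonneg_of_nonpos hc.le hr0
    linarith [(abs_le.1 (hD r hr)).1]

end Lelong

/-! ### Dependence on the values in `Ω` -/

section Congr

variable {n m : ℕ} {Ω : Set (Cn n)} {φ ψ : Cn n → EReal} {a : Cn n}

lemma polar_mem_of_mem_radii {r : ℝ} (hr : r ∈ radii Ω a) (ξ : sphere (0 : Cn n) 1) :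
    a + r • (ξ : Cn n) ∈ Ω :=
  hr.2 (polar_mem_closedBall a hr.1.le le_rfl ξ)

lemma sphereMeanE_congr (h : Set.EqOn φ ψ Ω) {r : ℝ} (hr : r ∈ radii Ω a) :
    sphereMeanE φ a r = sphereMeanE ψ a r := by
  simp only [sphereMeanE, h (polar_mem_of_mem_radii hr _)]

lemma sphereMean_congr (h : Set.EqOn φ ψ Ω) {r : ℝ} (hr : r ∈ radii Ω a) :
    sphereMean φ a r = sphereMean ψ a r := by
  simp only [sphereMean, h (polar_mem_of_mem_radii hr _)]

lemma SphereIntegrable.congr (h : Set.EqOn φ ψ Ω) {r : ℝ} (hr : r ∈ radii Ω a)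
    (hφ : SphereIntegrable φ a r) : SphereIntegrable ψ a r := by
  simpa only [SphereIntegrable, h (polar_mem_of_mem_radii hr _)] using hφ

lemma ballMean_congr (h : Set.EqOn φ ψ Ω) {r : ℝ} (hr : r ∈ radii Ω a) :
    ballMean φ a r = ballMean ψ a r := by
  rw [ballMean, ballMean]
  congr 1
  refine setIntegral_congr_fun measurableSet_ball fun z hz => ?_
  simp only [h (hr.2 (ball_subset_closedBall hz))]

lemma BallIntegrable.congr (h : Set.EqOn φ ψ Ω) {r : ℝ} (hr : r ∈ radii Ω a)
    (hφ : BallIntegrable φ a r) : BallIntegrable ψ a r := by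
  have h1 : Set.EqOn φ ψ (ball a r) := h.mono (ball_subset_closedBall.trans hr.2)
  refine ⟨?_, hφ.2.congr_fun (fun z hz => by simp only [h1 hz]) measurableSet_ball⟩
  filter_upwards [hφ.1, ae_restrict_mem measurableSet_ball] with z hz hzr
  rwa [← h1 hzr]

lemma ddcPairing_congr (hΩ : IsOpen Ω) (h : Set.EqOn φ ψ Ω) (χ : Cn n → ℝ)
    (α : ℕ → Cn n → Matrix (Fin n) (Fin n) ℂ) :
    ddcPairing m Ω φ χ α = ddcPairing m Ω ψ χ α :=
  setIntegral_congr_fun hΩ.measurableSet fun z hz => by simp only [h hz]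

lemma IsTraceMeasure.congr {μ : Measure (Cn n)} (hΩ : IsOpen Ω) (h : Set.EqOn φ ψ Ω)
    (hμ : IsTraceMeasure Ω φ μ) : IsTraceMeasure Ω ψ μ :=
  ⟨hμ.compl_eq_zero, hμ.finite, fun χ hχ => by
    rw [hμ.integral_eq χ hχ, ddcPairing_congr hΩ h]⟩

lemma IsSubharmonic.congr (h : Set.EqOn φ ψ Ω) (hφ : IsSubharmonic Ω φ) : IsSubharmonic Ω ψ where
  ne_top z hz := h hz ▸ hφ.ne_top z hz
  usc z hz y hy := by
    filter_upwards [hφ.usc z hz y ((h hz).trans_lt hy), self_mem_nhdsWithin] with w hw hwΩ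
    exact (h hwΩ).symm.trans_lt hw
  not_bot a ha := by
    obtain ⟨z, hz, hb⟩ := hφ.not_bot a ha
    exact ⟨z, hz, h (connectedComponentIn_subset _ _ hz) ▸ hb⟩
  submean a r hr har := by
    rw [← h (har (mem_closedBall_self hr.le)), ← sphereMeanE_congr h ⟨hr, har⟩]
    exact hφ.submean a r hr har

lemma IsMSubharmonic.congr (hΩ : IsOpen Ω) (h : Set.EqOn φ ψ Ω) (hφ : IsMSubharmonic m Ω φ) :
    IsMSubharmonic m Ω ψ :=
  ⟨hφ.subharmonic.congr h, fun χ α hχ hχ0 hα => by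
    rw [← ddcPairing_congr hΩ h]
    exact hφ.mpositive χ α hχ hχ0 hα⟩

/-- The function that agrees with `φ` on `Ω` and is `-∞` outside of `Ω`. -/
def extendBot (Ω : Set (Cn n)) (φ : Cn n → EReal) (z : Cn n) : EReal := ⨆ _ : z ∈ Ω, φ z

lemma extendBot_eqOn : Set.EqOn φ (extendBot Ω φ) Ω := fun z hz =>
  (iSup_pos (f := fun _ : z ∈ Ω => φ z) hz).symm

/-- Nothing is known about `φ` off `Ω`, not even measurability. After extension by `-∞` the set
where the function is below `y` is, for `y ≠ -∞`, the union of `Ωᶜ` and an open subset of `Ω`. -/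
lemma IsSubharmonic.measurable_extendBot (hΩ : IsOpen Ω) (hφ : IsSubharmonic Ω φ) :
    Measurable (extendBot Ω φ) := by
  refine measurable_of_Iio fun y => ?_
  rcases eq_or_ne y ⊥ with rfl | hy
  · simp
  obtain ⟨u, hu, hu'⟩ := upperSemicontinuousOn_iff_preimage_Iio.1 hφ.usc y
  have : extendBot Ω φ ⁻¹' Set.Iio y = Ωᶜ ∪ Ω ∩ u := by
    rw [← hu']
    ext z
    by_cases hz : z ∈ Ω
    · simp [hz, ← extendBot_eqOn hz]
    · simp [hz, extendBot, bot_lt_iff_ne_bot, hy]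
  rw [this]
  exact hΩ.measurableSet.compl.union (hΩ.inter hu).measurableSet

end Congr

end MSubharmonic

end

/-! ### The main theorem -/

theorem mainTheorem1 (n m : ℕ) (hm : 1 ≤ m) (hmn : m < n)
    (Ω : Set (MSubharmonic.Cn n)) (hΩ : IsOpen Ω)
    (φ : MSubharmonic.Cn n → EReal) (hφ : MSubharmonic.IsMSubharmonic m Ω φ)
    (a : MSubharmonic.Cn n) (ha : a ∈ Ω) :
    -- the measure in the definition of the Lelong number and the mean values are well defined
    (∃! μ : Measure (MSubharmonic.Cn n), MSubharmonic.IsTraceMeasure Ω φ μ) ∧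
    (∀ r ∈ MSubharmonic.radii Ω a,
      MSubharmonic.SphereIntegrable φ a r ∧ MSubharmonic.BallIntegrable φ a r) ∧
    -- the Lelong number exists and is given by the limits of the mean values
    (∃ ν l L : ℝ, 0 ≤ ν ∧ MSubharmonic.HasLelongNumber m Ω φ a ν ∧
      Tendsto (fun r => MSubharmonic.sphereMean φ a r / MSubharmonic.phi n m r) (𝓝[>] 0) (𝓝 l) ∧
      Tendsto (fun r => MSubharmonic.ballMean φ a r / MSubharmonic.phi n m r) (𝓝[>] 0) (𝓝 L) ∧
      ν = l ∧ ν = 1 / (n : ℝ) * ((n : ℝ) - n / m + 1) * L) ∧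
    -- it vanishes where the function is locally bounded
    ((∃ C : ℝ, ∀ᶠ z in 𝓝 a, ((-C : ℝ) : EReal) ≤ φ z ∧ φ z ≤ (C : EReal)) →
      MSubharmonic.HasLelongNumber m Ω φ a 0) ∧
    -- the spherical mean is a convex increasing function of `φ_m(r)`
    (∃ G : ℝ → ℝ,
      ConvexOn ℝ (MSubharmonic.phi n m '' MSubharmonic.radii Ω a) G ∧
      MonotoneOn G (MSubharmonic.phi n m '' MSubharmonic.radii Ω a) ∧
      ∀ r ∈ MSubharmonic.radii Ω a,
        MSubharmonic.sphereMean φ a r = G (MSubharmonic.phi n m r)) := by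
  have hn : 0 < n := by omega
  -- All notions involved depend only on the values in `Ω`, at radii whose closed balls lie in `Ω`,
  -- so `φ` may be replaced by its measurable extension `ψ` and the conclusions carried back.
  have hE := MSubharmonic.extendBot_eqOn (Ω := Ω) (φ := φ)
  have hm' := hφ.subharmonic.measurable_extendBot hΩ
  have hψ := hφ.congr hΩ hE
  set ψ := MSubharmonic.extendBot Ω φ
  have hf := hψ.subharmonic.locallyIntegrableOn hn hΩ hm'
  obtain ⟨μ, hμψ⟩ := MSubharmonic.exists_isTraceMeasure (by omega) hΩ hf
    fun χ hχ h0 => hψ.mpositive.integral_laplaceDensity_nonneg hm hmn hχ h0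
  have hμ := hμψ.congr hΩ hE.symm
  have hμ' := MSubharmonic.traceMeasure_spec ⟨μ, hμ⟩
  obtain ⟨hSI, hslope⟩ := hψ.sphereMean_slope_bounds hm hmn hΩ ha hm' hμψ
  obtain ⟨ν, hν0, hν, hl, hL⟩ := hψ.exists_lelong hm hmn hΩ ha hm' (hμ'.congr hΩ hE)
  obtain ⟨R, hR⟩ := MSubharmonic.nonempty_radii hΩ ha
  have hmem : ∀ᶠ r in 𝓝[>] (0 : ℝ), r ∈ MSubharmonic.radii Ω a := by
    filter_upwards [Ioo_mem_nhdsGT hR.1] with r hr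
      using MSubharmonic.mem_radii_of_le hR hr.1 hr.2.le
  refine ⟨⟨μ, hμ, fun μ' h' => h'.unique hΩ hμ⟩, fun r hr => ⟨(hSI r hr).congr hE.symm hr, ?_⟩,
    ⟨ν, ν, _, hν0, hν, hl.congr' ?_, hL.congr' ?_, rfl, ?_⟩, ?_, ?_⟩
  · refine MSubharmonic.BallIntegrable.congr hE.symm hr ⟨?_,
      (hf.integrableOn_compact_subset hr.2 (isCompact_closedBall a r)).mono_set
        ball_subset_closedBall⟩
    rw [ae_restrict_iff' measurableSet_ball]
    filter_upwards [hψ.subharmonic.ae_ne_bot hn hΩ hm'] with z hz hzr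
    exact hz (hr.2 (ball_subset_closedBall hzr))
  · filter_upwards [hmem] with r hr
    rw [MSubharmonic.sphereMean_congr hE hr]
  · filter_upwards [hmem] with r hr
    rw [MSubharmonic.ballMean_congr hE hr]
  · have hn0 : (0 : ℝ) < n := by exact_mod_cast hn
    have h1 : (n / m : ℝ) ≤ n := div_le_self hn0.le (by exact_mod_cast hm)
    have h2 : (n : ℝ) - (n / m - 1) ≠ 0 := by linarith
    rw [show (n : ℝ) - n / m + 1 = n - (n / m - 1) by ring]
    generalize (n : ℝ) - (n / m - 1) = x at *
    field_simp
  · rintro ⟨C, hC⟩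
    -- The quotients of the spherical means by `φ_m` tend both to `ν` and, the means being bounded,
    -- to `0`.
    have h0 : ν = 0 := by
      refine tendsto_nhds_unique hl
        (MSubharmonic.tendsto_sphereMean_div_phi_of_bounded hm hmn (C := C) ?_)
      filter_upwards [hC, hΩ.mem_nhds ha] with z hz hzΩ
      rwa [← hE hzΩ]
    rw [← h0]
    exact hν
  · obtain ⟨G, h1, h2, h3⟩ := MSubharmonic.exists_convexOn_of_slope_bounds
      MSubharmonic.ordConnected_radii
      ((MSubharmonic.continuousOn_phi hm hmn).mono MSubharmonic.radii_subset_Ioi)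
      ((MSubharmonic.strictMonoOn_phi hm hmn).mono MSubharmonic.radii_subset_Ioi)
      (fun r _ => MSubharmonic.massQuot_nonneg r) hslope
    exact ⟨G, h1, h2, fun r hr => by rw [MSubharmonic.sphereMean_congr hE hr, h3 r hr]⟩
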